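/- Let $\rho\in C_0^\infty(\mathbb R)$ be real-valued. Let $-\Delta_\rho$ be the self-adjoint, semibounded operator in $L^2(\mathbb R^2)$ formally given by $-\partial_{x_1}^2-\partial_{x_2}^2+\rho(x_1)\,\delta(x_1-x_2)$, i.e. the operator associated with the quadratic form $$q_\rho(\psi)=\int_{\mathbb R^2}|\nabla\psi|^2\,d\boldsymbol{x}+\int_{\mathbb R}\rho(x)\,|\psi(x,x)|^2\,dx,\qquad \psi\in H^1(\mathbb R^2),$$ where $\psi(x,x)$ is the trace of $\psi$ on the diagonal. Let $R_\rho(z)=(-\Delta_\rho-z)^{-1}$ and, for $\alpha<\frac{\pi}{2}$, let $C_\alpha=\{z\in\mathbb C:\ |\arg z-\frac{\pi}{2}|<\alpha\}$. For every $\alpha<\frac{\pi}{2}$ and all $\lambda\in\mathbb C$ with $k=\sqrt{-\lambda}\in C_\alpha$ and $|\lambda|$ sufficiently large, the resolvents $R_\rho(-\lambda)$ and $R_0(-\lambda)$ exist and $R_\rho(-\lambda)-R_0(-\lambda)$ is trace class. Its trace $\operatorname{tr}_{\rm reg}R_\rho(-\lambda):=\operatorname{tr}\big(R_\rho(-\lambda)-R_0(-\lambda)\big)$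 has a complete asymptotic expansion $$\operatorname{tr}_{\rm reg}R_\rho(-\lambda)\sim\sum_{m=0}^\infty b_m\,\lambda^{-(\frac m2+1)},\qquad |\lambda|\to\infty,\quad k=\sqrt{-\lambda}\in C_\alpha$$ (principal branch of the powers of $\lambda$), that is, for every $M\in\mathbb N_0$, $$\operatorname{tr}_{\rm reg}R_\rho(-\lambda)-\sum_{m<M}b_m\lambda^{-(\frac m2+1)}=O\big(|\lambda|^{-(\frac M2+1)}\big)$$ uniformly for $\lambda$ with $k\in C_\alpha$. The coefficients are $$b_m=\frac18\sum_{n+l=m}(-2\pi)^{-(n+1)}b_{n,l},\qquad b_{n,l}=\sum_{|a|=l}\ \sum_{s}c_{a,s}\int_{\mathbb R}\frac{\partial^{|a|}\rho_{n,s}}{\partial w_0^{a_0}\cdots\partial w_{n-1}^{a_{n-1}}}(0,\ldots,0,y)\,dy .$$ Here $n,l\in\mathbb N_0$, $a\in\mathbb N_0^n$ with $|a|=a_0+\dots+a_{n-1}$, and $s$ runs through the maps $\{0,\ldots,n-1\}\to\{1,-1\}$; for $n=0$ the double sum has a single term (empty $a$ and $s$) if $l=0$ and is $0$ if $l>0$.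 Moreover $$\rho_{n,s}(w_0,\ldots,w_n)=\prod_{l=0}^n\rho\big(\phi^{-1}(s(0)w_0,\ldots,s(n-1)w_{n-1},w_n)_l\big),$$ where $\phi(y_0,\ldots,y_n)=(y_0-y_1,\ldots,y_{n-1}-y_n,y_n+y_0)$, that is, $\phi^{-1}(w)_l=\frac12\big(\sum_{m=l}^nw_m-\sum_{m=0}^{l-1}w_m\big)$, and the constants $c_{a,s}$ are the absolutely convergent integrals $$c_{a,s}=\int_{(0,\infty)^n}\int_{\mathbb R}\frac{d\xi\,dt_0\cdots dt_{n-1}}{(1+\xi^2)^{3/2}\prod_{j=0}^{n-1}\big(\sqrt2\,(\cosh t_j+\mathrm i\,\xi\,s(j))\big)^{a_j+1}},$$ so that for $n=0$ the constant is $\int_{\mathbb R}(1+\xi^2)^{-3/2}d\xi=2$ and $b_{0,0}=2\int_{\mathbb R}\rho(\frac y2)\,dy$. In particular, $$b_0=-\frac1{4\pi}\int_{\mathbb R}\rho(y)\,dy,\qquad b_1=\frac{\sqrt2}{64}\int_{\mathbb R}\rho(y)^2\,dy .$$ -/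

import Mathlib

open MeasureTheory Filter Topology
open scoped SchwartzMap LineDeriv ContDiff

noncomputable section

namespace DeltaDiagonal

/-! ### Trace class operators on a complex Hilbert space -/

section TraceClass

variable {H : Type} [NormedAddCommGroup H] [InnerProductSpace ℂ H] [CompleteSpace H]

/-- `T` is trace class (nuclear): `T = ∑ n, ⟪x n, ·⟫ y n` with `∑ n, ‖x n‖ ‖y n‖ < ∞`. On a Hilbert
space this is equivalent to the summability of the singular values of `T`. -/
def IsTraceClass (T : H →L[ℂ] H) : Prop :=
  ∃ x y : ℕ → H, Summable (fun n => ‖x n‖ * ‖y n‖) ∧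
    ∀ v : H, HasSum (fun n => inner ℂ (x n) v • y n) (T v)

/-- `T` is trace class and its trace, computed in any Hilbert basis, is `τ`. -/
def HasTrace (T : H →L[ℂ] H) (τ : ℂ) : Prop :=
  IsTraceClass T ∧
    ∀ (ι : Type) (e : HilbertBasis ι ℂ H), HasSum (fun i => inner ℂ (e i) (T (e i))) τ

open Classical in
/-- The trace of a trace class operator (with value `0` on other operators). -/
def trace (T : H →L[ℂ] H) : ℂ :=
  if h : ∃ τ, HasTrace T τ then h.choose else 0

end TraceClass

/-! ### The Schrödinger operator with a delta interaction on the diagonal of the plane -/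

/-- The Euclidean plane. -/
abbrev Plane : Type := EuclideanSpace ℝ (Fin 2)

/-- The Hilbert space `L²(ℝ²)`. -/
abbrev L2Plane : Type := Lp ℂ 2 (volume : Measure Plane)

/-- The Hilbert space `L²(ℝ)`. -/
abbrev L2Line : Type := Lp ℂ 2 (volume : Measure ℝ)

/-- The point `(x, x)` of the diagonal. -/
def diag (x : ℝ) : Plane := !₂[x, x]

/-- The standard unit vectors of the plane. -/
def unitVec (i : Fin 2) : Plane := EuclideanSpace.single i 1

/-- `g` is the gradient of `u` in the sense of distributions. Thus `u ∈ H¹(ℝ²)` if and only if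
`∃ g, HasWeakGradient u g`. -/
def HasWeakGradient (u : L2Plane) (g : Fin 2 → L2Plane) : Prop :=
  ∀ i, ∂_{unitVec i} (u : 𝓢'(Plane, ℂ)) = (g i : 𝓢'(Plane, ℂ))

/-- `Ψ(x) = u(x, x)` is the trace of `u ∈ H¹(ℝ²)` on the diagonal: it is the limit in `L²(ℝ)` of the
restrictions of Schwartz functions that converge to `u` in `H¹(ℝ²)`. -/
def IsDiagonalTrace (u : L2Plane) (Ψ : L2Line) : Prop :=
  ∃ g : Fin 2 → L2Plane, HasWeakGradient u g ∧
    ∃ φ : ℕ → 𝓢(Plane, ℂ),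
      Tendsto (fun n => (φ n).toLp 2 volume) atTop (𝓝 u) ∧
      (∀ i, Tendsto (fun n => (∂_{unitVec i} (φ n)).toLp 2 volume) atTop (𝓝 (g i))) ∧
      Tendsto (fun n => eLpNorm (fun x : ℝ => φ n (diag x) - Ψ x) 2 volume) atTop (𝓝 0)

/-- The sesquilinear form `∫_{ℝ²} ⟨∇v, ∇u⟩ dx + ∫_ℝ ρ(x) conj(v(x, x)) u(x, x) dx`, in terms of the
gradients `h`, `g` and the diagonal traces `Φ`, `Ψ` of `v` and `u`. -/
def form (ρ : ℝ → ℝ) (h : Fin 2 → L2Plane) (Φ : L2Line) (g : Fin 2 → L2Plane) (Ψ : L2Line) : ℂ :=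
  ∑ i, inner ℂ (h i) (g i) + ∫ x : ℝ, (ρ x : ℂ) * (starRingEnd ℂ (Φ x) * Ψ x)

/-- The graph of the operator `-Δ_ρ = -∂₁² - ∂₂² + ρ(x₁) δ(x₁ - x₂)` associated with the quadratic
form `q_ρ` on `H¹(ℝ²)`: `u` lies in the domain of `-Δ_ρ` and `-Δ_ρ u = f` if and only if
`u ∈ H¹(ℝ²)` and `q_ρ(v, u) = ⟪v, f⟫` for all `v ∈ H¹(ℝ²)`. -/
def DeltaLaplacian (ρ : ℝ → ℝ) (u f : L2Plane) : Prop :=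
  ∃ (g : Fin 2 → L2Plane) (Ψ : L2Line), HasWeakGradient u g ∧ IsDiagonalTrace u Ψ ∧
    ∀ (v : L2Plane) (h : Fin 2 → L2Plane) (Φ : L2Line),
      HasWeakGradient v h → IsDiagonalTrace v Φ → form ρ h Φ g Ψ = inner ℂ v f

/-- The bounded operator `R` is the resolvent `(-Δ_ρ - z)⁻¹`: for `u, f ∈ L²(ℝ²)` we have `R f = u`
if and only if `u` lies in the domain of `-Δ_ρ` and `-Δ_ρ u - z u = f`. -/
def IsResolvent (ρ : ℝ → ℝ) (z : ℂ) (R : L2Plane →L[ℂ] L2Plane) : Prop :=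
  ∀ u f : L2Plane, R f = u ↔ DeltaLaplacian ρ u (f + z • u)

/-- `z` lies in the resolvent set of `-Δ_ρ`. -/
def InResolventSet (ρ : ℝ → ℝ) (z : ℂ) : Prop :=
  ∃ R : L2Plane →L[ℂ] L2Plane, IsResolvent ρ z R

open Classical in
/-- The resolvent `R_ρ(z) = (-Δ_ρ - z)⁻¹` (with value `0` if `z` is in the spectrum). -/
def resolvent (ρ : ℝ → ℝ) (z : ℂ) : L2Plane →L[ℂ] L2Plane :=
  if h : InResolventSet ρ z then h.choose else 0

/-- The regularized resolvent `R_ρ(z) - R_0(z)`. -/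
def regResolvent (ρ : ℝ → ℝ) (z : ℂ) : L2Plane →L[ℂ] L2Plane :=
  resolvent ρ z - resolvent (fun _ => 0) z

/-- The regularized trace of the resolvent `R_ρ(z)`. -/
def trReg (ρ : ℝ → ℝ) (z : ℂ) : ℂ := trace (regResolvent ρ z)

/-- The open cone `C_α` around the positive imaginary axis. -/
def cone (α : ℝ) : Set ℂ := {z | |z.arg - Real.pi / 2| < α}

/-- The sector of all `lam` for which the square root `k = √(-lam)` lies in `C_α`. -/
def sector (α : ℝ) : Set ℂ := {lam | ∃ k ∈ cone α, k ^ 2 = -lam}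

/-! ### The coefficients -/

/-- The inverse of the map
`(y₀, …, yₙ) ↦ (y₀ - y₁, …, yₙ₋₁ - yₙ, yₙ + y₀)`. -/
def phiInv (n : ℕ) (w : Fin (n + 1) → ℝ) (l : Fin (n + 1)) : ℝ :=
  (∑ m ∈ Finset.univ.filter (fun m => l ≤ m), w m -
    ∑ m ∈ Finset.univ.filter (fun m => m < l), w m) / 2

/-- The real number `1` or `-1` given by a sign. -/
def sgn (s : ℤˣ) : ℝ := ((s : ℤ) : ℝ)

/-- `ρ_{n,s}(w₀, …, wₙ) = ∏_{l=0}^n ρ(φ⁻¹(s(0) w₀, …, s(n-1) wₙ₋₁, wₙ)_l)`; for `n = 0`, where there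
is just the empty sign map, this is `ρ(w₀ / 2)`. -/
def rhoNS (ρ : ℝ → ℝ) (n : ℕ) (s : Fin n → ℤˣ) (w : Fin (n + 1) → ℝ) : ℝ :=
  ∏ l : Fin (n + 1),
    ρ (phiInv n (Fin.snoc (fun j : Fin n => sgn (s j) * w j.castSucc) (w (Fin.last n))) l)

/-- The partial derivative of a function of finitely many real variables. -/
def partialDeriv {N : ℕ} (i : Fin N) (f : (Fin N → ℝ) → ℝ) : (Fin N → ℝ) → ℝ :=
  fun w => deriv (fun t : ℝ => f (Function.update w i t)) (w i)

/-- The mixed partial derivative `∂^{|a|} / (∂w₀^{a₀} ⋯ ∂wₙ₋₁^{aₙ₋₁})` of a function of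
`(w₀, …, wₙ)`. -/
def multiDeriv {n : ℕ} (a : Fin n → ℕ) (f : (Fin (n + 1) → ℝ) → ℝ) : (Fin (n + 1) → ℝ) → ℝ :=
  (List.finRange n).foldr (fun j F => (partialDeriv j.castSucc)^[a j] F) f

/-- The integrand
`(1 + ξ²)^{-3/2} ∏_{j<n} (√2 (cosh t_j + i ξ s(j)))^{-(a_j + 1)}` as a function of `(t, ξ)`. -/
def cIntegrand {n : ℕ} (a : Fin n → ℕ) (s : Fin n → ℤˣ) (p : (Fin n → ℝ) × ℝ) : ℂ :=
  1 / (((1 + p.2 ^ 2) ^ (3 / 2 : ℝ) : ℝ) *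
    ∏ j : Fin n, ((Real.sqrt 2 : ℂ) *
      ((Real.cosh (p.1 j) : ℂ) + Complex.I * (p.2 : ℂ) * (sgn (s j) : ℂ))) ^ (a j + 1))

/-- The domain of integration `(0, ∞)ⁿ × ℝ`. -/
def cDomain (n : ℕ) : Set ((Fin n → ℝ) × ℝ) :=
  (Set.univ.pi fun _ => Set.Ioi 0) ×ˢ Set.univ

/-- The constants `c_{a,s}`. -/
def cCoeff {n : ℕ} (a : Fin n → ℕ) (s : Fin n → ℤˣ) : ℂ :=
  ∫ p in cDomain n, cIntegrand a s p

/-- `b_{n,l} = ∑_{|a| = l, s} c_{a,s} ∫_ℝ (∂_a ρ_{n,s})(0, …, 0, y) dy`. For `n = 0` the sum has one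
term if `l = 0`, equal to `2 ∫_ℝ ρ(y / 2) dy`, and no term otherwise. -/
def bNL (ρ : ℝ → ℝ) (n l : ℕ) : ℂ :=
  ∑ a ∈ Finset.piAntidiag (Finset.univ : Finset (Fin n)) l, ∑ s : Fin n → ℤˣ,
    cCoeff a s *
      ((∫ y : ℝ, multiDeriv a (rhoNS ρ n s) (Fin.snoc (fun _ : Fin n => (0 : ℝ)) y) : ℝ) : ℂ)

/-- `b_m = (1/8) ∑_{n + l = m} (-2π)^{-(n+1)} b_{n,l}`. -/
def bCoeff (ρ : ℝ → ℝ) (m : ℕ) : ℂ :=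
  (1 / 8) * ∑ q ∈ Finset.HasAntidiagonal.antidiagonal m, bNL ρ q.1 q.2 / (-2 * (Real.pi : ℂ)) ^ (q.1 + 1)

end DeltaDiagonal

end

open MeasureTheory Filter Topology
open scoped SchwartzMap LineDeriv ContDiff

noncomputable section

namespace DeltaDiagonal

/-! Write `λ = κ²` with `Re κ > 0`; in the sector `Re κ ≥ δ|κ|` for a fixed `δ > 0`. On the Fourier
side the free resolvent is division by `symb κ`, and `(-Δ_ρ + κ²) u = f` reads `û = (f̂ - (ρΨ)^) /
symb κ`, where `Ψ` is the diagonal trace of `u` and `(ρΨ)^` is the Fourier transform of the measure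
`ρΨ dx` on the diagonal (`deltaLaplacian_iff`). Taking the trace of both sides leaves an equation on
the line, `Ψ = ⟨g_x, f̂⟩ - b_κ ∗ (ρΨ)` (`trace_eq`), with the Green function `g_x` of pole `(x, x)`
and the kernel `b_κ(y) = K₀(√2 κ|y|) / 2π`. The `L¹` norm of `b_κ` is `O(1/|κ|)`, so for large `κ`
this is a contraction. Its solution is `Ψ(x) = ⟨h_x, f̂⟩`, where `h` solves the analogous equation
for bounded continuous functions with values in `L²`.

Hence `R_ρ - R_0` is unitarily equivalent to `-∫ ρ(x) ⟨h_x, ·⟩ g_x dx`, an integral of rank one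
operators with square integrable factors. Such an integral is a product of two Hilbert–Schmidt
operators, hence trace class with trace `-∫ ρ(x) ⟨h_x, g_x⟩ dx` (`hasTrace_of_integral_rankOne`,
`trace_formula`). The Neumann series of `h` turns the trace into a sum over `n` of integrals of `∏
b_κ(w_j) · c_κ(∑ w_j)` against a smooth density in `w`, the integral of `ρ_{n,1}` over its last
variable (`pairing_iterate`); here `c_κ` is the kernel of the squared free resolvent on the
diagonal. The remainder after `N` terms is `O(|κ|^{-N-2})` (`neumann_solution`).

The kernels live on the scale `1/|κ|`, so a Taylor expansion of the density at `w = 0` gains one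
power of `1/|κ|` per order (`iterate_expansion`) and leaves the moments of the kernel. For real `κ`
these are computed by writing `c_κ` as a Fourier integral with weight `(1 + ξ²)^{-3/2}`, after which
the `w_j` separate; each `w_j`-integral is split at `0`, whence the signs `s(j)`, and the integral
representation of `K₀` gives the factors with `cosh t_j` (`moment_ofReal`). Both sides are
holomorphic in `κ`, so the identity theorem extends the formula to the half-plane (`moment_eq`).
Collecting powers of `1/κ` yields `b_m`. -/

instance fact_two_ne_top : Fact ((2 : ENNReal) ≠ ⊤) := ⟨ENNReal.ofNat_ne_top⟩

/-! ### Trace class operators and integrals of rank one operators -/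

section TraceClass

variable {H : Type} [NormedAddCommGroup H] [InnerProductSpace ℂ H]

/-- Distinct basis vectors are at distance `√2`, so the balls of radius `1/2` around them are
disjoint, and a separable space holds only countably many disjoint nonempty open sets. -/
theorem countable_hilbertBasis [TopologicalSpace.SeparableSpace H] {ι : Type}
    (e : HilbertBasis ι ℂ H) : Countable ι := by
  have hd : (Set.univ : Set ι).PairwiseDisjoint fun i => Metric.ball (e i) (1 / 2) := by
    intro i _ j _ hij
    refine Metric.ball_disjoint_ball ?_
    have h1 : ‖e i - e j‖ ^ 2 = 2 := by
      rw [@norm_sub_sq ℂ, e.orthonormal.1 i, e.orthonormal.1 j, e.orthonormal.2 hij]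
      norm_num
    rw [dist_eq_norm]
    nlinarith [norm_nonneg (e i - e j)]
  have := hd.countable_of_isOpen (fun i _ => Metric.isOpen_ball)
    (fun i _ => ⟨e i, Metric.mem_ball_self (by norm_num)⟩)
  exact Set.countable_univ_iff.1 this

/-- Cauchy–Schwarz followed by Bessel for `x` and for `y`. The bound does not depend on `s`, so it
gives absolute summability. -/
theorem sum_norm_inner_mul_inner_le {ι : Type} {e : ι → H} (he : Orthonormal ℂ e)
    (s : Finset ι) (x y : H) :
    ∑ i ∈ s, ‖inner ℂ x (e i) * inner ℂ (e i) y‖ ≤ ‖x‖ * ‖y‖ := by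
  have hx : ∑ i ∈ s, ‖inner ℂ x (e i)‖ ^ 2 ≤ ‖x‖ ^ 2 := by
    simpa [norm_inner_symm] using he.sum_inner_products_le x (s := s)
  have hy : ∑ i ∈ s, ‖inner ℂ (e i) y‖ ^ 2 ≤ ‖y‖ ^ 2 := he.sum_inner_products_le y
  simp_rw [norm_mul]
  refine (Real.sum_mul_le_sqrt_mul_sqrt _ _ _).trans ?_
  refine mul_le_mul ?_ ?_ (Real.sqrt_nonneg _) (norm_nonneg _)
  · exact Real.sqrt_le_iff.2 ⟨norm_nonneg _, hx⟩
  · exact Real.sqrt_le_iff.2 ⟨norm_nonneg _, hy⟩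

/-- The double series `⟨x_n, e_i⟩⟨e_i, y_n⟩` converges absolutely. Summed over `i` first it gives
`⟨x_n, y_n⟩` by Parseval, summed over `n` first it gives the diagonal matrix entries of `T`. -/
theorem hasTrace_of_nuclear {T : H →L[ℂ] H} {x y : ℕ → H}
    (hs : Summable fun n => ‖x n‖ * ‖y n‖)
    (hT : ∀ v : H, HasSum (fun n => inner ℂ (x n) v • y n) (T v)) :
    HasTrace T (∑' n, inner ℂ (x n) (y n)) := by
  refine ⟨⟨x, y, hs, hT⟩, fun ι e => ?_⟩
  let a : ℕ × ι → ℂ := fun p => inner ℂ (x p.1) (e p.2) * inner ℂ (e p.2) (y p.1)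
  have hrow : ∀ n, HasSum (fun i => a (n, i)) (inner ℂ (x n) (y n)) := fun n =>
    e.hasSum_inner_mul_inner (x n) (y n)
  have hrow' : ∀ n, Summable fun i => ‖a (n, i)‖ := fun n =>
    summable_of_sum_le (fun i => norm_nonneg _)
      (fun s => sum_norm_inner_mul_inner_le e.orthonormal s (x n) (y n))
  have hsum : Summable a := by
    refine Summable.of_norm ?_
    rw [summable_prod_of_nonneg (fun p => norm_nonneg _)]
    refine ⟨hrow', hs.of_nonneg_of_le (fun n => tsum_nonneg fun i => norm_nonneg _) fun n => ?_⟩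
    exact (hrow' n).tsum_le_of_sum_le
      (fun s => sum_norm_inner_mul_inner_le e.orthonormal s (x n) (y n))
  have hcol : ∀ i, HasSum (fun n => a (n, i)) (inner ℂ (e i) (T (e i))) := by
    intro i
    have := (hT (e i)).mapL (innerSL ℂ (e i))
    simpa [a, inner_smul_right] using this
  have h1 : HasSum a (∑' n, inner ℂ (x n) (y n)) := by
    have := hsum.hasSum.prod_fiberwise hrow
    rw [this.tsum_eq]
    exact hsum.hasSum
  have h2 := ((Equiv.prodComm ι ℕ).hasSum_iff.2 h1)
  exact h2.prod_fiberwise hcol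

variable [CompleteSpace H]

theorem HasTrace.unique {T : H →L[ℂ] H} {τ τ' : ℂ} (h : HasTrace T τ) (h' : HasTrace T τ') :
    τ = τ' := by
  obtain ⟨w, b, -⟩ := exists_hilbertBasis ℂ H
  exact (h.2 _ b).unique (h'.2 _ b)

theorem HasTrace.trace_eq {T : H →L[ℂ] H} {τ : ℂ} (h : HasTrace T τ) : trace T = τ := by
  have hex : ∃ τ, HasTrace T τ := ⟨τ, h⟩
  rw [trace, dif_pos hex]
  exact hex.choose_spec.unique h

theorem memLp_two_inner_bound {g : ℝ → H} (hg : MemLp g 2) (z : H) :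
    ‖((hg.inner_const (𝕜 := ℂ) z).toLp _ : L2Line)‖ ^ 2 = ∫ x, ‖inner ℂ (g x) z‖ ^ 2 := by
  have h := L2.inner_def (𝕜 := ℂ) ((hg.inner_const (𝕜 := ℂ) z).toLp _) ((hg.inner_const (𝕜 := ℂ) z).toLp _)
  rw [inner_self_eq_norm_sq_to_K] at h
  have h2 : ∫ a, inner ℂ (((hg.inner_const (𝕜 := ℂ) z).toLp _ : L2Line) a) (((hg.inner_const (𝕜 := ℂ) z).toLp _ : L2Line) a)
      = ((∫ x, ‖inner ℂ (g x) z‖ ^ 2 : ℝ) : ℂ) := by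
    rw [← integral_complex_ofReal]
    refine integral_congr_ae ?_
    filter_upwards [(hg.inner_const (𝕜 := ℂ) z).coeFn_toLp] with a ha
    rw [ha, inner_self_eq_norm_sq_to_K]
    norm_cast
  rw [h2] at h
  exact Complex.ofReal_injective (by simpa using h)

theorem inner_integral_smul {g : ℝ → H} (hg : MemLp g 2) (F : L2Line) (z : H) :
    inner ℂ z (∫ x, F x • g x) = inner ℂ ((hg.inner_const (𝕜 := ℂ) z).toLp _ : L2Line) F := by
  have hint : Integrable fun x => F x • g x := memLp_one_iff_integrable.1 (hg.smul (Lp.memLp F))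
  rw [← integral_inner hint, L2.inner_def]
  refine integral_congr_ae ?_
  filter_upwards [(hg.inner_const (𝕜 := ℂ) z).coeFn_toLp] with a ha
  rw [ha, inner_smul_right, RCLike.inner_apply, inner_conj_symm]

/-- The map `F ↦ ∫ F g` from `L²(ℝ)` to `H` has Hilbert–Schmidt norm at most `‖g‖_{L²}`. Parseval in
a basis of `H` exchanges the roles of the two spaces, and Bessel is then used once in `L²(ℝ)` and
once in `H`. -/
theorem sum_norm_integral_smul_sq_le {g : ℝ → H} (hg : MemLp g 2) {ι : Type} {φ : ι → L2Line}
    (hφ : Orthonormal ℂ φ) (s : Finset ι) :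
    ∑ i ∈ s, ‖∫ x, φ i x • g x‖ ^ 2 ≤ ∫ x, ‖g x‖ ^ 2 := by
  obtain ⟨w, e, -⟩ := exists_hilbertBasis ℂ H
  have hsq : Integrable fun x => ‖g x‖ ^ 2 := (memLp_two_iff_integrable_sq_norm hg.1).1 hg
  have hP : ∀ z : H, HasSum (fun j => ‖inner ℂ (e j) z‖ ^ 2) (‖z‖ ^ 2) := by
    intro z
    have h := e.hasSum_inner_mul_inner z z
    rw [inner_self_eq_norm_sq_to_K] at h
    have h' := Complex.hasSum_re h
    convert h' using 1
    · ext j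
      rw [← inner_conj_symm z (e j), RCLike.conj_mul]
      norm_cast
    · norm_cast
  have hlim : HasSum (fun j => ∑ i ∈ s, ‖inner ℂ (e j) (∫ x, φ i x • g x)‖ ^ 2)
      (∑ i ∈ s, ‖∫ x, φ i x • g x‖ ^ 2) := hasSum_sum fun i _ => hP _
  refine le_of_tendsto' hlim fun t => ?_
  calc ∑ j ∈ t, ∑ i ∈ s, ‖inner ℂ (e j) (∫ x, φ i x • g x)‖ ^ 2
      ≤ ∑ j ∈ t, ∫ x, ‖inner ℂ (g x) (e j)‖ ^ 2 := by
        refine Finset.sum_le_sum fun j _ => ?_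
        rw [← memLp_two_inner_bound hg]
        simp_rw [inner_integral_smul hg]
        simpa [norm_inner_symm] using
          hφ.sum_inner_products_le ((hg.inner_const (𝕜 := ℂ) ((e j) : H)).toLp _) (s := s)
    _ = ∫ x, ∑ j ∈ t, ‖inner ℂ (g x) (e j)‖ ^ 2 := by
        rw [integral_finsetSum]
        intro j _
        exact (memLp_two_iff_integrable_sq_norm (hg.inner_const _).1).1 (hg.inner_const _)
    _ ≤ ∫ x, ‖g x‖ ^ 2 := by
        refine integral_mono ?_ hsq fun x => ?_
        · refine integrable_finsetSum _ fun j _ => ?_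
          exact (memLp_two_iff_integrable_sq_norm (hg.inner_const _).1).1 (hg.inner_const _)
        · simpa [norm_inner_symm] using e.orthonormal.sum_inner_products_le (g x) (s := t)

/-- An integral of rank one operators with square integrable factors is trace class, and its trace
is the integral of the traces. -/
theorem hasTrace_of_integral_rankOne [TopologicalSpace.SeparableSpace H]
    {g h : ℝ → H} (hg : MemLp g 2) (hh : MemLp h 2) {T : H →L[ℂ] H}
    (hT : ∀ z v : H, inner ℂ z (T v) = ∫ x, inner ℂ (h x) v * inner ℂ z (g x)) :
    HasTrace T (∫ x, inner ℂ (h x) (g x)) := by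
  obtain ⟨w, φ, -⟩ := exists_hilbertBasis ℂ L2Line
  have := countable_hilbertBasis φ
  -- Expanding both factors in an orthonormal basis of `L²(ℝ)` turns the integral of rank one
  -- operators into a series of them; Parseval in `L²(ℝ)` identifies its sum with `T`.
  let y : w → H := fun i => ∫ t, φ i t • g t
  let x : w → H := fun i => ∫ t, φ i t • h t
  have hsy : Summable fun i => ‖y i‖ ^ 2 := summable_of_sum_le (fun i => sq_nonneg _)
    (fun s => sum_norm_integral_smul_sq_le hg φ.orthonormal s)
  have hsx : Summable fun i => ‖x i‖ ^ 2 := summable_of_sum_le (fun i => sq_nonneg _)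
    (fun s => sum_norm_integral_smul_sq_le hh φ.orthonormal s)
  have hxy : Summable fun i => ‖x i‖ * ‖y i‖ := by
    refine Summable.of_nonneg_of_le (fun i => by positivity) (fun i => ?_) (hsx.add hsy)
    nlinarith [sq_nonneg (‖x i‖ - ‖y i‖), sq_nonneg (‖x i‖), sq_nonneg ‖y i‖]
  have hTv : ∀ v, HasSum (fun i => inner ℂ (x i) v • y i) (T v) := by
    intro v
    have hs : Summable fun i => inner ℂ (x i) v • y i := by
      refine Summable.of_norm_bounded (hxy.mul_left ‖v‖) fun i => ?_
      rw [norm_smul]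
      calc _ ≤ (‖x i‖ * ‖v‖) * ‖y i‖ := by gcongr; exact norm_inner_le_norm _ _
        _ = _ := by ring
    have : ∑' i, inner ℂ (x i) v • y i = T v := by
      refine ext_inner_left ℂ fun z => ?_
      have h1 := hs.hasSum.mapL (innerSL ℂ z)
      have h2 : HasSum (fun i => inner ℂ z (inner ℂ (x i) v • y i)) (inner ℂ z (T v)) := by
        have h3 := φ.hasSum_inner_mul_inner ((hg.inner_const (𝕜 := ℂ) z).toLp _)
          ((hh.inner_const (𝕜 := ℂ) v).toLp _)
        have e1 : (fun i => inner ℂ z (inner ℂ (x i) v • y i)) = fun i =>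
            inner ℂ ((hg.inner_const (𝕜 := ℂ) z).toLp _ : L2Line) (φ i) *
              inner ℂ (φ i) ((hh.inner_const (𝕜 := ℂ) v).toLp _ : L2Line) := by
          ext i
          rw [inner_smul_right, mul_comm, ← inner_integral_smul hg, ← inner_conj_symm (φ i),
            ← inner_integral_smul hh, inner_conj_symm]
        have e2 : inner ℂ z (T v) = inner ℂ ((hg.inner_const (𝕜 := ℂ) z).toLp _ : L2Line)
            ((hh.inner_const (𝕜 := ℂ) v).toLp _ : L2Line) := by
          rw [hT, L2.inner_def]
          refine integral_congr_ae ?_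
          filter_upwards [(hg.inner_const (𝕜 := ℂ) z).coeFn_toLp,
            (hh.inner_const (𝕜 := ℂ) v).coeFn_toLp] with a ha hb
          rw [ha, hb, RCLike.inner_apply, inner_conj_symm]
        rw [e1, e2]
        exact h3
      exact (by simpa using h1 : HasSum (fun i => inner ℂ z (inner ℂ (x i) v • y i)) _).unique h2
    rw [← this]
    exact hs.hasSum
  -- The definition of trace class sums over `ℕ`, so the countable index set is injected into `ℕ`
  -- and the families are extended by zero.
  obtain ⟨f, hf⟩ := Countable.exists_injective_nat w
  have hex : ∀ (u : w → H) (n : ℕ), n ∉ Set.range f → Function.extend f u 0 n = 0 := by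
    intro u n hn
    rw [Function.extend_apply' _ _ _ (by simpa using hn)]
    rfl
  have hnuc : HasTrace T (∑' n, inner ℂ (Function.extend f x 0 n) (Function.extend f y 0 n)) := by
    refine hasTrace_of_nuclear ?_ fun v => ?_
    · refine (hf.summable_iff fun n hn => ?_).1 ?_
      · simp [hex x n hn]
      · simpa [Function.comp_def, hf.extend_apply] using hxy
    · refine (hf.hasSum_iff fun n hn => ?_).1 ?_
      · simp [hex x n hn]
      · simpa [Function.comp_def, hf.extend_apply] using hTv v
  -- The trace exists by now; its value is read off in one basis of `H`, exchanging the sum with the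
  -- integral over `t`.
  obtain ⟨w', e, -⟩ := exists_hilbertBasis ℂ H
  have := countable_hilbertBasis e
  have hint : Integrable fun t => ‖h t‖ * ‖g t‖ := hh.norm.integrable_mul hg.norm
  have hi : ∀ j, Integrable fun t => inner ℂ (h t) (e j) * inner ℂ (e j) (g t) := fun j =>
    (hh.inner_const (e j)).integrable_mul (hg.const_inner (e j))
  have hval := hasSum_integral_of_summable_integral_norm hi
    (summable_of_sum_le (c := ∫ t, ‖h t‖ * ‖g t‖)
      (fun j => integral_nonneg fun t => norm_nonneg _) fun s => by
        rw [← integral_finsetSum _ fun j _ => (hi j).norm]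
        exact integral_mono (integrable_finsetSum _ fun j _ => (hi j).norm) hint
          fun t => sum_norm_inner_mul_inner_le e.orthonormal s (h t) (g t))
  have hval' : HasSum (fun j => inner ℂ (e j) (T (e j))) (∫ t, inner ℂ (h t) (g t)) := by
    have e2 : ∫ t, inner ℂ (h t) (g t) =
        ∫ t, ∑' j, inner ℂ (h t) (e j) * inner ℂ (e j) (g t) :=
      integral_congr_ae (Eventually.of_forall fun t =>
        (e.hasSum_inner_mul_inner (h t) (g t)).tsum_eq.symm)
    simp_rw [hT]
    rw [e2]
    exact hval
  rw [hval'.unique (hnuc.2 _ e)]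
  exact hnuc

end TraceClass

end DeltaDiagonal

namespace DeltaDiagonal

open Set

/-! ### Elementary integrals with a complex parameter in the right half-plane -/

section OneDim

/-- Both sides split in the same way: `|r + κ²|² = (r - |κ|²)² + 4r (Re κ)²` and `(r + |κ|²)² = (r -
|κ|²)² + 4r|κ|²`. This is the ellipticity of `-Δ + κ²`, uniform in the sector. -/
theorem norm_add_sq_ge {κ : ℂ} {δ r : ℝ} (hδ0 : 0 ≤ δ) (hδ1 : δ ≤ 1) (hr : 0 ≤ r)
    (h : δ * ‖κ‖ ≤ κ.re) : δ * (r + ‖κ‖ ^ 2) ≤ ‖(r : ℂ) + κ ^ 2‖ := by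
  have hn : ‖κ‖ ^ 2 = κ.re ^ 2 + κ.im ^ 2 := by
    rw [← Complex.normSq_eq_norm_sq, Complex.normSq_apply]; ring
  have hm : ‖(r : ℂ) + κ ^ 2‖ ^ 2 = (r + κ.re ^ 2 - κ.im ^ 2) ^ 2 + (2 * κ.re * κ.im) ^ 2 := by
    rw [← Complex.normSq_eq_norm_sq, Complex.normSq_apply]
    simp [sq]
    ring
  have h1 : δ ^ 2 * ‖κ‖ ^ 2 ≤ κ.re ^ 2 := by
    have : 0 ≤ δ * ‖κ‖ := by positivity
    nlinarith
  refine (sq_le_sq₀ (by positivity) (norm_nonneg _)).1 ?_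
  rw [hm, mul_pow]
  have h2 : δ ^ 2 * (r - ‖κ‖ ^ 2) ^ 2 ≤ (r - ‖κ‖ ^ 2) ^ 2 := by
    have : δ ^ 2 ≤ 1 := by nlinarith
    nlinarith [sq_nonneg (r - ‖κ‖ ^ 2)]
  have h3 : r * (δ ^ 2 * ‖κ‖ ^ 2) ≤ r * κ.re ^ 2 := mul_le_mul_of_nonneg_left h1 hr
  rw [hn] at *
  nlinarith

theorem add_sq_ne_zero {κ : ℂ} (h : 0 < κ.re) {r : ℝ} (hr : 0 ≤ r) : (r : ℂ) + κ ^ 2 ≠ 0 := by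
  have hκ : 0 < ‖κ‖ := norm_pos_iff.2 (by rintro rfl; simp at h)
  have h1 : κ.re / ‖κ‖ ≤ 1 := (div_le_one hκ).2 (Complex.re_le_norm κ)
  have := norm_add_sq_ge (κ := κ) (δ := κ.re / ‖κ‖) (by positivity) h1 hr
    (by rw [div_mul_cancel₀ _ hκ.ne'])
  rw [← norm_pos_iff]
  refine lt_of_lt_of_le ?_ this
  positivity

/-- Since `r + κ²` avoids the closed negative axis, half of its principal argument lies in `(-π/2,
π/2)`. -/
theorem exists_sq_eq {κ : ℂ} (h : 0 < κ.re) {r : ℝ} (hr : 0 ≤ r) :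
    ∃ c : ℂ, 0 < c.re ∧ c ^ 2 = r + κ ^ 2 := by
  have hs : (r : ℂ) + κ ^ 2 ∈ Complex.slitPlane := by
    rw [Complex.mem_slitPlane_iff]
    by_cases hi : κ.im = 0
    · left; simp [sq, hi]; positivity
    · right; simp [sq]; ring_nf; simp [hi, h.ne']
  have h0 : (r : ℂ) + κ ^ 2 ≠ 0 := Complex.slitPlane_ne_zero hs
  refine ⟨Complex.exp (Complex.log (r + κ ^ 2) / 2), ?_, ?_⟩
  · rw [Complex.exp_re]
    have h1 := Complex.mem_slitPlane_iff_arg.1 hs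
    refine mul_pos (Real.exp_pos _) (Real.cos_pos_of_mem_Ioo ?_)
    have h2 := Complex.neg_pi_lt_arg ((r : ℂ) + κ ^ 2)
    have h3 := lt_of_le_of_ne (Complex.arg_le_pi ((r : ℂ) + κ ^ 2)) h1.1
    have h4 : (Complex.log (r + κ ^ 2) / 2).im = Complex.arg (r + κ ^ 2) / 2 := by
      rw [show (2 : ℂ) = ((2 : ℝ) : ℂ) by norm_num, Complex.div_ofReal_im, Complex.log_im]
    rw [h4]
    constructor <;> linarith
  · rw [← Complex.exp_nat_mul]
    push_cast
    rw [mul_div_cancel₀ _ two_ne_zero, Complex.exp_log h0]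

theorem integrable_inv_sq_add {z : ℂ} (hz : 0 < z.re) :
    Integrable fun u : ℝ => 1 / ((u : ℂ) ^ 2 + z ^ 2) := by
  have hn : 0 < ‖z‖ := norm_pos_iff.2 (by rintro rfl; simp at hz)
  set δ := z.re / ‖z‖ with hδ
  have hδ0 : 0 < δ := by positivity
  have h1 : δ ≤ 1 := (div_le_one hn).2 (Complex.re_le_norm z)
  set c := δ * min 1 (‖z‖ ^ 2) with hc
  have hc0 : 0 < c := by positivity
  refine (integrable_inv_one_add_sq.const_mul c⁻¹).mono' ?_ (Eventually.of_forall fun u => ?_)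
  · refine Continuous.aestronglyMeasurable ?_
    refine continuous_const.div (by fun_prop) fun u => ?_
    have := add_sq_ne_zero hz (sq_nonneg u)
    push_cast at this
    exact this
  · rw [norm_div, norm_one, one_div, ← mul_inv]
    refine inv_anti₀ (by positivity) ?_
    have h2 := norm_add_sq_ge hδ0.le h1 (sq_nonneg u) (by rw [hδ, div_mul_cancel₀ _ hn.ne'])
    push_cast at h2
    refine le_trans ?_ h2
    rw [hc, mul_assoc]
    refine mul_le_mul_of_nonneg_left ?_ hδ0.le
    nlinarith [min_le_left 1 (‖z‖ ^ 2), min_le_right 1 (‖z‖ ^ 2), sq_nonneg u]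

/-- For complex `z` the arctangent is replaced by a difference of logarithms of `z ± iu`, which stay
in the right half-plane. At infinity the positive factor `u` cancels and `log i - log(-i) = πi`
remains. -/
theorem integral_Ioi_inv_sq_add {z : ℂ} (hz : 0 < z.re) :
    ∫ u : ℝ in Ioi 0, 1 / ((u : ℂ) ^ 2 + z ^ 2) = Real.pi / (2 * z) := by
  have hz0 : z ≠ 0 := by rintro rfl; simp at hz
  let F : ℝ → ℂ := fun u => (1 / (2 * Complex.I * z)) *
    (Complex.log (z + Complex.I * u) - Complex.log (z - Complex.I * u))
  have hp : ∀ u : ℝ, z + Complex.I * u ∈ Complex.slitPlane := fun u => by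
    rw [Complex.mem_slitPlane_iff]; left; simpa using hz
  have hm : ∀ u : ℝ, z - Complex.I * u ∈ Complex.slitPlane := fun u => by
    rw [Complex.mem_slitPlane_iff]; left; simpa using hz
  have hd : ∀ u ∈ Ici (0 : ℝ), HasDerivAt F (1 / ((u : ℂ) ^ 2 + z ^ 2)) u := by
    intro u _
    have hu : HasDerivAt (fun u : ℝ => (u : ℂ)) 1 u := Complex.ofRealCLM.hasDerivAt
    have h1 : HasDerivAt (fun u : ℝ => z + Complex.I * u) (Complex.I * 1) u :=
      (hu.const_mul _).const_add z
    have h2 : HasDerivAt (fun u : ℝ => z - Complex.I * u) (-(Complex.I * 1)) u :=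
      (hu.const_mul _).const_sub z
    have h3 := ((h1.clog_real (hp u)).sub (h2.clog_real (hm u))).const_mul
      (1 / (2 * Complex.I * z))
    refine h3.congr_deriv ?_
    have n1 := Complex.slitPlane_ne_zero (hp u)
    have n2 := Complex.slitPlane_ne_zero (hm u)
    have n3 : (u : ℂ) ^ 2 + z ^ 2 = (z + Complex.I * u) * (z - Complex.I * u) := by
      ring_nf; rw [Complex.I_sq]; ring
    rw [n3]
    field_simp
    ring
  have hlim : Tendsto F atTop (𝓝 (Real.pi / (2 * z))) := by
    have hinv : Tendsto (fun u : ℝ => z / (u : ℂ)) atTop (𝓝 0) := by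
      have h : Tendsto (fun u : ℝ => ((u⁻¹ : ℝ) : ℂ)) atTop (𝓝 ((0 : ℝ) : ℂ)) :=
        (Complex.continuous_ofReal.tendsto 0).comp tendsto_inv_atTop_zero
      have := h.const_mul z
      simpa [div_eq_mul_inv] using this
    have hI : Complex.I ∈ Complex.slitPlane := by simp [Complex.mem_slitPlane_iff]
    have hnI : -Complex.I ∈ Complex.slitPlane := by simp [Complex.mem_slitPlane_iff]
    have h1 : Tendsto (fun u : ℝ => Complex.log (z / u + Complex.I)) atTop
        (𝓝 (Complex.log Complex.I)) := by
      have := (hinv.add_const Complex.I)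
      rw [zero_add] at this
      exact this.clog hI
    have h2 : Tendsto (fun u : ℝ => Complex.log (z / u + -Complex.I)) atTop
        (𝓝 (Complex.log (-Complex.I))) := by
      have := (hinv.add_const (-Complex.I))
      rw [zero_add] at this
      exact this.clog hnI
    have h3 := (h1.sub h2).const_mul (1 / (2 * Complex.I * z))
    have h4 : 1 / (2 * Complex.I * z) * (Complex.log Complex.I - Complex.log (-Complex.I)) =
        Real.pi / (2 * z) := by
      rw [Complex.log_I, Complex.log_neg_I]
      field_simp
      ring
    rw [h4] at h3
    refine h3.congr' ?_
    filter_upwards [eventually_gt_atTop 0] with u hu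
    have hu0 : (u : ℂ) ≠ 0 := by exact_mod_cast hu.ne'
    have e1 : z + Complex.I * u = (u : ℂ) * (z / u + Complex.I) := by field_simp
    have e2 : z - Complex.I * u = (u : ℂ) * (z / u + -Complex.I) := by field_simp; ring
    have n1 : z / u + Complex.I ≠ 0 := fun h => Complex.slitPlane_ne_zero (hp u) (by rw [e1, h, mul_zero])
    have n2 : z / u + -Complex.I ≠ 0 := fun h => Complex.slitPlane_ne_zero (hm u) (by rw [e2, h, mul_zero])
    simp only [F]
    rw [e1, e2, Complex.log_ofReal_mul hu n1, Complex.log_ofReal_mul hu n2]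
    ring
  rw [integral_Ioi_of_hasDerivAt_of_tendsto' hd (integrable_inv_sq_add hz).integrableOn hlim]
  simp [F]

theorem integral_eq_Ioi_add {E : Type*} [NormedAddCommGroup E] [NormedSpace ℝ E] {f : ℝ → E}
    (hf : Integrable f) : ∫ x, f x = (∫ x in Ioi 0, f x) + ∫ x in Ioi 0, f (-x) := by
  rw [← intervalIntegral.integral_Iic_add_Ioi (b := 0) hf.integrableOn hf.integrableOn, add_comm]
  congr 1
  rw [integral_comp_neg_Ioi, neg_zero]

theorem integrable_of_integrableOn_Ioi {E : Type*} [NormedAddCommGroup E] {f : ℝ → E}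
    (h1 : IntegrableOn f (Ioi 0)) (h2 : IntegrableOn (fun x => f (-x)) (Ioi 0)) :
    Integrable f := by
  have h3 : IntegrableOn f (Iio 0) := by
    have := ((Measure.measurePreserving_neg (volume : Measure ℝ)).integrableOn_comp_preimage
      (Homeomorph.neg ℝ).measurableEmbedding (f := f) (s := Iio 0))
    refine this.1 ?_
    simpa [Function.comp_def] using h2
  rw [← integrableOn_univ, ← Iic_union_Ioi (a := (0 : ℝ))]
  exact ((integrableOn_Iic_iff_integrableOn_Iio (by finiteness)).2 h3).union h1

theorem integral_inv_sq_add {z : ℂ} (hz : 0 < z.re) :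
    ∫ u : ℝ, 1 / ((u : ℂ) ^ 2 + z ^ 2) = Real.pi / z := by
  have hz0 : z ≠ 0 := by rintro rfl; simp at hz
  rw [integral_eq_Ioi_add (integrable_inv_sq_add hz)]
  simp only [Complex.ofReal_neg, neg_sq]
  rw [integral_Ioi_inv_sq_add hz]
  field_simp
  ring

theorem integrable_inv_one_add_sq_sq : Integrable fun u : ℝ => 1 / (1 + u ^ 2) ^ 2 := by
  refine integrable_inv_one_add_sq.mono' ?_ (Eventually.of_forall fun u => ?_)
  · exact (continuous_const.div (by fun_prop) fun u => by positivity).aestronglyMeasurable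
  · rw [Real.norm_of_nonneg (by positivity), one_div]
    exact inv_anti₀ (by positivity) (by nlinarith [sq_nonneg u])

theorem integral_inv_one_add_sq_sq : ∫ u : ℝ, 1 / (1 + u ^ 2) ^ 2 = Real.pi / 2 := by
  let F : ℝ → ℝ := fun u => (u * (1 + u ^ 2)⁻¹ + Real.arctan u) / 2
  have hd : ∀ u, HasDerivAt F (1 / (1 + u ^ 2) ^ 2) u := by
    intro u
    have h1 : HasDerivAt (fun u : ℝ => 1 + u ^ 2) (2 * u) u := by
      simpa using (hasDerivAt_pow 2 u).const_add 1
    have h2 := (((hasDerivAt_id u).mul (h1.inv (by positivity))).add (Real.hasDerivAt_arctan u)).div_const 2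
    refine h2.congr_deriv ?_
    have : (1 + u ^ 2 : ℝ) ≠ 0 := by positivity
    simp only [id, Pi.inv_apply]
    field_simp
    ring
  have hq : ∀ l : Filter ℝ, Tendsto (fun u : ℝ => |u|) l atTop →
      Tendsto (fun u : ℝ => u * (1 + u ^ 2)⁻¹) l (𝓝 0) := by
    intro l hl
    refine squeeze_zero_norm' ?_ (tendsto_inv_atTop_zero.comp hl)
    filter_upwards [hl.eventually_gt_atTop 0] with u hu
    rw [norm_mul, Real.norm_eq_abs, Real.norm_of_nonneg (by positivity), Function.comp]
    have : |u| * |u| = u ^ 2 := by rw [abs_mul_abs_self, sq]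
    rw [← div_eq_mul_inv, div_le_iff₀ (by positivity), inv_mul_eq_div, le_div_iff₀ hu]
    nlinarith
  have ht : Tendsto F atTop (𝓝 ((0 + Real.pi / 2) / 2)) :=
    ((hq _ tendsto_abs_atTop_atTop).add
      (tendsto_nhds_of_tendsto_nhdsWithin Real.tendsto_arctan_atTop)).div_const 2
  have hb : Tendsto F atBot (𝓝 ((0 + -(Real.pi / 2)) / 2)) :=
    ((hq _ tendsto_abs_atBot_atTop).add
      (tendsto_nhds_of_tendsto_nhdsWithin Real.tendsto_arctan_atBot)).div_const 2
  rw [integral_of_hasDerivAt_of_tendsto hd integrable_inv_one_add_sq_sq hb ht]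
  ring

theorem rpow_three_halves {x : ℝ} (hx : 0 ≤ x) : x ^ (3 / 2 : ℝ) = x * √x := by
  rw [show (3 / 2 : ℝ) = 1 + 1 / 2 by norm_num, Real.rpow_add' hx (by norm_num), Real.rpow_one,
    Real.sqrt_eq_rpow]

theorem integrable_inv_rpow_three_halves :
    Integrable fun u : ℝ => 1 / (1 + u ^ 2) ^ (3 / 2 : ℝ) := by
  refine integrable_inv_one_add_sq.mono' ?_ (Eventually.of_forall fun u => ?_)
  · refine (continuous_const.div ?_ fun u => by positivity).aestronglyMeasurable
    exact (by fun_prop : Continuous fun u : ℝ => 1 + u ^ 2).rpow_const fun u => Or.inr (by norm_num)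
  · rw [Real.norm_of_nonneg (by positivity), one_div]
    refine inv_anti₀ (by positivity) ?_
    have h1 : (1 : ℝ) ≤ 1 + u ^ 2 := by nlinarith [sq_nonneg u]
    simpa using Real.rpow_le_rpow_of_exponent_le h1 (by norm_num : (1 : ℝ) ≤ 3 / 2)

theorem integral_inv_rpow_three_halves :
    ∫ u : ℝ, 1 / (1 + u ^ 2) ^ (3 / 2 : ℝ) = 2 := by
  let F : ℝ → ℝ := fun u => u / √(1 + u ^ 2)
  have hd : ∀ u, HasDerivAt F (1 / (1 + u ^ 2) ^ (3 / 2 : ℝ)) u := by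
    intro u
    have h1 : HasDerivAt (fun u : ℝ => 1 + u ^ 2) (2 * u) u := by
      simpa using (hasDerivAt_pow 2 u).const_add 1
    have hp : (0 : ℝ) < 1 + u ^ 2 := by positivity
    have hs : (0 : ℝ) < √(1 + u ^ 2) := Real.sqrt_pos.2 hp
    have h2 := (hasDerivAt_id u).div (h1.sqrt hp.ne') hs.ne'
    refine h2.congr_deriv ?_
    rw [rpow_three_halves hp.le]
    simp only [id]
    have h3 : √(1 + u ^ 2) ^ 2 = 1 + u ^ 2 := Real.sq_sqrt hp.le
    field_simp
    rw [h3]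
    ring
  have hq : Tendsto (fun u : ℝ => √(1 + (u⁻¹) ^ 2)) atTop (𝓝 1) := by
    have h1 : Tendsto (fun u : ℝ => √(1 + (u⁻¹) ^ 2)) atTop (𝓝 √(1 + 0 ^ 2)) :=
      ((tendsto_inv_atTop_zero.pow 2).const_add 1).sqrt
    simpa using h1
  have hrel : ∀ u : ℝ, 0 < u → F u = (√(1 + (u⁻¹) ^ 2))⁻¹ := by
    intro u hu
    have : √(1 + u ^ 2) = u * √(1 + (u⁻¹) ^ 2) := by
      rw [← Real.sqrt_sq hu.le, ← Real.sqrt_mul (sq_nonneg _), Real.sqrt_sq hu.le]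
      congr 1; field_simp; ring
    simp only [F]
    rw [this]
    have : √(1 + (u⁻¹) ^ 2) ≠ 0 := by positivity
    field_simp
  have ht : Tendsto F atTop (𝓝 1) := by
    have := hq.inv₀ one_ne_zero
    rw [inv_one] at this
    refine this.congr' ?_
    filter_upwards [eventually_gt_atTop 0] with u hu using (hrel u hu).symm
  have hb : Tendsto F atBot (𝓝 (-1)) := by
    have h1 : Tendsto (fun u => -F (-u)) atBot (𝓝 (-1)) := (ht.comp tendsto_neg_atBot_atTop).neg
    refine h1.congr fun u => ?_
    simp [F, neg_div]
  rw [integral_of_hasDerivAt_of_tendsto hd integrable_inv_rpow_three_halves hb ht]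
  norm_num

theorem integrableOn_pow_mul_exp {c : ℝ} (hc : 0 < c) (s : ℝ) (hs : -1 < s) :
    IntegrableOn (fun w : ℝ => w ^ s * Real.exp (-(c * w))) (Ioi 0) := by
  have := integrableOn_rpow_mul_exp_neg_mul_rpow hs one_pos hc
  simpa using this

theorem norm_cexp_neg_mul (c : ℂ) (w : ℝ) :
    ‖Complex.exp (-(c * w))‖ = Real.exp (-(c.re * w)) := by
  rw [Complex.norm_exp]; simp

theorem integrableOn_pow_mul_cexp {c : ℂ} (hc : 0 < c.re) (a : ℕ) :
    IntegrableOn (fun w : ℝ => (w : ℂ) ^ a * Complex.exp (-(c * w))) (Ioi 0) := by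
  refine (integrableOn_pow_mul_exp hc a (by linarith [a.cast_nonneg (α := ℝ)])).mono' ?_ ?_
  · exact Continuous.aestronglyMeasurable (by fun_prop)
  · filter_upwards [ae_restrict_mem measurableSet_Ioi] with w hw
    rw [norm_mul, norm_cexp_neg_mul, norm_pow, Complex.norm_real, Real.norm_of_nonneg (le_of_lt hw),
      Real.rpow_natCast]

theorem integral_pow_mul_cexp {c : ℂ} (hc : 0 < c.re) (a : ℕ) :
    ∫ w : ℝ in Ioi 0, (w : ℂ) ^ a * Complex.exp (-(c * w)) = a.factorial / c ^ (a + 1) := by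
  have hc0 : c ≠ 0 := by rintro rfl; simp at hc
  have hder : ∀ w : ℝ, HasDerivAt (fun w : ℝ => Complex.exp (-(c * w)))
      (-c * Complex.exp (-(c * w))) w := by
    intro w
    have hu : HasDerivAt (fun u : ℝ => (u : ℂ)) 1 w := Complex.ofRealCLM.hasDerivAt
    refine ((hu.const_mul c).neg.cexp).congr_deriv ?_
    simp only [Pi.neg_apply]
    ring
  have hlim : ∀ n : ℕ, Tendsto (fun w : ℝ => (w : ℂ) ^ n * Complex.exp (-(c * w))) atTop (𝓝 0) := by
    intro n
    rw [tendsto_zero_iff_norm_tendsto_zero]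
    have := Real.tendsto_pow_mul_exp_neg_atTop_nhds_zero n
    have h2 := (this.comp (tendsto_id.const_mul_atTop hc)).const_mul ((c.re ^ n)⁻¹)
    rw [mul_zero] at h2
    refine h2.congr' ?_
    filter_upwards [eventually_gt_atTop 0] with w hw
    rw [norm_mul, norm_cexp_neg_mul, norm_pow, Complex.norm_real, Real.norm_of_nonneg hw.le]
    simp only [Function.comp, id, mul_pow]
    field_simp
  induction a with
  | zero =>
    have h1 := integral_Ioi_of_hasDerivAt_of_tendsto' (a := 0)
      (f := fun w : ℝ => Complex.exp (-(c * w))) (f' := fun w => -c * Complex.exp (-(c * w)))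
      (fun w _ => hder w) (by simpa [IntegrableOn] using (integrableOn_pow_mul_cexp hc 0).const_mul c)
      (by simpa using hlim 0)
    rw [integral_const_mul] at h1
    simp at h1 ⊢
    exact eq_inv_of_mul_eq_one_right h1
  | succ a ih =>
    have hd2 : ∀ w ∈ Ici (0 : ℝ), HasDerivAt (fun w : ℝ => (w : ℂ) ^ (a + 1) * Complex.exp (-(c * w)))
        ((a + 1) * ((w : ℂ) ^ a * Complex.exp (-(c * w))) -
          c * ((w : ℂ) ^ (a + 1) * Complex.exp (-(c * w)))) w := by
      intro w _
      have hu : HasDerivAt (fun u : ℝ => (u : ℂ)) 1 w := Complex.ofRealCLM.hasDerivAt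
      refine ((hu.pow (a + 1)).mul (hder w)).congr_deriv ?_
      push_cast
      simp only [Pi.pow_apply]
      ring
    have i1 := (integrableOn_pow_mul_cexp hc a).const_mul ((a : ℂ) + 1)
    have i2 := (integrableOn_pow_mul_cexp hc (a + 1)).const_mul c
    have h1 := integral_Ioi_of_hasDerivAt_of_tendsto' hd2 (i1.sub i2) (hlim (a + 1))
    rw [integral_sub i1 i2, integral_const_mul, integral_const_mul, ih] at h1
    simp at h1
    have h2 : c * ∫ w : ℝ in Ioi 0, (w : ℂ) ^ (a + 1) * Complex.exp (-(c * w)) =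
        (a + 1) * (a.factorial / c ^ (a + 1)) := (sub_eq_zero.1 h1).symm
    rw [← mul_right_inj' hc0, h2, Nat.factorial_succ]
    push_cast
    rw [pow_succ c (a + 1)]
    field_simp

end OneDim

end DeltaDiagonal

namespace DeltaDiagonal

open Set

/-! ### The kernel `K₀` and its Fourier transform -/

section Kernel

/-- `b_k(y) = (2π)⁻¹ K₀(√2 k |y|)` for real `k`. -/
def bReal (k y : ℝ) : ℝ :=
  1 / (2 * Real.pi) * ∫ t in Ioi (0 : ℝ), Real.exp (-(√2 * k * Real.cosh t * |y|))

/-- `b_κ(y) = (2π)⁻¹ K₀(√2 κ |y|)`, the free Green function between points of the diagonal. -/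
def bKer (κ : ℂ) (y : ℝ) : ℂ :=
  1 / (2 * Real.pi) *
    ∫ t in Ioi (0 : ℝ), Complex.exp (-(((√2 : ℝ) : ℂ) * κ * (Real.cosh t : ℂ) * (|y| : ℝ)))

theorem integrable_abs_rpow_mul_exp {c : ℝ} (hc : 0 < c) {s : ℝ} (hs : -1 < s) :
    Integrable fun w : ℝ => |w| ^ s * Real.exp (-(c * |w|)) := by
  have h : IntegrableOn (fun w : ℝ => |w| ^ s * Real.exp (-(c * |w|))) (Ioi 0) :=
    (integrableOn_pow_mul_exp hc s hs).congr_fun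
      (fun w hw => by simp only [abs_of_pos (mem_Ioi.1 hw)]) measurableSet_Ioi
  exact integrable_of_integrableOn_Ioi h (by simpa using h)

/-- Half of the exponential decay is traded for the power `x^{-1/2}`, which for `x` proportional to
`|w| cosh t` splits into a function of `w` and a function of `t`. -/
theorem exp_neg_le_inv_sqrt {x : ℝ} (hx : 0 < x) :
    Real.exp (-x) ≤ x ^ (-(1 / 2) : ℝ) * Real.exp (-(x / 2)) := by
  have h1 : x ≤ Real.exp x := by linarith [Real.add_one_le_exp x]
  have h2 : x ^ (1 / 2 : ℝ) ≤ Real.exp (x / 2) := by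
    calc x ^ (1 / 2 : ℝ) ≤ (Real.exp x) ^ (1 / 2 : ℝ) := Real.rpow_le_rpow hx.le h1 (by norm_num)
      _ = Real.exp (x / 2) := by rw [← Real.exp_mul]; ring_nf
  have h3 : 0 < x ^ (1 / 2 : ℝ) := Real.rpow_pos_of_pos hx _
  rw [Real.rpow_neg hx.le, inv_mul_eq_div, le_div_iff₀ h3]
  calc _ ≤ Real.exp (-x) * Real.exp (x / 2) := by gcongr
    _ = _ := by rw [← Real.exp_add]; ring_nf

/-- The `t`-integral diverges at `w = 0`, so joint integrability needs both decays at once. With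
`cosh t ≥ e^t / 2` in the power and `cosh t ≥ 1` in the exponential, `exp_neg_le_inv_sqrt` gives the
product majorant `|w|^{n-1/2} e^{-c|w|} · e^{-t/2}`. -/
theorem integrable_pow_mul_exp_cosh {k : ℝ} (hk : 0 < k) (n : ℕ) :
    Integrable (fun p : ℝ × ℝ => |p.1| ^ n * Real.exp (-(√2 * k * Real.cosh p.2 * |p.1|)))
      (volume.prod (volume.restrict (Ioi 0))) := by
  set c := √2 * k / 2 with hc
  have hc0 : 0 < c := by positivity
  have h1 := integrable_abs_rpow_mul_exp hc0 (s := (n : ℝ) - 1 / 2)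
    (by linarith [n.cast_nonneg (α := ℝ)])
  have h2 : IntegrableOn (fun t : ℝ => Real.exp (-(1 / 2) * t)) (Ioi 0) :=
    exp_neg_integrableOn_Ioi 0 (by norm_num)
  refine ((h1.mul_prod h2).const_mul (c ^ (-(1 / 2) : ℝ))).mono' ?_ ?_
  · exact (Continuous.aestronglyMeasurable (by fun_prop))
  have hae : ∀ᵐ p : ℝ × ℝ ∂(volume.prod (volume.restrict (Ioi (0 : ℝ)))), p.1 ≠ 0 :=
    Measure.quasiMeasurePreserving_fst.ae (Measure.ae_ne volume 0)
  filter_upwards [hae] with p hp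
  obtain ⟨w, t⟩ := p
  have hw : 0 < |w| := abs_pos.2 hp
  rw [Real.norm_of_nonneg (by positivity)]
  have hcosh : Real.exp t ≤ 2 * Real.cosh t := by
    rw [Real.cosh_eq]; linarith [Real.exp_pos (-t)]
  set x := √2 * k * Real.cosh t * |w| with hx
  have hx0 : 0 < x := by have := Real.cosh_pos t; positivity
  have hxge : c * |w| * Real.exp t ≤ x := by
    rw [hc, hx]
    have : 0 ≤ √2 * k * |w| := by positivity
    nlinarith
  have hxge2 : 2 * (c * |w|) ≤ x := by
    rw [hc, hx]
    have : 0 ≤ √2 * k * |w| := by positivity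
    nlinarith [Real.one_le_cosh t]
  calc |w| ^ n * Real.exp (-x) ≤ |w| ^ n * (x ^ (-(1 / 2) : ℝ) * Real.exp (-(x / 2))) := by
        gcongr; exact exp_neg_le_inv_sqrt hx0
    _ ≤ |w| ^ n * ((c * |w| * Real.exp t) ^ (-(1 / 2) : ℝ) * Real.exp (-(c * |w|))) := by
        gcongr ?_ * (?_ * ?_)
        · exact Real.rpow_le_rpow_of_nonpos (by positivity) hxge (by norm_num)
        · exact Real.exp_le_exp.2 (by linarith)
    _ = _ := by
        rw [Real.mul_rpow (by positivity) (by positivity), Real.mul_rpow hc0.le hw.le,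
          ← Real.exp_mul, Real.rpow_sub hw, Real.rpow_natCast, Real.rpow_neg hw.le]
        rw [show t * -(1 / 2) = -(1 / 2) * t by ring]
        field_simp

theorem bReal_nonneg (k y : ℝ) : 0 ≤ bReal k y :=
  mul_nonneg (by positivity) (integral_nonneg fun t => (Real.exp_pos _).le)

theorem bReal_scale {k : ℝ} (hk : 0 < k) (y : ℝ) : bReal k y = bReal 1 (k * y) := by
  simp only [bReal, abs_mul, abs_of_pos hk]
  congr 2
  ext t
  ring_nf

theorem norm_cexp_kernel (κ : ℂ) (t y : ℝ) :
    ‖Complex.exp (-(((√2 : ℝ) : ℂ) * κ * (Real.cosh t : ℂ) * (|y| : ℝ)))‖ =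
      Real.exp (-(√2 * κ.re * Real.cosh t * |y|)) := by
  have : ((√2 : ℝ) : ℂ) * κ * (Real.cosh t : ℂ) = ((√2 * Real.cosh t : ℝ) : ℂ) * κ := by
    push_cast; ring
  rw [norm_cexp_neg_mul, this, Complex.re_ofReal_mul]
  ring_nf

theorem norm_bKer_le (κ : ℂ) (y : ℝ) : ‖bKer κ y‖ ≤ bReal κ.re y := by
  rw [bKer, bReal, norm_mul]
  refine mul_le_mul (le_of_eq ?_) ?_ (norm_nonneg _) (by positivity)
  · rw [norm_div, norm_mul, Complex.norm_real, Real.norm_of_nonneg Real.pi_pos.le]; simp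
  · refine (norm_integral_le_integral_norm _).trans (le_of_eq ?_)
    simp only [norm_cexp_kernel]

theorem integrable_pow_bReal {k : ℝ} (hk : 0 < k) (n : ℕ) :
    Integrable fun y : ℝ => |y| ^ n * bReal k y := by
  have := (integrable_pow_mul_exp_cosh hk n).integral_prod_left.const_mul (1 / (2 * Real.pi))
  refine this.congr (Eventually.of_forall fun y => ?_)
  simp only [bReal]
  rw [integral_const_mul]
  ring

theorem stronglyMeasurable_bReal (k : ℝ) : StronglyMeasurable (bReal k) := by
  refine stronglyMeasurable_const.mul ?_
  refine StronglyMeasurable.integral_prod_right (f := fun y t =>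
    Real.exp (-(√2 * k * Real.cosh t * |y|))) ?_
  exact Continuous.stronglyMeasurable (by fun_prop)

theorem stronglyMeasurable_bKer (κ : ℂ) : StronglyMeasurable (bKer κ) := by
  refine stronglyMeasurable_const.mul ?_
  refine StronglyMeasurable.integral_prod_right (f := fun y t =>
    Complex.exp (-(((√2 : ℝ) : ℂ) * κ * (Real.cosh t : ℂ) * (|y| : ℝ)))) ?_
  exact Continuous.stronglyMeasurable (by fun_prop)

theorem integrable_bReal {k : ℝ} (hk : 0 < k) : Integrable (bReal k) := by
  simpa using integrable_pow_bReal hk 0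

theorem integrable_bKer {κ : ℂ} (hκ : 0 < κ.re) : Integrable (bKer κ) :=
  (integrable_bReal hκ).mono' (stronglyMeasurable_bKer κ).aestronglyMeasurable
    (Eventually.of_forall (norm_bKer_le κ))

theorem integral_bReal_scale {k : ℝ} (hk : 0 < k) :
    ∫ y, bReal k y = k⁻¹ * ∫ y, bReal 1 y := by
  simp_rw [bReal_scale hk]
  rw [Measure.integral_comp_mul_left, abs_of_pos (by positivity), smul_eq_mul]

theorem bKer_neg (κ : ℂ) (y : ℝ) : bKer κ (-y) = bKer κ y := by simp [bKer]

theorem conj_bKer (κ : ℂ) (y : ℝ) :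
    (starRingEnd ℂ) (bKer κ y) = bKer ((starRingEnd ℂ) κ) y := by
  simp only [bKer, map_mul, map_div₀, map_one, map_ofNat, Complex.conj_ofReal]
  rw [← integral_conj]
  congr 2
  ext t
  rw [← Complex.exp_conj]
  simp only [map_neg, map_mul, Complex.conj_ofReal]

/-- For `w > 0` the exponentials of the kernel and of the phase merge into one, and Fubini leaves a
Laplace integral of `w^a`. This is the origin of the denominators with `cosh t` in `c_{a,s}`. -/
theorem integral_Ioi_bKer_mul {κ : ℂ} (hκ : 0 < κ.re) (τ : ℝ) (a : ℕ) :
    ∫ w in Ioi (0 : ℝ), bKer κ w * ((w : ℂ) ^ a * Complex.exp (-(Complex.I * τ * w))) =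
      1 / (2 * Real.pi) * ∫ t in Ioi (0 : ℝ),
        a.factorial / (((√2 : ℝ) : ℂ) * κ * (Real.cosh t : ℂ) + Complex.I * τ) ^ (a + 1) := by
  let f : ℝ → ℝ → ℂ := fun w t =>
    (w : ℂ) ^ a * Complex.exp (-((((√2 : ℝ) : ℂ) * κ * (Real.cosh t : ℂ) + Complex.I * τ) * w))
  have h1 : ∀ w ∈ Ioi (0 : ℝ), bKer κ w * ((w : ℂ) ^ a * Complex.exp (-(Complex.I * τ * w))) =
      1 / (2 * Real.pi) * ∫ t in Ioi (0 : ℝ), f w t := by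
    intro w hw
    rw [bKer, mul_assoc, ← integral_mul_const]
    congr 2
    ext t
    simp only [f]
    rw [abs_of_pos (mem_Ioi.1 hw), add_mul, neg_add, Complex.exp_add]
    ring
  have hint : Integrable (Function.uncurry f)
      ((volume.restrict (Ioi 0)).prod (volume.restrict (Ioi 0))) := by
    have h := (integrable_pow_mul_exp_cosh hκ a).mono_measure
      (Measure.prod_mono (Measure.restrict_le_self (s := Ioi (0 : ℝ))) (le_refl _))
    have hae : ∀ᵐ p : ℝ × ℝ ∂((volume.restrict (Ioi 0)).prod (volume.restrict (Ioi (0 : ℝ)))),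
        p.1 ∈ Ioi (0 : ℝ) :=
      Measure.quasiMeasurePreserving_fst.ae (ae_restrict_mem measurableSet_Ioi)
    refine h.mono' (Continuous.aestronglyMeasurable (by fun_prop)) ?_
    filter_upwards [hae] with p hp
    simp only [Function.uncurry, f]
    rw [norm_mul, norm_cexp_neg_mul, norm_pow, Complex.norm_real, Real.norm_eq_abs]
    have : ((√2 : ℝ) : ℂ) * κ * (Real.cosh p.2 : ℂ) = ((√2 * Real.cosh p.2 : ℝ) : ℂ) * κ := by
      push_cast; ring
    rw [this, Complex.add_re, Complex.re_ofReal_mul, abs_of_pos (mem_Ioi.1 hp)]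
    simp only [Complex.mul_re, Complex.I_re, Complex.ofReal_im, Complex.I_im, Complex.ofReal_re]
    ring_nf
    exact le_refl _
  rw [setIntegral_congr_fun measurableSet_Ioi h1, integral_const_mul, integral_integral_swap hint]
  congr 2
  ext t
  refine integral_pow_mul_cexp ?_ a
  have : ((√2 : ℝ) : ℂ) * κ * (Real.cosh t : ℂ) = ((√2 * Real.cosh t : ℝ) : ℂ) * κ := by
    push_cast; ring
  rw [this, Complex.add_re, Complex.re_ofReal_mul]
  have := Real.cosh_pos t
  simp
  positivity

theorem integrable_bKer_mul {κ : ℂ} (hκ : 0 < κ.re) (τ : ℝ) (a : ℕ) :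
    Integrable fun w : ℝ => bKer κ w * ((w : ℂ) ^ a * Complex.exp (-(Complex.I * τ * w))) := by
  refine (integrable_pow_bReal hκ a).mono' ?_ (Eventually.of_forall fun w => ?_)
  · exact (stronglyMeasurable_bKer κ).aestronglyMeasurable.mul
      (Continuous.aestronglyMeasurable (by fun_prop))
  · rw [norm_mul, norm_mul, norm_cexp_neg_mul, norm_pow, Complex.norm_real, Real.norm_eq_abs]
    have := norm_bKer_le κ w
    simp only [Complex.mul_re, Complex.I_re, Complex.ofReal_im, Complex.I_im, Complex.ofReal_re]
    simp only [zero_mul, mul_zero, sub_zero, neg_zero, Real.exp_zero, mul_one]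
    rw [mul_comm]
    gcongr

theorem integral_Ioi_comp_sinh {g : ℝ → ℂ} (hg : Continuous g) (hi : Integrable g) :
    ∫ t in Ioi (0 : ℝ), (Real.cosh t : ℂ) * g (Real.sinh t) = ∫ u in Ioi (0 : ℝ), g u := by
  have h2 : IntegrableOn (fun x => Real.cosh x • (g ∘ Real.sinh) x) (Ici 0) := by
    have := (integrableOn_image_iff_integrableOn_abs_deriv_smul (s := univ) (f := Real.sinh)
      (f' := Real.cosh) (g := g) MeasurableSet.univ
      (fun x _ => (Real.hasDerivAt_sinh x).hasDerivWithinAt) Real.sinh_injective.injOn).1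
      hi.integrableOn
    refine (this.mono_set (subset_univ _)).congr_fun (fun x _ => ?_) measurableSet_Ici
    simp only [abs_of_pos (Real.cosh_pos x)]; rfl
  have := integral_deriv_smul_comp_Ioi (a := 0) (f := Real.sinh) (f' := Real.cosh) (g := g)
    Real.continuous_sinh.continuousOn Real.sinhOrderIso.tendsto_atTop
    (fun x _ => (Real.hasDerivAt_sinh x).hasDerivWithinAt) hg.continuousOn hi.integrableOn h2
  rw [Real.sinh_zero] at this
  rw [← this]
  refine setIntegral_congr_fun measurableSet_Ioi fun x _ => ?_
  simp [Complex.real_smul]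

/-- The Fourier transform of `b_κ`. -/
theorem integral_bKer_mul_exp {κ : ℂ} (hκ : 0 < κ.re) (τ : ℝ) {c : ℂ} (hc : 0 < c.re)
    (hc2 : c ^ 2 = 2 * κ ^ 2 + (τ : ℂ) ^ 2) :
    ∫ w : ℝ, bKer κ w * Complex.exp (-(Complex.I * τ * w)) = 1 / (2 * c) := by
  have hi : ∀ τ : ℝ, Integrable fun w : ℝ => bKer κ w * Complex.exp (-(Complex.I * τ * w)) :=
    fun τ => by simpa using integrable_bKer_mul hκ τ 0
  have hhalf : ∀ τ : ℝ, ∫ w in Ioi (0 : ℝ), bKer κ w * Complex.exp (-(Complex.I * τ * w)) =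
      1 / (2 * Real.pi) * ∫ t in Ioi (0 : ℝ),
        1 / (((√2 : ℝ) : ℂ) * κ * (Real.cosh t : ℂ) + Complex.I * τ) := fun τ => by
    simpa using integral_Ioi_bKer_mul hκ τ 0
  have hs2 : ((√2 : ℝ) : ℂ) ^ 2 = 2 := by
    rw [← Complex.ofReal_pow, Real.sq_sqrt (by norm_num)]; norm_num
  have hs0 : ((√2 : ℝ) : ℂ) ≠ 0 := fun h => by rw [h] at hs2; norm_num at hs2
  have hκ0 : κ ≠ 0 := by rintro rfl; simp at hκ
  have hc0 : c ≠ 0 := by rintro rfl; simp at hc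
  have hden : ∀ (τ : ℝ) (t : ℝ), ((√2 : ℝ) : ℂ) * κ * (Real.cosh t : ℂ) + Complex.I * τ ≠ 0 := by
    intro τ t h
    have h2 := congrArg Complex.re h
    have : ((√2 : ℝ) : ℂ) * κ * (Real.cosh t : ℂ) = ((√2 * Real.cosh t : ℝ) : ℂ) * κ := by
      push_cast; ring
    rw [this, Complex.add_re, Complex.re_ofReal_mul] at h2
    have := Real.cosh_pos t
    simp at h2
    rcases h2 with h2 | h2
    · linarith
    · exact hκ.ne' h2
  have hdi : ∀ τ : ℝ, IntegrableOn (fun t : ℝ =>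
      1 / (((√2 : ℝ) : ℂ) * κ * (Real.cosh t : ℂ) + Complex.I * τ)) (Ioi 0) := by
    intro τ
    refine Integrable.mono' (g := fun t => (2 / (√2 * κ.re)) * Real.exp (-1 * t)) ?_ ?_ ?_
    · exact (exp_neg_integrableOn_Ioi 0 one_pos).const_mul _
    · exact (continuous_const.div (by fun_prop) (hden τ)).aestronglyMeasurable
    · refine Eventually.of_forall fun t => ?_
      have hre : √2 * κ.re * (Real.exp t / 2) ≤
          ‖((√2 : ℝ) : ℂ) * κ * (Real.cosh t : ℂ) + Complex.I * τ‖ := by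
        refine le_trans ?_ (Complex.re_le_norm _)
        have : ((√2 : ℝ) : ℂ) * κ * (Real.cosh t : ℂ) = ((√2 * Real.cosh t : ℝ) : ℂ) * κ := by
          push_cast; ring
        rw [this, Complex.add_re, Complex.re_ofReal_mul]
        have hcosh : Real.exp t / 2 ≤ Real.cosh t := by
          rw [Real.cosh_eq]; linarith [Real.exp_pos (-t)]
        have : √2 * κ.re * (Real.exp t / 2) ≤ √2 * κ.re * Real.cosh t := by gcongr
        simp
        linarith
      rw [norm_div, norm_one, div_le_iff₀ (norm_pos_iff.2 (hden τ t))]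
      calc (1 : ℝ) = (2 / (√2 * κ.re)) * Real.exp (-1 * t) * (√2 * κ.re * (Real.exp t / 2)) := by
            rw [neg_one_mul, Real.exp_neg]; field_simp
        _ ≤ _ := by gcongr
  -- As `b_κ` is even, the negative half-line contributes the half-line integral with `-τ`.
  rw [integral_eq_Ioi_add (hi τ)]
  have hneg : ∫ w in Ioi (0 : ℝ), bKer κ (-w) * Complex.exp (-(Complex.I * τ * ((-w : ℝ) : ℂ))) =
      ∫ w in Ioi (0 : ℝ), bKer κ w * Complex.exp (-(Complex.I * ((-τ : ℝ) : ℂ) * w)) := by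
    congr 1; ext w; rw [bKer_neg]; push_cast; ring_nf
  rw [hneg, hhalf, hhalf, ← mul_add, ← integral_add (hdi _) (hdi _)]
  set z := c / (((√2 : ℝ) : ℂ) * κ) with hz
  have hzre : 0 < z.re := by
    have h1 : z = (1 / (√2 * ‖κ‖ ^ 2) : ℝ) * (c * (starRingEnd ℂ) κ) := by
      rw [hz]
      have : (((‖κ‖ ^ 2 : ℝ)) : ℂ) = κ * (starRingEnd ℂ) κ := by
        rw [Complex.mul_conj, Complex.normSq_eq_norm_sq]
      push_cast at this ⊢
      rw [this]
      have : (starRingEnd ℂ) κ ≠ 0 := by simpa using hκ0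
      field_simp
    rw [h1, Complex.re_ofReal_mul]
    refine mul_pos (by have := norm_pos_iff.2 hκ0; positivity) ?_
    have him := congrArg Complex.im hc2
    simp [sq] at him
    simp only [Complex.mul_re, Complex.conj_re, Complex.conj_im]
    -- The imaginary part of `c² = 2κ² + τ²` says `Re c · Im c = 2 Re κ · Im κ`. Hence `Im c` and
    -- `Im κ` do not have opposite signs, and `Re (c κ̄) = Re c Re κ + Im c Im κ > 0`.
    have : c.im * κ.im * c.re = 2 * κ.re * κ.im ^ 2 := by linear_combination κ.im / 2 * him
    have h3 : 0 ≤ c.im * κ.im := by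
      by_contra hcon
      have := mul_neg_of_neg_of_pos (not_le.1 hcon) hc
      nlinarith [mul_nonneg hκ.le (sq_nonneg κ.im)]
    have := mul_pos hc hκ
    linarith
  have hz2 : z ^ 2 = 1 + (τ : ℂ) ^ 2 / (2 * κ ^ 2) := by
    rw [hz, div_pow, hc2, mul_pow, hs2]; field_simp
  have hcont : Continuous fun u : ℝ => 1 / ((u : ℂ) ^ 2 + z ^ 2) := by
    refine continuous_const.div (by fun_prop) fun u => ?_
    have := add_sq_ne_zero hzre (sq_nonneg u)
    push_cast at this
    exact this
  have hsub := integral_Ioi_comp_sinh hcont (integrable_inv_sq_add hzre)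
  rw [integral_Ioi_inv_sq_add hzre] at hsub
  -- The product of the two denominators is `2κ² cosh² t + τ² = 2κ² (sinh² t + z²)` and their sum is
  -- `2√2 κ cosh t`, so the substitution `u = sinh t` applies.
  have hcongr : ∫ t in Ioi (0 : ℝ), (1 / (((√2 : ℝ) : ℂ) * κ * (Real.cosh t : ℂ) + Complex.I * τ) +
      1 / (((√2 : ℝ) : ℂ) * κ * (Real.cosh t : ℂ) + Complex.I * ((-τ : ℝ) : ℂ))) =
      ∫ t in Ioi (0 : ℝ), (((√2 : ℝ) : ℂ) / κ) *
        ((Real.cosh t : ℂ) * (1 / (((Real.sinh t : ℝ) : ℂ) ^ 2 + z ^ 2))) := by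
    refine setIntegral_congr_fun measurableSet_Ioi fun t _ => ?_
    have h1 := hden τ t
    have h2 := hden (-τ) t
    have h3 : ((Real.sinh t : ℝ) : ℂ) ^ 2 + 1 = ((Real.cosh t : ℝ) : ℂ) ^ 2 := by
      norm_cast; rw [Real.cosh_sq]
    have h4 : ((Real.sinh t : ℝ) : ℂ) ^ 2 + z ^ 2 =
        (((√2 : ℝ) : ℂ) * κ * (Real.cosh t : ℂ) + Complex.I * τ) *
        (((√2 : ℝ) : ℂ) * κ * (Real.cosh t : ℂ) + Complex.I * ((-τ : ℝ) : ℂ)) / (2 * κ ^ 2) := by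
      rw [hz2, ← add_assoc, h3]
      push_cast
      field_simp
      ring_nf
      rw [hs2, Complex.I_sq]
      ring
    simp only [h4]
    generalize ((Real.cosh t : ℝ) : ℂ) = C at h1 h2 ⊢
    generalize hD1 : ((√2 : ℝ) : ℂ) * κ * C + Complex.I * τ = D1 at h1 ⊢
    generalize hD2 : ((√2 : ℝ) : ℂ) * κ * C + Complex.I * ((-τ : ℝ) : ℂ) = D2 at h2 ⊢
    have hsum : D1 + D2 = 2 * ((√2 : ℝ) : ℂ) * κ * C := by
      rw [← hD1, ← hD2]; push_cast; ring
    field_simp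
    rw [add_comm D2, hsum]
    ring
  rw [hcongr, integral_const_mul, hsub, hz]
  have hπ : (Real.pi : ℂ) ≠ 0 := by exact_mod_cast Real.pi_ne_zero
  field_simp
  rw [hs2]

end Kernel

end DeltaDiagonal

namespace DeltaDiagonal

open Set

/-! ### Fourier side of the plane: the symbol and the Green functions on the diagonal -/

section Plane

/-- Coordinates `(ξ₁ + ξ₂, (ξ₁ - ξ₂)/2)` on the plane. -/
def rot : ℝ × ℝ ≃ᵐ Plane where
  toFun p := !₂[p.1 / 2 + p.2, p.1 / 2 - p.2]
  invFun ξ := (ξ 0 + ξ 1, (ξ 0 - ξ 1) / 2)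
  left_inv p := by ext <;> simp
  right_inv ξ := by ext i; fin_cases i <;> simp <;> ring
  measurable_toFun := by
    refine Continuous.measurable ?_
    refine (PiLp.continuous_toLp 2 _).comp (continuous_pi fun i => ?_)
    fin_cases i <;> simp <;> fun_prop
  measurable_invFun := by
    refine Continuous.measurable ?_
    exact Continuous.prodMk (by fun_prop) (by fun_prop)

theorem rot_zero (η t : ℝ) : rot (η, t) 0 = η / 2 + t := rfl

theorem rot_one (η t : ℝ) : rot (η, t) 1 = η / 2 - t := rfl

theorem rot_add (η t : ℝ) : rot (η, t) 0 + rot (η, t) 1 = η := by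
  rw [rot_zero, rot_one]; ring

theorem norm_sq_plane (ξ : Plane) : ‖ξ‖ ^ 2 = ξ 0 ^ 2 + ξ 1 ^ 2 := by
  rw [EuclideanSpace.norm_sq_eq]; simp

theorem norm_sq_rot (η t : ℝ) : ‖rot (η, t)‖ ^ 2 = η ^ 2 / 2 + 2 * t ^ 2 := by
  rw [norm_sq_plane, rot_zero, rot_one]; ring

/-- The halves in `rot` are placed so that its determinant is `-1`. -/
theorem measurePreserving_rot : MeasurePreserving rot := by
  let M : Matrix (Fin 2) (Fin 2) ℝ := !![1 / 2, 1; 1 / 2, -1]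
  have hdet : M.det = -1 := by simp [M, Matrix.det_fin_two]; norm_num
  have h1 : MeasurePreserving (Matrix.toLin' M) := by
    refine ⟨(LinearMap.continuous_of_finiteDimensional _).measurable, ?_⟩
    rw [Real.map_matrix_volume_pi_eq_smul_volume_pi (by rw [hdet]; norm_num), hdet]
    simp
  have h2 := (PiLp.volume_preserving_toLp (Fin 2)).comp
    (h1.comp (volume_preserving_finTwoArrow ℝ).symm)
  have he : ⇑rot = WithLp.toLp 2 ∘ ⇑(Matrix.toLin' M) ∘ ⇑MeasurableEquiv.finTwoArrow.symm := by
    funext p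
    refine PiLp.ext fun i => ?_
    fin_cases i <;> simp [rot, M, MeasurableEquiv.finTwoArrow] <;> ring
  rw [he]
  exact h2

theorem integral_plane {E : Type*} [NormedAddCommGroup E] [NormedSpace ℝ E] (f : Plane → E) :
    ∫ ξ, f ξ = ∫ p : ℝ × ℝ, f (rot p) :=
  (measurePreserving_rot.integral_comp rot.measurableEmbedding f).symm

theorem integrable_plane {E : Type*} [NormedAddCommGroup E] {f : Plane → E} :
    Integrable (fun p : ℝ × ℝ => f (rot p)) ↔ Integrable f :=
  measurePreserving_rot.integrable_comp_emb rot.measurableEmbedding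

/-- The symbol `4π²|ξ|² + κ²` of `-Δ + κ²`. -/
def symb (κ : ℂ) (ξ : Plane) : ℂ := ((4 * Real.pi ^ 2 * ‖ξ‖ ^ 2 : ℝ) : ℂ) + κ ^ 2

theorem continuous_symb (κ : ℂ) : Continuous (symb κ) := by unfold symb; fun_prop

theorem symb_ne_zero {κ : ℂ} (hκ : 0 < κ.re) (ξ : Plane) : symb κ ξ ≠ 0 :=
  add_sq_ne_zero hκ (by positivity)

theorem norm_symb_ge {κ : ℂ} {δ : ℝ} (hδ0 : 0 ≤ δ) (hδ1 : δ ≤ 1) (h : δ * ‖κ‖ ≤ κ.re)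
    (ξ : Plane) : δ * (4 * Real.pi ^ 2 * ‖ξ‖ ^ 2 + ‖κ‖ ^ 2) ≤ ‖symb κ ξ‖ :=
  norm_add_sq_ge hδ0 hδ1 (by positivity) h

theorem conj_symb (κ : ℂ) (ξ : Plane) :
    (starRingEnd ℂ) (symb κ ξ) = symb ((starRingEnd ℂ) κ) ξ := by
  simp only [symb, map_add, map_pow, Complex.conj_ofReal]

theorem exists_sector {κ : ℂ} (hκ : 0 < κ.re) : ∃ δ : ℝ, 0 < δ ∧ δ ≤ 1 ∧ δ * ‖κ‖ ≤ κ.re := by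
  have hn : 0 < ‖κ‖ := norm_pos_iff.2 (by rintro rfl; simp at hκ)
  exact ⟨κ.re / ‖κ‖, by positivity, (div_le_one hn).2 (Complex.re_le_norm κ),
    by rw [div_mul_cancel₀ _ hn.ne']⟩

theorem integrable_planeWeight {r : ℝ} (hr : 0 < r) :
    Integrable fun ξ : Plane => 1 / (4 * Real.pi ^ 2 * ‖ξ‖ ^ 2 + r ^ 2) ^ 2 := by
  have h1 : Integrable fun ξ : Plane => (1 + ‖ξ‖ ^ 2) ^ (-(4 : ℝ) / 2) :=
    integrable_rpow_neg_one_add_norm_sq (by simp; norm_num)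
  set c := min 1 (r ^ 2) with hc
  have hc0 : 0 < c := by positivity
  refine (h1.const_mul (c ^ 2)⁻¹).mono' ?_ (Eventually.of_forall fun ξ => ?_)
  · exact (continuous_const.div (by fun_prop) fun ξ => by positivity).aestronglyMeasurable
  · rw [Real.norm_of_nonneg (by positivity), show -(4 : ℝ) / 2 = -((2 : ℕ) : ℝ) by norm_num,
      Real.rpow_neg (by positivity), Real.rpow_natCast, ← mul_inv, ← mul_pow, one_div]
    refine inv_anti₀ (by positivity) ?_
    gcongr
    have h4 : (1 : ℝ) ≤ 4 * Real.pi ^ 2 := by nlinarith [Real.pi_gt_three]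
    have h5 : ‖ξ‖ ^ 2 ≤ 4 * Real.pi ^ 2 * ‖ξ‖ ^ 2 := le_mul_of_one_le_left (sq_nonneg _) h4
    nlinarith [min_le_left 1 (r ^ 2), min_le_right 1 (r ^ 2), sq_nonneg ‖ξ‖]

/-- The constant `∫ (4π²|ξ|² + 1)⁻² dξ`. -/
def planeConst : ℝ := ∫ ξ : Plane, 1 / (4 * Real.pi ^ 2 * ‖ξ‖ ^ 2 + 1 ^ 2) ^ 2

theorem planeConst_nonneg : 0 ≤ planeConst := integral_nonneg fun ξ => by positivity

/-- Rescaling `ξ` by `r` gives `r²` from the area element against `r⁻⁴` from the integrand. The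
factor `|κ|⁻²` in the bounds on `c_κ` and `‖g_x‖²` comes from here. -/
theorem integral_planeWeight {r : ℝ} (hr : 0 < r) :
    ∫ ξ : Plane, 1 / (4 * Real.pi ^ 2 * ‖ξ‖ ^ 2 + r ^ 2) ^ 2 = planeConst / r ^ 2 := by
  have h := Measure.integral_comp_smul (volume : Measure Plane)
    (fun ξ => 1 / (4 * Real.pi ^ 2 * ‖ξ‖ ^ 2 + 1 ^ 2) ^ 2) r⁻¹
  simp only [finrank_euclideanSpace, Fintype.card_fin] at h
  rw [show ∫ ξ : Plane, 1 / (4 * Real.pi ^ 2 * ‖ξ‖ ^ 2 + 1 ^ 2) ^ 2 = planeConst from rfl,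
    abs_of_pos (by positivity), smul_eq_mul] at h
  have h2 : ∀ ξ : Plane, 1 / (4 * Real.pi ^ 2 * ‖ξ‖ ^ 2 + r ^ 2) ^ 2 =
      (r ^ 4)⁻¹ * (1 / (4 * Real.pi ^ 2 * ‖r⁻¹ • ξ‖ ^ 2 + 1 ^ 2) ^ 2) := by
    intro ξ
    rw [norm_smul, norm_inv, Real.norm_of_nonneg hr.le]
    field_simp
  simp_rw [h2]
  rw [integral_const_mul, h]
  field_simp

theorem norm_inv_symb_sq_le {κ : ℂ} {δ : ℝ} (hδ0 : 0 < δ) (hδ1 : δ ≤ 1) (h : δ * ‖κ‖ ≤ κ.re)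
    (hκ : 0 < κ.re) (ξ : Plane) :
    ‖1 / symb κ ξ ^ 2‖ ≤ (δ ^ 2)⁻¹ * (1 / (4 * Real.pi ^ 2 * ‖ξ‖ ^ 2 + ‖κ‖ ^ 2) ^ 2) := by
  have hn : 0 < ‖κ‖ := norm_pos_iff.2 (by rintro rfl; simp at hκ)
  rw [norm_div, norm_one, norm_pow, one_div, one_div, ← mul_inv, ← mul_pow]
  refine inv_anti₀ (by positivity) ?_
  gcongr
  exact norm_symb_ge hδ0.le hδ1 h ξ

theorem integrable_inv_symb_sq {κ : ℂ} (hκ : 0 < κ.re) :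
    Integrable fun ξ : Plane => 1 / symb κ ξ ^ 2 := by
  obtain ⟨δ, h0, h1, h2⟩ := exists_sector hκ
  have hn : 0 < ‖κ‖ := norm_pos_iff.2 (by rintro rfl; simp at hκ)
  refine ((integrable_planeWeight hn).const_mul (δ ^ 2)⁻¹).mono' ?_
    (Eventually.of_forall (norm_inv_symb_sq_le h0 h1 h2 hκ))
  exact (continuous_const.div ((continuous_symb κ).pow 2)
    fun ξ => pow_ne_zero 2 (symb_ne_zero hκ ξ)).aestronglyMeasurable

theorem integral_norm_inv_symb_sq_le {κ : ℂ} {δ : ℝ} (hδ0 : 0 < δ) (hδ1 : δ ≤ 1)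
    (h : δ * ‖κ‖ ≤ κ.re) (hκ : 0 < κ.re) :
    ∫ ξ, ‖1 / symb κ ξ ^ 2‖ ≤ planeConst / (δ ^ 2 * ‖κ‖ ^ 2) := by
  have hn : 0 < ‖κ‖ := norm_pos_iff.2 (by rintro rfl; simp at hκ)
  calc _ ≤ ∫ ξ : Plane, (δ ^ 2)⁻¹ * (1 / (4 * Real.pi ^ 2 * ‖ξ‖ ^ 2 + ‖κ‖ ^ 2) ^ 2) :=
        integral_mono (integrable_inv_symb_sq hκ).norm ((integrable_planeWeight hn).const_mul _)
          (norm_inv_symb_sq_le hδ0 hδ1 h hκ)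
    _ = _ := by rw [integral_const_mul, integral_planeWeight hn]; field_simp

/-- The phase `exp(-2πi(ξ₁ + ξ₂)x)`. -/
def phase (x : ℝ) (ξ : Plane) : ℂ :=
  Complex.exp (-(Complex.I * ((2 * Real.pi * (ξ 0 + ξ 1) : ℝ) : ℂ) * x))

theorem continuous_phase : Continuous fun p : ℝ × Plane => phase p.1 p.2 := by
  unfold phase; fun_prop

theorem continuous_phase_right (x : ℝ) : Continuous (phase x) := by
  unfold phase; fun_prop

theorem norm_phase (x : ℝ) (ξ : Plane) : ‖phase x ξ‖ = 1 := by
  rw [phase, norm_cexp_neg_mul]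
  simp only [Complex.mul_re, Complex.I_re, Complex.ofReal_im, Complex.I_im, Complex.ofReal_re]
  simp

theorem conj_phase_mul_phase (x y : ℝ) (ξ : Plane) :
    (starRingEnd ℂ) (phase x ξ) * phase y ξ = phase (y - x) ξ := by
  simp only [phase]
  rw [← Complex.exp_conj, ← Complex.exp_add]
  simp only [map_neg, map_mul, Complex.conj_I, Complex.conj_ofReal]
  push_cast; ring_nf

theorem phase_rot (x η t : ℝ) :
    phase x (rot (η, t)) = Complex.exp (-(Complex.I * ((2 * Real.pi * η : ℝ) : ℂ) * x)) := by
  rw [phase, rot_add]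

theorem memLp_inv_symb {κ : ℂ} (hκ : 0 < κ.re) : MemLp (fun ξ => 1 / symb κ ξ) 2 := by
  refine (memLp_two_iff_integrable_sq_norm ?_).2 ?_
  · exact (continuous_const.div (continuous_symb κ) (symb_ne_zero hκ)).aestronglyMeasurable
  · simpa [norm_pow] using (integrable_inv_symb_sq hκ).norm

theorem norm_inv_symb_le {κ : ℂ} (hκ : 0 < κ.re) : ∃ C, ∀ ξ, ‖1 / symb κ ξ‖ ≤ C := by
  obtain ⟨δ, h0, h1, h2⟩ := exists_sector hκ
  have hn : 0 < ‖κ‖ := norm_pos_iff.2 (by rintro rfl; simp at hκ)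
  refine ⟨1 / (δ * ‖κ‖ ^ 2), fun ξ => ?_⟩
  rw [norm_div, norm_one]
  refine one_div_le_one_div_of_le (by positivity) (le_trans ?_ (norm_symb_ge h0.le h1 h2 ξ))
  have : 0 ≤ 4 * Real.pi ^ 2 * ‖ξ‖ ^ 2 := by positivity
  gcongr
  linarith

theorem memLp_bounded_div_symb {κ : ℂ} (hκ : 0 < κ.re) {u : Plane → ℂ}
    (hu : AEStronglyMeasurable u) {C : ℝ} (hC : ∀ ξ, ‖u ξ‖ ≤ C) :
    MemLp (fun ξ => u ξ / symb κ ξ) 2 := by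
  refine (memLp_inv_symb hκ).of_le_mul (c := C) ?_ (Eventually.of_forall fun ξ => ?_)
  · simp_rw [div_eq_mul_inv]
    exact hu.mul ((continuous_symb κ).inv₀ (symb_ne_zero hκ)).aestronglyMeasurable
  · rw [norm_div, norm_div, norm_one, mul_one_div]
    gcongr
    exact hC ξ

theorem memLp_phase_div_symb {κ : ℂ} (hκ : 0 < κ.re) (x : ℝ) :
    MemLp (fun ξ => phase x ξ / symb κ ξ) 2 :=
  memLp_bounded_div_symb hκ (continuous_phase_right x).aestronglyMeasurable
    (fun ξ => (norm_phase x ξ).le)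

/-- The Fourier transform of the Green function with pole at `(x, x)`. -/
def gLp {κ : ℂ} (hκ : 0 < κ.re) (x : ℝ) : L2Plane := (memLp_phase_div_symb hκ x).toLp _

theorem coeFn_gLp {κ : ℂ} (hκ : 0 < κ.re) (x : ℝ) :
    gLp hκ x =ᵐ[volume] fun ξ => phase x ξ / symb κ ξ := MemLp.coeFn_toLp _

/-- The integral kernel of `T R₀² T*` with `T` the diagonal trace. -/
def cKer (κ : ℂ) (y : ℝ) : ℂ := ∫ ξ : Plane, phase y ξ * (1 / symb κ ξ ^ 2)

theorem re_conj_pos {κ : ℂ} (hκ : 0 < κ.re) : 0 < ((starRingEnd ℂ) κ).re := by simpa using hκ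

/-- With parameter `κ̄` in the conjugate-linear slot the product of the symbols is `symb κ ²` and
not its modulus, so the pairing is holomorphic in `κ`. For the same reason `κ̄` appears in the first
slot throughout. -/
theorem inner_gLp_conj {κ : ℂ} (hκ : 0 < κ.re) (x y : ℝ) :
    inner ℂ (gLp (re_conj_pos hκ) x) (gLp hκ y) = cKer κ (y - x) := by
  rw [L2.inner_def, cKer]
  refine integral_congr_ae ?_
  filter_upwards [coeFn_gLp hκ y, coeFn_gLp (re_conj_pos hκ) x] with ξ h1 h2
  rw [h1, h2, RCLike.inner_apply, map_div₀, conj_symb, Complex.conj_conj,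
    ← conj_phase_mul_phase x y]
  have := symb_ne_zero hκ ξ
  field_simp

theorem inner_gLp_self {κ : ℂ} (hκ : 0 < κ.re) (x y : ℝ) :
    inner ℂ (gLp hκ x) (gLp hκ y) = ∫ ξ, phase (y - x) ξ * (‖1 / symb κ ξ ^ 2‖ : ℝ) := by
  rw [L2.inner_def]
  refine integral_congr_ae ?_
  filter_upwards [coeFn_gLp hκ y, coeFn_gLp hκ x] with ξ h1 h2
  rw [h1, h2, RCLike.inner_apply, map_div₀, ← conj_phase_mul_phase x y]
  have h := symb_ne_zero hκ ξ
  have h' : (starRingEnd ℂ) (symb κ ξ) ≠ 0 := by simpa using h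
  have : ((‖1 / symb κ ξ ^ 2‖ : ℝ) : ℂ) = 1 / (symb κ ξ * (starRingEnd ℂ) (symb κ ξ)) := by
    rw [Complex.mul_conj, Complex.normSq_eq_norm_sq, norm_div, norm_one, norm_pow]
    push_cast; rfl
  rw [this]
  field_simp

theorem norm_integral_phase_le {w : Plane → ℂ} (y : ℝ) :
    ‖∫ ξ, phase y ξ * w ξ‖ ≤ ∫ ξ, ‖w ξ‖ := by
  refine (norm_integral_le_integral_norm _).trans (le_of_eq ?_)
  simp [norm_phase]

theorem norm_cKer_le {κ : ℂ} {δ : ℝ} (hδ0 : 0 < δ) (hδ1 : δ ≤ 1)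
    (h : δ * ‖κ‖ ≤ κ.re) (hκ : 0 < κ.re) (y : ℝ) :
    ‖cKer κ y‖ ≤ planeConst / (δ ^ 2 * ‖κ‖ ^ 2) :=
  (norm_integral_phase_le y).trans (integral_norm_inv_symb_sq_le hδ0 hδ1 h hκ)

theorem norm_gLp_sq_le {κ : ℂ} {δ : ℝ} (hδ0 : 0 < δ) (hδ1 : δ ≤ 1)
    (h : δ * ‖κ‖ ≤ κ.re) (hκ : 0 < κ.re) (x : ℝ) :
    ‖gLp hκ x‖ ^ 2 ≤ planeConst / (δ ^ 2 * ‖κ‖ ^ 2) := by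
  have h1 := inner_self_eq_norm_sq_to_K (𝕜 := ℂ) (gLp hκ x)
  rw [inner_gLp_self] at h1
  have h2 : ‖((‖gLp hκ x‖ : ℝ) : ℂ) ^ 2‖ = ‖gLp hκ x‖ ^ 2 := by simp
  rw [← h2]
  erw [← h1]
  refine (norm_integral_phase_le _).trans (le_trans (le_of_eq ?_)
    (integral_norm_inv_symb_sq_le hδ0 hδ1 h hκ))
  simp

theorem continuous_integral_phase {w : Plane → ℂ} (hw : Integrable w) :
    Continuous fun y => ∫ ξ, phase y ξ * w ξ := by
  refine continuous_of_dominated (bound := fun ξ => ‖w ξ‖) (fun y => ?_) (fun y => ?_) hw.norm ?_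
  · exact (continuous_phase_right y).aestronglyMeasurable.mul hw.1
  · exact Eventually.of_forall fun ξ => by rw [norm_mul, norm_phase, one_mul]
  · refine Eventually.of_forall fun ξ => ?_
    exact (continuous_phase.comp (Continuous.prodMk continuous_id continuous_const)).mul
      continuous_const

theorem continuous_cKer {κ : ℂ} (hκ : 0 < κ.re) : Continuous (cKer κ) :=
  continuous_integral_phase (integrable_inv_symb_sq hκ)

theorem continuous_gLp {κ : ℂ} (hκ : 0 < κ.re) : Continuous (gLp hκ) := by
  have hw : Integrable fun ξ => ((‖1 / symb κ ξ ^ 2‖ : ℝ) : ℂ) :=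
    (integrable_inv_symb_sq hκ).norm.ofReal
  have hc := continuous_integral_phase hw
  refine continuous_iff_continuousAt.2 fun x => ?_
  rw [ContinuousAt, tendsto_iff_norm_sub_tendsto_zero]
  -- All `g_z` have the same norm, because the inner product depends only on the difference of the
  -- poles. Norm continuity thus reduces to continuity of a Fourier integral in `y`.
  have hsq : ∀ y, ‖gLp hκ y - gLp hκ x‖ ^ 2 =
      2 * (inner ℂ (gLp hκ x) (gLp hκ x) : ℂ).re - 2 * (inner ℂ (gLp hκ y) (gLp hκ x) : ℂ).re := by
    intro y
    have e1 : ∀ z, ‖gLp hκ z‖ ^ 2 = (inner ℂ (gLp hκ x) (gLp hκ x) : ℂ).re := by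
      intro z
      have : ‖gLp hκ z‖ ^ 2 = (inner ℂ (gLp hκ z) (gLp hκ z) : ℂ).re :=
        (inner_self_eq_norm_sq (𝕜 := ℂ) (gLp hκ z)).symm
      rw [this, inner_gLp_self, inner_gLp_self, sub_self, sub_self]
    rw [@norm_sub_sq ℂ, e1, e1]
    simp only [RCLike.re_to_complex]
    ring
  have h2 : Tendsto (fun y => ‖gLp hκ y - gLp hκ x‖ ^ 2) (𝓝 x) (𝓝 0) := by
    simp_rw [hsq, inner_gLp_self]
    have h3 : Continuous fun y => 2 * (∫ ξ, phase (x - x) ξ * (‖1 / symb κ ξ ^ 2‖ : ℝ)).re -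
        2 * (∫ ξ, phase (x - y) ξ * (‖1 / symb κ ξ ^ 2‖ : ℝ)).re :=
      continuous_const.sub (continuous_const.mul (Complex.continuous_re.comp
        (hc.comp (continuous_const.sub continuous_id))))
    have := h3.tendsto x
    simpa using this
  have h4 := h2.sqrt
  simpa [Real.sqrt_sq] using h4

theorem symb_rot (κ : ℂ) (η t : ℝ) :
    symb κ (rot (η, t)) = 8 * (Real.pi : ℂ) ^ 2 * (t : ℂ) ^ 2 + (2 * (Real.pi : ℂ) ^ 2 * (η : ℂ) ^ 2 + κ ^ 2) := by
  rw [symb, norm_sq_rot]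
  push_cast
  ring

/-- The integral of the free resolvent symbol over a line `ξ₁ + ξ₂ = η` is the Fourier transform
of `b_κ`. -/
theorem integral_inv_symb_rot {κ : ℂ} (hκ : 0 < κ.re) (η : ℝ) :
    ∫ t : ℝ, 1 / symb κ (rot (η, t)) =
      ∫ w : ℝ, bKer κ w * Complex.exp (-(Complex.I * ((2 * Real.pi * η : ℝ) : ℂ) * w)) := by
  obtain ⟨c, hc, hc2⟩ := exists_sq_eq hκ (r := 2 * Real.pi ^ 2 * η ^ 2) (by positivity)
  have hs2 : ((√2 : ℝ) : ℂ) ^ 2 = 2 := by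
    rw [← Complex.ofReal_pow, Real.sq_sqrt (by norm_num)]; norm_num
  have hs0 : ((√2 : ℝ) : ℂ) ≠ 0 := fun h => by rw [h] at hs2; norm_num at hs2
  have hπ : (Real.pi : ℂ) ≠ 0 := by exact_mod_cast Real.pi_ne_zero
  have hc0 : c ≠ 0 := by rintro rfl; simp at hc
  rw [integral_bKer_mul_exp hκ (2 * Real.pi * η) (c := ((√2 : ℝ) : ℂ) * c)
    (by rw [Complex.re_ofReal_mul]; positivity)
    (by rw [mul_pow, hs2, hc2]; push_cast; ring)]
  set z : ℂ := ((1 / (2 * √2 * Real.pi) : ℝ) : ℂ) * c with hz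
  have hzre : 0 < z.re := by
    rw [hz, Complex.re_ofReal_mul]; positivity
  have h1 : ∀ t : ℝ, 1 / symb κ (rot (η, t)) =
      1 / (8 * (Real.pi : ℂ) ^ 2) * (1 / ((t : ℂ) ^ 2 + z ^ 2)) := by
    intro t
    have hz2 : z ^ 2 = (2 * (Real.pi : ℂ) ^ 2 * (η : ℂ) ^ 2 + κ ^ 2) / (8 * (Real.pi : ℂ) ^ 2) := by
      rw [hz, mul_pow, hc2]
      push_cast
      rw [div_pow, mul_pow, mul_pow, hs2]
      field_simp
      ring
    rw [symb_rot, hz2, ← one_div_mul_one_div_rev, mul_comm]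
    rw [one_div_mul_one_div_rev]
    field_simp
  simp_rw [h1]
  rw [integral_const_mul, integral_inv_sq_add hzre, hz]
  push_cast
  field_simp
  rw [hs2]
  norm_num

end Plane

end DeltaDiagonal

namespace DeltaDiagonal

open Set
open scoped FourierTransform

/-! ### The Sobolev space `H¹` and the diagonal trace -/

section Sobolev

theorem ae_eq_of_schwartz {E : Type*} [NormedAddCommGroup E] [NormedSpace ℝ E]
    [FiniteDimensional ℝ E] [MeasurableSpace E] [BorelSpace E] {μ : Measure E}
    {f g : E → ℂ} (hf : LocallyIntegrable f μ) (hg : LocallyIntegrable g μ)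
    (h : ∀ ψ : 𝓢(E, ℂ), ∫ x, ψ x * f x ∂μ = ∫ x, ψ x * g x ∂μ) : f =ᵐ[μ] g := by
  refine ae_eq_of_integral_contDiff_smul_eq hf hg fun ψ hψ hc => ?_
  have hg₁ : HasCompactSupport (Complex.ofRealCLM ∘ ψ) := hc.comp_left rfl
  have hg₂ : ContDiff ℝ ∞ (Complex.ofRealCLM ∘ ψ) := by fun_prop
  simpa [Complex.real_smul] using h (hg₁.toSchwartzMap hg₂)

theorem inner_unitVec (ξ : Plane) (i : Fin 2) : inner ℝ ξ (unitVec i) = ξ i := by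
  simp [unitVec, EuclideanSpace.inner_single_right]

/-- The Fourier transform is injective on tempered distributions and turns `∂_i` into multiplication
by `2πi ξ_i`; equality of the resulting locally integrable functions is tested against Schwartz
functions. -/
theorem weakDeriv_iff (u g : L2Plane) (i : Fin 2) :
    ∂_{unitVec i} (u : 𝓢'(Plane, ℂ)) = (g : 𝓢'(Plane, ℂ)) ↔
      ((𝓕 g : L2Plane) : Plane → ℂ) =ᵐ[volume]
        fun ξ => 2 * Real.pi * Complex.I * (ξ i : ℂ) * (𝓕 u : L2Plane) ξ := by
  have h1 : (∂_{unitVec i} (u : 𝓢'(Plane, ℂ)) = (g : 𝓢'(Plane, ℂ))) ↔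
      𝓕 (∂_{unitVec i} (u : 𝓢'(Plane, ℂ))) = 𝓕 (g : 𝓢'(Plane, ℂ)) := by
    refine ⟨fun h => by rw [h], fun h => ?_⟩
    have := congrArg (𝓕⁻ ·) h
    simpa using this
  have hT : (inner ℝ · (unitVec i) : Plane → ℝ).HasTemperateGrowth := by fun_prop
  have h2 : ∀ ψ : 𝓢(Plane, ℂ), 𝓕 (∂_{unitVec i} (u : 𝓢'(Plane, ℂ))) ψ =
      ∫ ξ, ψ ξ * (2 * Real.pi * Complex.I * (ξ i : ℂ) * (𝓕 u : L2Plane) ξ) := by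
    intro ψ
    rw [TemperedDistribution.fourier_lineDerivOp_eq, Lp.fourier_toTemperedDistribution_eq]
    have hT' : (fun x : Plane => ((inner ℝ x (unitVec i) : ℝ) : ℂ)).HasTemperateGrowth := by fun_prop
    simp only [_root_.smul_apply, TemperedDistribution.smulLeftCLM_apply_apply,
      Lp.toTemperedDistribution_apply, smul_eq_mul, SchwartzMap.smulLeftCLM_apply_apply hT']
    rw [← integral_const_mul]
    congr 1
    ext ξ
    rw [inner_unitVec]
    ring
  rw [h1, Lp.fourier_toTemperedDistribution_eq]
  constructor
  · intro h
    refine ae_eq_of_schwartz ((Lp.memLp _).locallyIntegrable (by norm_num)) ?_ fun ψ => ?_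
    · have := (((Lp.memLp (𝓕 u : L2Plane)).locallyIntegrable (by norm_num)).locallyIntegrableOn
        univ).continuousOn_mul (g := fun ξ : Plane => 2 * Real.pi * Complex.I * (ξ i : ℂ))
        (by fun_prop) isOpen_univ.isLocallyClosed
      exact locallyIntegrableOn_univ.1 this
    · rw [← h2 ψ, h, Lp.toTemperedDistribution_apply]
      simp
  · intro h
    ext ψ
    rw [h2 ψ, Lp.toTemperedDistribution_apply]
    refine integral_congr_ae ?_
    filter_upwards [h] with ξ hξ
    rw [hξ, smul_eq_mul]

theorem hasWeakGradient_iff (u : L2Plane) (g : Fin 2 → L2Plane) :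
    HasWeakGradient u g ↔ ∀ i, ((𝓕 (g i) : L2Plane) : Plane → ℂ) =ᵐ[volume]
        fun ξ => 2 * Real.pi * Complex.I * (ξ i : ℂ) * (𝓕 u : L2Plane) ξ :=
  forall_congr' fun i => weakDeriv_iff u (g i) i

theorem HasWeakGradient.unique {u : L2Plane} {g h : Fin 2 → L2Plane} (hg : HasWeakGradient u g)
    (hh : HasWeakGradient u h) : g = h := by
  rw [hasWeakGradient_iff] at hg hh
  ext1 i
  have : (𝓕 (g i) : L2Plane) = 𝓕 (h i) := Lp.ext ((hg i).trans (hh i).symm)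
  exact (Lp.fourierTransformₗᵢ Plane ℂ).injective this

theorem hasWeakGradient_schwartz (φ : 𝓢(Plane, ℂ)) :
    HasWeakGradient (φ.toLp 2) fun i => (∂_{unitVec i} φ).toLp 2 := by
  intro i
  rw [Lp.toTemperedDistribution_toLp_eq, Lp.toTemperedDistribution_toLp_eq,
    TemperedDistribution.lineDerivOp_toTemperedDistributionCLM_eq]

theorem exists_hasWeakGradient {u : L2Plane}
    (h : ∀ i : Fin 2, MemLp (fun ξ : Plane => (ξ i : ℂ) * (𝓕 u : L2Plane) ξ) 2) :
    ∃ g, HasWeakGradient u g := by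
  refine ⟨fun i => 𝓕⁻ (((h i).const_mul (2 * Real.pi * Complex.I)).toLp _), ?_⟩
  rw [hasWeakGradient_iff]
  intro i
  rw [FourierTransform.fourier_fourierInv_eq]
  filter_upwards [((h i).const_mul (2 * Real.pi * Complex.I)).coeFn_toLp] with ξ hξ
  rw [hξ]; ring

/-- The form of `-Δ + κ²` on the Fourier side. -/
theorem gradient_inner {u w : L2Plane} {g G : Fin 2 → L2Plane} (hu : HasWeakGradient u g)
    (hw : HasWeakGradient w G) (κ : ℂ) :
    ∑ i, inner ℂ (g i) (G i) + κ ^ 2 * inner ℂ u w =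
      ∫ ξ, (starRingEnd ℂ) ((𝓕 u : L2Plane) ξ) * (symb κ ξ * (𝓕 w : L2Plane) ξ) := by
  rw [hasWeakGradient_iff] at hu hw
  have e : ∀ a b : L2Plane, inner ℂ a b = inner ℂ (𝓕 a) (𝓕 b) := fun a b =>
    (Lp.inner_fourier_eq a b).symm
  rw [e u w, Fin.sum_univ_two, e (g 0), e (g 1)]
  have hi := fun a b : L2Plane => L2.integrable_inner (𝕜 := ℂ) a b
  simp only [L2.inner_def]
  have hA : Integrable fun ξ : Plane => inner ℂ ((𝓕 (g 0) : L2Plane) ξ) ((𝓕 (G 0) : L2Plane) ξ) +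
      inner ℂ ((𝓕 (g 1) : L2Plane) ξ) ((𝓕 (G 1) : L2Plane) ξ) := (hi _ _).add (hi _ _)
  rw [← integral_add (hi _ _) (hi _ _), ← integral_const_mul,
    ← integral_add hA ((hi _ _).const_mul _)]
  refine integral_congr_ae ?_
  filter_upwards [hu 0, hu 1, hw 0, hw 1] with ξ h1 h2 h3 h4
  simp only [RCLike.inner_apply, h1, h2, h3, h4, symb, norm_sq_plane, map_mul, Complex.conj_I,
    Complex.conj_ofReal, map_ofNat]
  push_cast
  ring_nf
  rw [Complex.I_sq]
  ring

/-- A function lies in `H¹` if `(1 + |ξ|²)^{1/2} û` is in `L²`. This function is approximated in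
`L²` by Schwartz functions `v_n`, and `φ_n` is the inverse transform of `(1 + |ξ|²)^{-1/2} v_n`. The
multipliers `(1 + |ξ|²)^{-1/2}` and `ξ_i (1 + |ξ|²)^{-1/2}` are bounded by `1`, so `φ_n` and its
derivatives converge. -/
theorem exists_schwartz_approx {u : L2Plane} {g : Fin 2 → L2Plane} (hu : HasWeakGradient u g) :
    ∃ φ : ℕ → 𝓢(Plane, ℂ), Tendsto (fun n => (φ n).toLp 2 volume) atTop (𝓝 u) ∧
      ∀ i, Tendsto (fun n => (∂_{unitVec i} (φ n)).toLp 2 volume) atTop (𝓝 (g i)) := by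
  rw [hasWeakGradient_iff] at hu
  let J : ℝ → Plane → ℂ := fun r ξ => ((1 + ‖ξ‖ ^ 2) ^ r : ℝ)
  have hJ : (J (-1 / 2)).HasTemperateGrowth := by
    have : (fun ξ : Plane => (1 + ‖ξ‖ ^ 2) ^ (-1 / 2 : ℝ)).HasTemperateGrowth :=
      Function.hasTemperateGrowth_one_add_norm_sq_rpow Plane _
    exact Complex.ofRealCLM.hasTemperateGrowth.comp this
  have hpos : ∀ ξ : Plane, (0 : ℝ) < 1 + ‖ξ‖ ^ 2 := fun ξ => by positivity
  have hJJ : ∀ ξ, J (-1 / 2) ξ * J (1 / 2) ξ = 1 := by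
    intro ξ
    simp only [J]
    rw [← Complex.ofReal_mul, ← Real.rpow_add (hpos ξ)]
    norm_num
  have hV : MemLp (fun ξ => J (1 / 2) ξ * (𝓕 u : L2Plane) ξ) 2 := by
    refine (memLp_two_iff_integrable_sq_norm ?_).2 ?_
    · refine Continuous.aestronglyMeasurable ?_ |>.mul (Lp.aestronglyMeasurable _)
      exact Complex.continuous_ofReal.comp
        ((by fun_prop : Continuous fun ξ : Plane => 1 + ‖ξ‖ ^ 2).rpow_const
          fun ξ => Or.inl (hpos ξ).ne')
    · have hi := fun f : L2Plane => (memLp_two_iff_integrable_sq_norm (Lp.memLp f).1).1 (Lp.memLp f)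
      have hsum := (hi (𝓕 u)).add (((hi (𝓕 (g 0))).add (hi (𝓕 (g 1)))).const_mul
        ((2 * Real.pi) ^ 2)⁻¹)
      refine hsum.congr ?_
      filter_upwards [hu 0, hu 1] with ξ h0 h1
      simp only [Pi.add_apply, h0, h1, norm_mul, Complex.norm_real, Complex.norm_I, Complex.norm_ofNat,
        J, mul_pow, Real.norm_eq_abs, sq_abs]
      rw [← Real.rpow_natCast (((1 : ℝ) + ‖ξ‖ ^ 2) ^ (1 / 2 : ℝ)), ← Real.rpow_mul (hpos ξ).le]
      norm_num
      rw [norm_sq_plane]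
      field_simp
  have hdense := (SchwartzMap.denseRange_toLpCLM (E := Plane) (F := ℂ) (p := 2)
    (μ := volume) ENNReal.ofNat_ne_top)
  obtain ⟨x, hxmem, hx⟩ := mem_closure_iff_seq_limit.1 (hdense (hV.toLp _))
  choose v hv using hxmem
  have hae : ∀ n, ∀ᵐ ξ, (x n - hV.toLp _ : L2Plane) ξ = v n ξ - J (1 / 2) ξ * (𝓕 u : L2Plane) ξ := by
    intro n
    filter_upwards [Lp.coeFn_sub (x n) (hV.toLp _), hV.coeFn_toLp, (v n).coeFn_toLp 2] with ξ h1 h2 h3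
    rw [h1, Pi.sub_apply, h2, ← h3, ← hv n]
    rfl
  have hJ1 : ∀ ξ, ‖J (-1 / 2) ξ‖ ^ 2 * (1 + ‖ξ‖ ^ 2) = 1 := by
    intro ξ
    simp only [J, Complex.norm_real, Real.norm_eq_abs, sq_abs]
    rw [← Real.rpow_natCast, ← Real.rpow_mul (hpos ξ).le]
    norm_num
    rw [Real.rpow_neg_one, inv_mul_cancel₀ (hpos ξ).ne']
  have hx0 : Tendsto (fun n => ‖x n - hV.toLp _‖) atTop (𝓝 0) := tendsto_iff_norm_sub_tendsto_zero.1 hx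
  let ψ : ℕ → 𝓢(Plane, ℂ) := fun n => SchwartzMap.smulLeftCLM ℂ (J (-1 / 2)) (v n)
  have hψ : ∀ n ξ, ψ n ξ = J (-1 / 2) ξ * v n ξ := fun n ξ => by
    simp only [ψ]; rw [SchwartzMap.smulLeftCLM_apply_apply hJ, smul_eq_mul]
  let φ : ℕ → 𝓢(Plane, ℂ) := fun n => 𝓕⁻ (ψ n)
  have hφ : ∀ n, ((𝓕 ((φ n).toLp 2 : L2Plane) : L2Plane) : Plane → ℂ) =ᵐ[volume] ψ n := by
    intro n
    rw [SchwartzMap.toLp_fourier_eq, FourierTransform.fourier_fourierInv_eq]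
    exact (ψ n).coeFn_toLp 2
  have hnorm : ∀ a b : L2Plane, ‖a - b‖ = ‖(𝓕 a : L2Plane) - 𝓕 b‖ := fun a b => by
    rw [← Lp.norm_fourier_eq (a - b)]
    congr 1
    exact (Lp.fourierTransformₗᵢ Plane ℂ).map_sub _ _
  refine ⟨φ, ?_, fun i => ?_⟩
  · rw [tendsto_iff_norm_sub_tendsto_zero]
    refine squeeze_zero (fun _ => norm_nonneg _) (fun n => ?_) hx0
    rw [hnorm]
    refine Lp.norm_le_norm_of_ae_le ?_
    filter_upwards [hae n, hφ n, Lp.coeFn_sub (𝓕 ((φ n).toLp 2 : L2Plane) : L2Plane) (𝓕 u)]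
      with ξ h1 h2 h3
    have h4 : ψ n ξ - (𝓕 u : L2Plane) ξ = J (-1 / 2) ξ * (v n ξ - J (1 / 2) ξ * (𝓕 u : L2Plane) ξ) := by
      rw [hψ, mul_sub, ← mul_assoc, hJJ, one_mul]
    rw [h1, h3, Pi.sub_apply, h2, h4, norm_mul]
    refine mul_le_of_le_one_left (norm_nonneg _) ?_
    have := hJ1 ξ
    nlinarith [norm_nonneg (J (-1 / 2) ξ), sq_nonneg ‖ξ‖, sq_nonneg (‖J (-1 / 2) ξ‖ * ‖ξ‖)]
  · rw [tendsto_iff_norm_sub_tendsto_zero]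
    have hx1 := hx0.const_mul (2 * Real.pi)
    rw [mul_zero] at hx1
    refine squeeze_zero (fun _ => norm_nonneg _) (fun n => ?_) hx1
    rw [hnorm]
    refine Lp.norm_le_mul_norm_of_ae_le_mul ?_
    have hgrad := (hasWeakGradient_iff _ _).1 (hasWeakGradient_schwartz (φ n)) i
    filter_upwards [hae n, hφ n, hgrad, hu i,
      Lp.coeFn_sub (𝓕 ((∂_{unitVec i} (φ n)).toLp 2 : L2Plane) : L2Plane) (𝓕 (g i))]
      with ξ h1 h2 h5 h6 h3
    have h4 : 2 * Real.pi * Complex.I * (ξ i : ℂ) * ψ n ξ -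
        2 * Real.pi * Complex.I * (ξ i : ℂ) * (𝓕 u : L2Plane) ξ =
        (2 * Real.pi * Complex.I * (ξ i : ℂ) * J (-1 / 2) ξ) *
          (v n ξ - J (1 / 2) ξ * (𝓕 u : L2Plane) ξ) := by
      rw [hψ, mul_sub]
      have := hJJ ξ
      linear_combination (2 * Real.pi * Complex.I * (ξ i : ℂ) * (𝓕 u : L2Plane) ξ) * this
    rw [h1, h3, Pi.sub_apply, h5, h2, h6, h4, norm_mul]
    refine mul_le_mul_of_nonneg_right ?_ (norm_nonneg _)
    have h7 : ‖(ξ i : ℂ)‖ * ‖J (-1 / 2) ξ‖ ≤ 1 := by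
      have h8 : ‖(ξ i : ℂ)‖ ≤ ‖ξ‖ := by
        rw [Complex.norm_real]; exact PiLp.norm_apply_le ξ i
      have h9 := hJ1 ξ
      have h10 : (‖ξ‖ * ‖J (-1 / 2) ξ‖) ^ 2 ≤ 1 := by
        nlinarith [sq_nonneg (‖J (-1 / 2) ξ‖)]
      have h11 : ‖ξ‖ * ‖J (-1 / 2) ξ‖ ≤ 1 := by
        exact (sq_le_one_iff₀ (by positivity)).1 h10
      exact (mul_le_mul_of_nonneg_right h8 (norm_nonneg _)).trans h11
    have : ‖(2 * Real.pi * Complex.I : ℂ)‖ = 2 * Real.pi := by simp [abs_of_pos Real.pi_pos]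
    rw [mul_assoc (2 * Real.pi * Complex.I : ℂ), norm_mul, this, norm_mul]
    have hp : 0 ≤ 2 * Real.pi := by positivity
    nlinarith

theorem continuous_rot_right (η : ℝ) : Continuous fun t : ℝ => rot (η, t) := by
  refine (PiLp.continuous_toLp 2 _).comp (continuous_pi fun i => ?_)
  fin_cases i <;> simp <;> fun_prop

theorem hasDerivAt_rot (η t : ℝ) :
    HasDerivAt (fun t : ℝ => rot (η, t)) (unitVec 0 - unitVec 1) t := by
  have h : (fun t : ℝ => rot (η, t)) = fun t => rot (η, 0) + t • (unitVec 0 - unitVec 1) := by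
    funext t
    refine PiLp.ext fun i => ?_
    fin_cases i <;> simp [rot, unitVec]
    ring
  rw [h]
  simpa using ((hasDerivAt_id t).smul_const (unitVec 0 - unitVec 1)).const_add (rot (η, 0))

theorem diag_eq_rot (x : ℝ) : diag x = rot (2 * x, 0) := by
  refine PiLp.ext fun i => ?_
  fin_cases i <;> simp [rot, diag]

/-- The one-dimensional estimate behind the trace inequality. -/
theorem norm_sq_diag_le (φ : 𝓢(Plane, ℂ)) (η : ℝ)
    (hi : Integrable fun t => ‖φ (rot (η, t))‖ ^ 2 + ‖(∂_{unitVec 0 - unitVec 1} φ) (rot (η, t))‖ ^ 2) :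
    ‖φ (rot (η, 0))‖ ^ 2 ≤
      ∫ t, (‖φ (rot (η, t))‖ ^ 2 + ‖(∂_{unitVec 0 - unitVec 1} φ) (rot (η, t))‖ ^ 2) := by
  set dφ := ∂_{unitVec 0 - unitVec 1} φ with hdφ
  have hd : ∀ t : ℝ, HasDerivAt (fun t => φ (rot (η, t))) (dφ (rot (η, t))) t := by
    intro t
    have h1 := (φ.differentiableAt (x := rot (η, t))).hasFDerivAt.comp_hasDerivAt t (hasDerivAt_rot η t)
    rw [hdφ, SchwartzMap.lineDerivOp_apply_eq_fderiv]
    exact h1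
  have hd2 : ∀ t ∈ Ici (0 : ℝ), HasDerivAt (fun t => ‖φ (rot (η, t))‖ ^ 2)
      (2 * inner ℝ (φ (rot (η, t))) (dφ (rot (η, t)))) t := fun t _ => (hd t).norm_sq
  have hbound : ∀ t, ‖2 * inner ℝ (φ (rot (η, t))) (dφ (rot (η, t)))‖ ≤
      ‖φ (rot (η, t))‖ ^ 2 + ‖dφ (rot (η, t))‖ ^ 2 := by
    intro t
    rw [norm_mul]
    have := norm_inner_le_norm (𝕜 := ℝ) (φ (rot (η, t))) (dφ (rot (η, t)))
    simp only [Real.norm_ofNat]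
    nlinarith [sq_nonneg (‖φ (rot (η, t))‖ - ‖dφ (rot (η, t))‖)]
  have hint : Integrable fun t => 2 * inner ℝ (φ (rot (η, t))) (dφ (rot (η, t))) := by
    refine hi.mono' ?_ (Eventually.of_forall hbound)
    refine Continuous.aestronglyMeasurable (continuous_const.mul ?_)
    exact (φ.continuous.comp (continuous_rot_right η)).inner (dφ.continuous.comp (continuous_rot_right η))
  have hlim : Tendsto (fun t => ‖φ (rot (η, t))‖ ^ 2) atTop (𝓝 0) := by
    have h1 : Tendsto (fun t : ℝ => rot (η, t)) atTop (cocompact Plane) := by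
      rw [← Metric.cobounded_eq_cocompact, ← tendsto_norm_atTop_iff_cobounded]
      refine tendsto_atTop_mono (fun t => ?_) tendsto_id
      have := norm_sq_rot η t
      by_contra hcon
      have hlt := not_le.1 hcon
      simp only [id] at hlt
      nlinarith [norm_nonneg (rot (η, t)), sq_nonneg η]
    have := ((φ.tendsto_cocompact).comp h1).norm.pow 2
    simpa using this
  have hftc := integral_Ioi_of_hasDerivAt_of_tendsto' hd2 hint.integrableOn hlim
  have : ‖φ (rot (η, 0))‖ ^ 2 = -∫ t in Ioi 0, 2 * inner ℝ (φ (rot (η, t))) (dφ (rot (η, t))) := by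
    rw [hftc]; ring
  rw [this]
  calc _ ≤ ‖∫ t in Ioi 0, 2 * inner ℝ (φ (rot (η, t))) (dφ (rot (η, t)))‖ := neg_le_abs _
    _ ≤ ∫ t in Ioi 0, ‖2 * inner ℝ (φ (rot (η, t))) (dφ (rot (η, t)))‖ := norm_integral_le_integral_norm _
    _ ≤ ∫ t, ‖2 * inner ℝ (φ (rot (η, t))) (dφ (rot (η, t)))‖ :=
        setIntegral_le_integral hint.norm (Eventually.of_forall fun t => norm_nonneg _)
    _ ≤ _ := integral_mono hint.norm hi hbound

theorem integrable_norm_sq_schwartz (φ : 𝓢(Plane, ℂ)) : Integrable fun ξ => ‖φ ξ‖ ^ 2 :=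
  (memLp_two_iff_integrable_sq_norm φ.continuous.aestronglyMeasurable).1 (φ.memLp 2)

theorem norm_sq_toLp {E : Type*} [NormedAddCommGroup E] [InnerProductSpace ℝ E] [FiniteDimensional ℝ E]
    [MeasurableSpace E] [BorelSpace E] {f : E → ℂ} (hf : MemLp f 2) :
    ‖(hf.toLp f : Lp ℂ 2 (volume : Measure E))‖ ^ 2 = ∫ x, ‖f x‖ ^ 2 := by
  have h := L2.inner_def (𝕜 := ℂ) (hf.toLp f : Lp ℂ 2 (volume : Measure E)) (hf.toLp f)
  rw [inner_self_eq_norm_sq_to_K] at h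
  have h2 : ∫ a, inner ℂ ((hf.toLp f : Lp ℂ 2 (volume : Measure E)) a) ((hf.toLp f : Lp ℂ 2 (volume : Measure E)) a)
      = ((∫ x, ‖f x‖ ^ 2 : ℝ) : ℂ) := by
    rw [← integral_complex_ofReal]
    refine integral_congr_ae ?_
    filter_upwards [hf.coeFn_toLp] with a ha
    rw [ha, inner_self_eq_norm_sq_to_K]
    norm_cast
  rw [h2] at h
  exact Complex.ofReal_injective (by simpa using h)

/-- The one-dimensional estimate on each line transversal to the diagonal is integrated along the
diagonal; the transversal derivative is `∂₀ - ∂₁`. -/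
theorem schwartz_trace (φ : 𝓢(Plane, ℂ)) :
    ∃ h : MemLp (fun x : ℝ => φ (diag x)) 2, ‖h.toLp _‖ ≤
      ‖φ.toLp 2 volume‖ + ‖(∂_{unitVec 0} φ).toLp 2 volume‖ + ‖(∂_{unitVec 1} φ).toLp 2 volume‖ := by
  set dφ := ∂_{unitVec 0 - unitVec 1} φ with hdφ
  have hd : dφ = ∂_{unitVec 0} φ - ∂_{unitVec 1} φ := by
    ext x
    simp [hdφ, SchwartzMap.lineDerivOp_apply_eq_fderiv]
  have hG : Integrable fun ξ => ‖φ ξ‖ ^ 2 + ‖dφ ξ‖ ^ 2 :=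
    (integrable_norm_sq_schwartz φ).add (integrable_norm_sq_schwartz dφ)
  have hG' := integrable_plane.2 hG
  have hcont : Continuous fun η : ℝ => rot (η, 0) := by
    refine (PiLp.continuous_toLp 2 _).comp (continuous_pi fun i => ?_)
    fin_cases i <;> simp <;> fun_prop
  have hle : ∀ᵐ η : ℝ, ‖φ (rot (η, 0))‖ ^ 2 ≤ ∫ t, (‖φ (rot (η, t))‖ ^ 2 + ‖dφ (rot (η, t))‖ ^ 2) := by
    filter_upwards [hG'.prod_right_ae] with η hη using norm_sq_diag_le φ η hη
  have hI : Integrable fun η : ℝ => ‖φ (rot (η, 0))‖ ^ 2 := by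
    refine hG'.integral_prod_left.mono' ?_ ?_
    · exact ((φ.continuous.comp hcont).norm.pow 2).aestronglyMeasurable
    · filter_upwards [hle] with η hη
      rwa [Real.norm_of_nonneg (by positivity)]
  have hle2 : ∫ η : ℝ, ‖φ (rot (η, 0))‖ ^ 2 ≤ ∫ ξ, (‖φ ξ‖ ^ 2 + ‖dφ ξ‖ ^ 2) := by
    rw [integral_plane, Measure.volume_eq_prod, integral_prod _ hG']
    exact integral_mono_ae hI hG'.integral_prod_left hle
  have hI2 : Integrable fun x : ℝ => ‖φ (diag x)‖ ^ 2 := by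
    simp_rw [diag_eq_rot]
    exact hI.comp_mul_left' two_ne_zero
  have hcd : Continuous fun x : ℝ => φ (diag x) := by
    simp_rw [diag_eq_rot]
    exact φ.continuous.comp (hcont.comp (continuous_const.mul continuous_id))
  have hmem : MemLp (fun x : ℝ => φ (diag x)) 2 :=
    (memLp_two_iff_integrable_sq_norm hcd.aestronglyMeasurable).2 hI2
  refine ⟨hmem, ?_⟩
  have h1 : ‖hmem.toLp _‖ ^ 2 ≤ ‖φ.toLp 2 volume‖ ^ 2 + ‖dφ.toLp 2 volume‖ ^ 2 := by
    rw [norm_sq_toLp hmem]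
    have e1 : ‖φ.toLp 2 volume‖ ^ 2 = ∫ ξ, ‖φ ξ‖ ^ 2 := norm_sq_toLp (φ.memLp 2)
    have e2 : ‖dφ.toLp 2 volume‖ ^ 2 = ∫ ξ, ‖dφ ξ‖ ^ 2 := norm_sq_toLp (dφ.memLp 2)
    rw [e1, e2, ← integral_add (integrable_norm_sq_schwartz φ) (integrable_norm_sq_schwartz dφ)]
    refine le_trans ?_ hle2
    simp_rw [diag_eq_rot]
    rw [Measure.integral_comp_mul_left (fun η => ‖φ (rot (η, 0))‖ ^ 2) 2, smul_eq_mul]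
    have : 0 ≤ ∫ η : ℝ, ‖φ (rot (η, 0))‖ ^ 2 := integral_nonneg fun _ => by positivity
    rw [abs_of_pos (by norm_num)]
    linarith
  have h2 : ‖dφ.toLp 2 volume‖ ≤ ‖(∂_{unitVec 0} φ).toLp 2 volume‖ + ‖(∂_{unitVec 1} φ).toLp 2 volume‖ := by
    have : dφ.toLp 2 volume = (∂_{unitVec 0} φ).toLp 2 volume - (∂_{unitVec 1} φ).toLp 2 volume := by
      rw [hd]
      exact map_sub (SchwartzMap.toLpCLM ℂ (E := Plane) ℂ 2 volume) _ _
    rw [this]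
    exact norm_sub_le _ _
  have h3 := norm_nonneg (φ.toLp 2 volume)
  have h4 := norm_nonneg (dφ.toLp 2 volume)
  have : ‖hmem.toLp _‖ ≤ ‖φ.toLp 2 volume‖ + ‖dφ.toLp 2 volume‖ := by
    refine abs_le_of_sq_le_sq' ?_ (by positivity) |>.2
    nlinarith
  linarith

/-- By the trace inequality the restrictions of an approximating Schwartz sequence are Cauchy in
`L²(ℝ)`. -/
theorem HasWeakGradient.exists_trace {u : L2Plane} {g : Fin 2 → L2Plane} (hu : HasWeakGradient u g) :
    ∃ Ψ, IsDiagonalTrace u Ψ := by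
  obtain ⟨φ, hφ, hg⟩ := exists_schwartz_approx hu
  choose hmem hbd using schwartz_trace
  let D : ℕ → L2Line := fun n => (hmem (φ n)).toLp _
  have hD : ∀ n m, ‖D n - D m‖ ≤ ‖(φ n).toLp 2 volume - (φ m).toLp 2 volume‖ +
      ‖(∂_{unitVec 0} (φ n)).toLp 2 volume - (∂_{unitVec 0} (φ m)).toLp 2 volume‖ +
      ‖(∂_{unitVec 1} (φ n)).toLp 2 volume - (∂_{unitVec 1} (φ m)).toLp 2 volume‖ := by
    intro n m
    have h := hbd (φ n - φ m)
    have e0 : D n - D m = (hmem (φ n - φ m)).toLp _ := by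
      rw [← MemLp.toLp_sub]; rfl
    have e1 : (φ n - φ m).toLp 2 volume = (φ n).toLp 2 volume - (φ m).toLp 2 volume :=
      map_sub (SchwartzMap.toLpCLM ℂ (E := Plane) ℂ 2 volume) _ _
    have e2 : ∀ i, (∂_{unitVec i} (φ n - φ m)).toLp 2 volume =
        (∂_{unitVec i} (φ n)).toLp 2 volume - (∂_{unitVec i} (φ m)).toLp 2 volume := by
      intro i
      have : ∂_{unitVec i} (φ n - φ m) = ∂_{unitVec i} (φ n) - ∂_{unitVec i} (φ m) := by
        ext x
        simp only [SchwartzMap.lineDerivOp_apply_eq_fderiv, sub_apply]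
        have : ⇑(φ n - φ m) = ⇑(φ n) - ⇑(φ m) := rfl
        rw [this, fderiv_sub (φ n).differentiableAt (φ m).differentiableAt]
        rfl
      rw [this]
      exact map_sub (SchwartzMap.toLpCLM ℂ (E := Plane) ℂ 2 volume) _ _
    rw [e0]
    rwa [e1, e2, e2] at h
  have hcau : CauchySeq D := by
    have c0 := cauchySeq_iff_tendsto_dist_atTop_0.1 hφ.cauchySeq
    have c1 := cauchySeq_iff_tendsto_dist_atTop_0.1 (hg 0).cauchySeq
    have c2 := cauchySeq_iff_tendsto_dist_atTop_0.1 (hg 1).cauchySeq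
    rw [cauchySeq_iff_tendsto_dist_atTop_0]
    have c3 := (c0.add c1).add c2
    simp only [add_zero] at c3
    refine squeeze_zero (fun _ => dist_nonneg) (fun p => ?_) c3
    simp only [dist_eq_norm]
    exact hD p.1 p.2
  obtain ⟨Ψ, hΨ⟩ := cauchySeq_tendsto_of_complete hcau
  refine ⟨Ψ, g, hu, φ, hφ, hg, ?_⟩
  have h1 := Lp.tendsto_Lp_iff_tendsto_eLpNorm' (fun n => D n) Ψ |>.1 hΨ
  refine h1.congr fun n => ?_
  refine eLpNorm_congr_ae ?_
  filter_upwards [(hmem (φ n)).coeFn_toLp] with x hx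
  simp only [Pi.sub_apply, D]
  rw [hx]

end Sobolev

end DeltaDiagonal

namespace DeltaDiagonal

open Set
open scoped FourierTransform

/-! ### The diagonal trace on the Fourier side -/

section FourierPairing

/-- Fubini for a bounded oscillating kernel. -/
theorem integral_kernel_swap {X Y : Type*} [MeasurableSpace X] [MeasurableSpace Y] {μ : Measure X}
    {ν : Measure Y} [SFinite μ] [SFinite ν] {p : X × Y → ℂ}
    (hp : AEStronglyMeasurable p (μ.prod ν)) {C : ℝ} (hC : ∀ z, ‖p z‖ ≤ C) {A : X → ℂ} {B : Y → ℂ}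
    (hA : Integrable A μ) (hB : Integrable B ν) :
    ∫ x, A x * ∫ y, p (x, y) * B y ∂ν ∂μ = ∫ y, (∫ x, p (x, y) * A x ∂μ) * B y ∂ν := by
  have hI : Integrable (Function.uncurry fun x y => A x * (p (x, y) * B y)) (μ.prod ν) := by
    have h := (hA.mul_prod hB).bdd_mul (c := C) hp (Eventually.of_forall hC)
    refine h.congr (Eventually.of_forall fun z => ?_)
    simp only [Function.uncurry]; ring
  calc _ = ∫ x, ∫ y, A x * (p (x, y) * B y) ∂ν ∂μ := by simp_rw [integral_const_mul]
    _ = ∫ y, ∫ x, A x * (p (x, y) * B y) ∂μ ∂ν := integral_integral_swap hI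
    _ = _ := by
      congr 1; ext y
      rw [← integral_mul_const]
      congr 1; ext x; ring

/-- The Fourier transform of the measure `F(x) dx` on the diagonal. -/
def dHat (F : ℝ → ℂ) (ξ : Plane) : ℂ := ∫ x : ℝ, phase x ξ * F x

theorem dHat_eq (F : ℝ → ℂ) (ξ : Plane) : dHat F ξ = 𝓕 F (ξ 0 + ξ 1) := by
  rw [Real.fourier_real_eq_integral_exp_smul, dHat]
  congr 1; ext x
  rw [phase, smul_eq_mul]
  congr 2
  push_cast; ring

theorem continuous_fourier {F : ℝ → ℂ} (hF : Integrable F) : Continuous (𝓕 F) := by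
  have := VectorFourier.fourierIntegral_continuous (L := innerₗ ℝ) Real.continuous_fourierChar
    (by exact continuous_inner) hF
  exact this

theorem continuous_dHat {F : ℝ → ℂ} (hF : Integrable F) : Continuous (dHat F) := by
  have : dHat F = fun ξ => 𝓕 F (ξ 0 + ξ 1) := funext (dHat_eq F)
  rw [this]
  exact (continuous_fourier hF).comp (by fun_prop)

theorem norm_dHat_le (F : ℝ → ℂ) (ξ : Plane) : ‖dHat F ξ‖ ≤ ∫ x, ‖F x‖ := by
  refine (norm_integral_le_integral_norm _).trans (le_of_eq ?_)
  simp [norm_phase]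

theorem dHat_rot (F : ℝ → ℂ) (η t : ℝ) : dHat F (rot (η, t)) = 𝓕 F η := by
  rw [dHat_eq, rot_add]

theorem memLp_dHat_div_symb {κ : ℂ} (hκ : 0 < κ.re) {F : ℝ → ℂ} (hF : Integrable F) :
    MemLp (fun ξ => dHat F ξ / symb κ ξ) 2 :=
  memLp_bounded_div_symb hκ (continuous_dHat hF).aestronglyMeasurable (norm_dHat_le F)

theorem schwartz_eq_integral_phase (φ : 𝓢(Plane, ℂ)) (x : ℝ) :
    (starRingEnd ℂ) (φ (diag x)) = ∫ ξ, phase x ξ * (starRingEnd ℂ) (𝓕 φ ξ) := by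
  have h : φ (diag x) = 𝓕⁻ (𝓕 φ) (diag x) := by rw [FourierTransform.fourierInv_fourier_eq]
  rw [h, SchwartzMap.fourierInv_coe, Real.fourierInv_eq', ← integral_conj]
  congr 1; ext ξ
  rw [smul_eq_mul, map_mul, ← Complex.exp_conj, phase]
  congr 2
  simp only [map_mul, Complex.conj_I, Complex.conj_ofReal, diag, EuclideanSpace.inner_eq_star_dotProduct]
  simp [Fin.sum_univ_two, dotProduct]
  ring

/-- The diagonal trace of a Schwartz function on the Fourier side. -/
theorem schwartz_diag_pairing (φ : 𝓢(Plane, ℂ)) {F : ℝ → ℂ} (hF : Integrable F) :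
    ∫ x, (starRingEnd ℂ) (φ (diag x)) * F x = ∫ ξ, (starRingEnd ℂ) (𝓕 φ ξ) * dHat F ξ := by
  simp_rw [schwartz_eq_integral_phase, mul_comm _ (F _)]
  have hB : Integrable fun ξ => (starRingEnd ℂ) (𝓕 φ ξ) :=
    (Complex.conjCLE.toContinuousLinearMap).integrable_comp (𝓕 φ).integrable
  rw [integral_kernel_swap (p := fun z : ℝ × Plane => phase z.1 z.2)
    continuous_phase.aestronglyMeasurable (C := 1) (fun z => (norm_phase _ _).le) hF hB]
  simp_rw [mul_comm _ (dHat F _)]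
  rfl

theorem fourier_pairing {H : ℝ → ℂ} (hH : Integrable H) (ψ : 𝓢(ℝ, ℂ)) :
    ∫ η, (starRingEnd ℂ) (𝓕 H η) * 𝓕 ψ η = ∫ x, (starRingEnd ℂ) (H x) * ψ x := by
  have h := VectorFourier.integral_sesq_fourierIntegral_eq_neg_flip (L := innerₗ ℝ) (innerSL ℂ (E := ℂ))
    Real.continuous_fourierChar (by exact continuous_inner) hH ((𝓕 ψ : 𝓢(ℝ, ℂ)).integrable (μ := volume))
  have e : ∀ x, VectorFourier.fourierIntegral Real.fourierChar volume (-(innerₗ ℝ).flip) (𝓕 ψ : 𝓢(ℝ, ℂ)) x = ψ x := by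
    intro x
    have : 𝓕⁻ (𝓕 ψ) x = ψ x := by rw [FourierTransform.fourierInv_fourier_eq]
    rw [← this, SchwartzMap.fourierInv_coe]
    simp only [VectorFourier.fourierIntegral, Real.fourierInv_eq]
    simp
  simp_rw [e] at h
  simp only [innerSL_apply_apply, RCLike.inner_apply] at h
  simp_rw [mul_comm ((starRingEnd ℂ) _)]
  exact h

/-- Testing against Schwartz functions shows that the Fourier integral of `F` agrees almost
everywhere with its `L²` Fourier transform. -/
theorem memLp_fourier {F : ℝ → ℂ} (hF : Integrable F) (hF2 : MemLp F 2) : MemLp (𝓕 F) 2 := by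
  have : ((𝓕 (hF2.toLp F) : L2Line) : ℝ → ℂ) =ᵐ[volume] 𝓕 F := by
    refine ae_eq_of_schwartz ((Lp.memLp _).locallyIntegrable (by norm_num))
      (continuous_fourier hF).locallyIntegrable fun ψ => ?_
    have h1 := Lp.toTemperedDistribution_apply (𝓕 (hF2.toLp F) : L2Line) ψ
    rw [← Lp.fourier_toTemperedDistribution_eq, TemperedDistribution.fourier_apply,
      Lp.toTemperedDistribution_apply] at h1
    simp only [smul_eq_mul] at h1
    rw [← h1]
    have h2 := VectorFourier.integral_fourierIntegral_smul_eq_flip (L := innerₗ ℝ) (f := (ψ : ℝ → ℂ))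
      Real.continuous_fourierChar (by exact continuous_inner) (ψ.integrable (μ := volume)) hF
    simp only [smul_eq_mul] at h2
    have e1 : ∀ ξ, VectorFourier.fourierIntegral Real.fourierChar volume (innerₗ ℝ) ψ ξ = 𝓕 ψ ξ := by
      intro ξ; rw [SchwartzMap.fourier_coe]; rfl
    have e2 : ∀ ξ, VectorFourier.fourierIntegral Real.fourierChar volume (innerₗ ℝ).flip F ξ = 𝓕 F ξ := by
      intro ξ; rw [flip_innerₗ]; rfl
    simp_rw [e1, e2] at h2
    rw [← h2]
    refine integral_congr_ae ?_
    filter_upwards [hF2.coeFn_toLp] with x hx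
    rw [hx]
  exact (memLp_congr_ae this).1 (Lp.memLp _)

/-- In the coordinates `(η, t)` the symbol is bounded below by `δ(t² + |κ|²)` uniformly in `η`, so
the majorant is a product. -/
theorem integrable_div_symb_rot {κ : ℂ} (hκ : 0 < κ.re) {A : ℝ → ℂ} (hA : Integrable A) :
    Integrable fun p : ℝ × ℝ => A p.1 / symb κ (rot p) := by
  obtain ⟨δ, h0, h1, h2⟩ := exists_sector hκ
  have hn : 0 < ‖κ‖ := norm_pos_iff.2 (by rintro rfl; simp at hκ)
  have hI2 : Integrable fun t : ℝ => δ⁻¹ * (t ^ 2 + ‖κ‖ ^ 2)⁻¹ := by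
    have := (integrable_inv_sq_add (z := ((‖κ‖ : ℝ) : ℂ)) (by
      rw [Complex.ofReal_re]; positivity)).norm
    refine (this.const_mul δ⁻¹).congr (Eventually.of_forall fun t => ?_)
    have e : (t : ℂ) ^ 2 + ((‖κ‖ : ℝ) : ℂ) ^ 2 = ((t ^ 2 + ‖κ‖ ^ 2 : ℝ) : ℂ) := by push_cast; rfl
    simp only []
    rw [e, norm_div, norm_one, Complex.norm_real, Real.norm_of_nonneg (by positivity), one_div]
  refine (hA.norm.mul_prod hI2).mono' ?_ (Eventually.of_forall fun p => ?_)
  · simp_rw [div_eq_mul_inv]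
    exact hA.1.comp_fst.mul ((continuous_symb κ).measurable.comp rot.measurable).inv.aestronglyMeasurable
  · rw [norm_div, div_eq_mul_inv, ← mul_inv]
    gcongr
    have h3 := norm_symb_ge h0.le h1 h2 (rot p)
    refine le_trans ?_ h3
    rw [show rot p = rot (p.1, p.2) from rfl, norm_sq_rot]
    have : 1 ≤ Real.pi ^ 2 := by nlinarith [Real.pi_gt_three]
    gcongr
    nlinarith [sq_nonneg p.1, sq_nonneg p.2]

/-- The free resolvent maps a square integrable density on the diagonal into `H¹`. One factor of
`|symb κ|` absorbs `|ξ_i|²`, and the remaining `1/|symb κ|` is integrable across the diagonal. -/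
theorem memLp_coord_dHat {κ : ℂ} (hκ : 0 < κ.re) {F : ℝ → ℂ} (hF : Integrable F) (hF2 : MemLp F 2)
    (i : Fin 2) : MemLp (fun ξ : Plane => (ξ i : ℂ) * (dHat F ξ / symb κ ξ)) 2 := by
  obtain ⟨δ, h0, h1, h2⟩ := exists_sector hκ
  have hcont : Continuous fun ξ : Plane => (ξ i : ℂ) * (dHat F ξ / symb κ ξ) :=
    (by fun_prop : Continuous fun ξ : Plane => (ξ i : ℂ)).mul
      ((continuous_dHat hF).div (continuous_symb κ) (symb_ne_zero hκ))
  refine (memLp_two_iff_integrable_sq_norm hcont.aestronglyMeasurable).2 ?_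
  rw [← integrable_plane]
  have hI1 : Integrable fun η => ((‖𝓕 F η‖ ^ 2 : ℝ) : ℂ) := ((memLp_two_iff_integrable_sq_norm
    (continuous_fourier hF).aestronglyMeasurable).1 (memLp_fourier hF hF2)).ofReal
  refine ((integrable_div_symb_rot hκ hI1).norm.const_mul δ⁻¹).mono'
    ((hcont.norm.pow 2).measurable.comp rot.measurable).aestronglyMeasurable
    (Eventually.of_forall fun p => ?_)
  rw [Real.norm_of_nonneg (by positivity), show rot p = rot (p.1, p.2) from rfl,
    dHat_rot]
  set ξ := rot (p.1, p.2)
  have hs : 0 < ‖symb κ ξ‖ := norm_pos_iff.2 (symb_ne_zero hκ ξ)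
  have h3 := norm_symb_ge h0.le h1 h2 ξ
  have h4 : ‖(ξ i : ℂ)‖ ≤ ‖ξ‖ := by
    rw [Complex.norm_real]; exact PiLp.norm_apply_le ξ i
  have h8 : ‖((‖𝓕 F p.1‖ ^ 2 : ℝ) : ℂ)‖ = ‖𝓕 F p.1‖ ^ 2 := by
    rw [Complex.norm_real, Real.norm_of_nonneg (by positivity)]
  rw [norm_mul, norm_div, norm_div, h8, mul_pow, div_pow]
  have h5 : ‖(ξ i : ℂ)‖ ^ 2 ≤ δ⁻¹ * ‖symb κ ξ‖ := by
    rw [inv_mul_eq_div, le_div_iff₀ h0]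
    have h6 : 1 ≤ Real.pi ^ 2 := by nlinarith [Real.pi_gt_three]
    have h7 : ‖(ξ i : ℂ)‖ ^ 2 ≤ ‖ξ‖ ^ 2 := by gcongr
    refine le_trans ?_ h3
    rw [mul_comm]
    gcongr
    nlinarith [sq_nonneg ‖ξ‖, sq_nonneg ‖κ‖]
  calc ‖(ξ i : ℂ)‖ ^ 2 * (‖𝓕 F p.1‖ ^ 2 / ‖symb κ ξ‖ ^ 2)
      ≤ (δ⁻¹ * ‖symb κ ξ‖) * (‖𝓕 F p.1‖ ^ 2 / ‖symb κ ξ‖ ^ 2) := by gcongr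
    _ = _ := by field_simp

/-- Let `w = (-Δ + 1)⁻¹` applied to the measure `ψ dx` on the diagonal. The `H¹` inner product with
`w` is continuous and is the pairing with `ψ` for Schwartz functions, hence for `u` in the limit. In
particular `u` determines its trace. -/
theorem trace_pairing {u : L2Plane} {g : Fin 2 → L2Plane} (hu : HasWeakGradient u g) {Φ : L2Line}
    (hΦ : IsDiagonalTrace u Φ) (ψ : 𝓢(ℝ, ℂ)) :
    ∫ x, (starRingEnd ℂ) (Φ x) * ψ x = ∫ ξ, (starRingEnd ℂ) ((𝓕 u : L2Plane) ξ) * dHat ψ ξ := by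
  have h1 : 0 < (1 : ℂ).re := by simp
  obtain ⟨g', hg', φ, hφ, hφg, hφt⟩ := hΦ
  obtain rfl := hg'.unique hu
  have hψ := ψ.integrable (μ := volume)
  have hw := memLp_dHat_div_symb h1 hψ
  set w : L2Plane := 𝓕⁻ (hw.toLp _) with hwdef
  have hw1 : ((𝓕 w : L2Plane) : Plane → ℂ) =ᵐ[volume] fun ξ => dHat ψ ξ / symb 1 ξ := by
    rw [hwdef, FourierTransform.fourier_fourierInv_eq]
    exact hw.coeFn_toLp
  obtain ⟨G, hG⟩ : ∃ G, HasWeakGradient w G := by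
    refine exists_hasWeakGradient fun i => ?_
    refine (memLp_congr_ae ?_).2 (memLp_coord_dHat h1 hψ (ψ.memLp 2) i)
    filter_upwards [hw1] with ξ hξ
    rw [hξ]
  have key : ∀ {v : L2Plane} {h : Fin 2 → L2Plane}, HasWeakGradient v h →
      ∑ i, inner ℂ (h i) (G i) + 1 ^ 2 * inner ℂ v w =
        ∫ ξ, (starRingEnd ℂ) ((𝓕 v : L2Plane) ξ) * dHat ψ ξ := by
    intro v h hv
    rw [gradient_inner hv hG]
    refine integral_congr_ae ?_
    filter_upwards [hw1] with ξ hξ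
    rw [hξ, mul_div_cancel₀ _ (symb_ne_zero h1 ξ)]
  rw [← key hu]
  choose hmem hbd using schwartz_trace
  let D : ℕ → L2Line := fun n => (hmem (φ n)).toLp _
  have hD : Tendsto D atTop (𝓝 Φ) := by
    refine (Lp.tendsto_Lp_iff_tendsto_eLpNorm' D Φ).2 (hφt.congr fun n => ?_)
    refine eLpNorm_congr_ae ?_
    filter_upwards [(hmem (φ n)).coeFn_toLp] with x hx
    simp only [Pi.sub_apply, D]
    rw [hx]
  have hpair : ∀ E : L2Line, inner ℂ E (ψ.toLp 2 volume) = ∫ x, (starRingEnd ℂ) (E x) * ψ x := by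
    intro E
    rw [L2.inner_def]
    refine integral_congr_ae ?_
    filter_upwards [ψ.coeFn_toLp 2 volume] with x hx
    rw [hx, RCLike.inner_apply, mul_comm]
  have hn : ∀ n, inner ℂ (D n) (ψ.toLp 2 volume) =
      ∑ i, inner ℂ ((∂_{unitVec i} (φ n)).toLp 2 volume) (G i) + 1 ^ 2 * inner ℂ ((φ n).toLp 2 volume) w := by
    intro n
    rw [key (hasWeakGradient_schwartz (φ n)), hpair]
    have e1 : ∫ x, (starRingEnd ℂ) (D n x) * ψ x = ∫ x, (starRingEnd ℂ) (φ n (diag x)) * ψ x := by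
      refine integral_congr_ae ?_
      filter_upwards [(hmem (φ n)).coeFn_toLp] with x hx
      simp only [D]; rw [hx]
    rw [e1, schwartz_diag_pairing _ hψ, SchwartzMap.toLp_fourier_eq]
    refine integral_congr_ae ?_
    filter_upwards [(𝓕 (φ n)).coeFn_toLp 2 volume] with ξ hξ
    rw [hξ]
  rw [← hpair]
  refine tendsto_nhds_unique (hD.inner tendsto_const_nhds) ?_
  simp_rw [hn]
  refine Tendsto.add (tendsto_finsetSum _ fun i _ => (hφg i).inner tendsto_const_nhds) ?_
  exact (hφ.inner tendsto_const_nhds).const_mul _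

open scoped Convolution in
/-- The diagonal trace of `(f - F(x₁) δ(x₁ - x₂))` under the free resolvent. -/
theorem trace_eq {κ : ℂ} (hκ : 0 < κ.re) {u f : L2Plane} {g : Fin 2 → L2Plane} {F : ℝ → ℂ}
    (hF : Integrable F) (hu : HasWeakGradient u g)
    (h : ((𝓕 u : L2Plane) : Plane → ℂ) =ᵐ[volume]
      fun ξ => ((𝓕 f : L2Plane) ξ - dHat F ξ) / symb κ ξ) {Φ : L2Line} (hΦ : IsDiagonalTrace u Φ) :
    Φ =ᵐ[volume] fun x => inner ℂ (gLp (re_conj_pos hκ) x) (𝓕 f : L2Plane) -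
      ∫ w, bKer κ w * F (x - w) := by
  set H : ℝ → ℂ := bKer κ ⋆[ContinuousLinearMap.mul ℂ ℂ] F with hHdef
  have hH : Integrable H := (integrable_bKer hκ).integrable_convolution _ hF
  set Gf : ℝ → ℂ := fun x => inner ℂ (gLp (re_conj_pos hκ) x) (𝓕 f : L2Plane) with hGf
  have hGc : Continuous Gf := (continuous_gLp (re_conj_pos hκ)).inner continuous_const
  have hB : Integrable fun ξ => (𝓕 f : L2Plane) ξ / symb κ ξ := by
    have := (Lp.memLp (𝓕 f : L2Plane)).integrable_mul (memLp_inv_symb hκ)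
    refine this.congr (Eventually.of_forall fun ξ => ?_)
    simp [div_eq_mul_inv]
  have hGf' : ∀ x, (starRingEnd ℂ) (Gf x) =
      ∫ ξ, phase x ξ * (starRingEnd ℂ) ((𝓕 f : L2Plane) ξ / symb κ ξ) := by
    intro x
    change (starRingEnd ℂ) (inner ℂ (gLp _ x) (𝓕 f : L2Plane)) = _
    rw [L2.inner_def, ← integral_conj]
    refine integral_congr_ae ?_
    filter_upwards [coeFn_gLp (re_conj_pos hκ) x] with ξ hξ
    rw [hξ, RCLike.inner_apply, map_mul, Complex.conj_conj, map_div₀, conj_symb]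
    ring
  -- Both sides are compared after conjugation, since `trace_pairing` tests the conjugate of the
  -- trace.
  have hstar : (fun x => (starRingEnd ℂ) (Φ x)) =ᵐ[volume] fun x => (starRingEnd ℂ) (Gf x - H x) := by
    have hst : ∀ {A : ℝ → ℂ}, LocallyIntegrable A → LocallyIntegrable fun x => (starRingEnd ℂ) (A x) :=
      fun hA x => by
        obtain ⟨s, hs, hi⟩ := hA x
        exact ⟨s, hs, (Complex.conjCLE.toContinuousLinearMap).integrable_comp hi⟩
    refine ae_eq_of_schwartz (hst ((Lp.memLp Φ).locallyIntegrable (by norm_num)))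
      (hst (hGc.locallyIntegrable.sub hH.locallyIntegrable)) fun ψ => ?_
    have hψ := ψ.integrable (μ := volume)
    simp_rw [mul_comm (ψ _)]
    rw [trace_pairing hu hΦ]
    have hB' : Integrable fun ξ => (starRingEnd ℂ) ((𝓕 f : L2Plane) ξ / symb κ ξ) :=
      (Complex.conjCLE.toContinuousLinearMap).integrable_comp hB
    have hfψ : Integrable fun η => (starRingEnd ℂ) (𝓕 F η) * 𝓕 ψ η := by
      refine (𝓕 ψ).integrable.bdd_mul (c := ∫ x, ‖F x‖) ?_ (Eventually.of_forall fun η => ?_)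
      · exact ((Complex.continuous_conj.comp (continuous_fourier hF))).aestronglyMeasurable
      · rw [RCLike.norm_conj]
        have := norm_dHat_le F (rot (η, 0))
        rwa [dHat_rot] at this
    have hC : Integrable fun ξ => (starRingEnd ℂ) (dHat F ξ / symb κ ξ) * dHat ψ ξ := by
      rw [← integrable_plane]
      have h2 := integrable_div_symb_rot (re_conj_pos hκ) hfψ
      refine h2.congr (Eventually.of_forall fun p => ?_)
      beta_reduce
      rw [show rot p = rot (p.1, p.2) from rfl, dHat_rot, dHat_rot, map_div₀,
        conj_symb, ← SchwartzMap.fourier_coe]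
      ring
    have e1 : ∫ ξ, (starRingEnd ℂ) ((𝓕 f : L2Plane) ξ / symb κ ξ) * dHat ψ ξ =
        ∫ x, (starRingEnd ℂ) (Gf x) * ψ x := by
      simp_rw [hGf', mul_comm _ (ψ _)]
      rw [integral_kernel_swap (p := fun z : ℝ × Plane => phase z.1 z.2)
        continuous_phase.aestronglyMeasurable (C := 1) (fun z => (norm_phase _ _).le) hψ hB']
      simp_rw [mul_comm _ (dHat _ _)]
      rfl
    -- The transform of a diagonal density is constant across the diagonal. The transversal integral
    -- therefore acts on `1 / symb κ` alone and gives the transform of `b_κ`; the product of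
    -- transforms belongs to the convolution.
    have e2 : ∫ ξ, (starRingEnd ℂ) (dHat F ξ / symb κ ξ) * dHat ψ ξ =
        ∫ x, (starRingEnd ℂ) (H x) * ψ x := by
      rw [← fourier_pairing hH]
      rw [← integrable_plane] at hC
      rw [integral_plane, Measure.volume_eq_prod, integral_prod _ hC]
      refine integral_congr_ae (Eventually.of_forall fun η => ?_)
      simp only []
      rw [hHdef, Real.fourier_mul_convolution_eq (integrable_bKer hκ) hF]
      simp_rw [dHat_rot, ← SchwartzMap.fourier_coe]
      rw [integral_mul_const]
      congr 1
      rw [integral_conj]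
      congr 1
      simp_rw [div_eq_mul_one_div (𝓕 F η)]
      rw [integral_const_mul, mul_comm, integral_inv_symb_rot hκ, Real.fourier_real_eq_integral_exp_smul (bKer κ)]
      congr 2
      ext w
      rw [smul_eq_mul, mul_comm]
      congr 2
      push_cast; ring
    have hBψ : Integrable fun ξ => (starRingEnd ℂ) ((𝓕 f : L2Plane) ξ / symb κ ξ) * dHat ψ ξ :=
      hB'.mul_bdd (c := ∫ x, ‖ψ x‖) (continuous_dHat hψ).aestronglyMeasurable
        (Eventually.of_forall (norm_dHat_le ψ))
    have hGψ : Integrable fun x => (starRingEnd ℂ) (Gf x) * ψ x := by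
      have hb : ∀ x, ‖Gf x‖ ≤ ∫ ξ, ‖(starRingEnd ℂ) ((𝓕 f : L2Plane) ξ / symb κ ξ)‖ := fun x => by
        rw [← RCLike.norm_conj, hGf']
        exact norm_integral_phase_le x
      refine hψ.bdd_mul (Complex.continuous_conj.comp hGc).aestronglyMeasurable
        (Eventually.of_forall fun x => ?_) (c := ∫ ξ, ‖(starRingEnd ℂ) ((𝓕 f : L2Plane) ξ / symb κ ξ)‖)
      rw [RCLike.norm_conj]
      exact hb x
    have hHψ : Integrable fun x => (starRingEnd ℂ) (H x) * ψ x := by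
      refine ((Complex.conjCLE.toContinuousLinearMap).integrable_comp hH).mul_bdd
        (c := (SchwartzMap.seminorm ℝ 0 0) ψ) ψ.continuous.aestronglyMeasurable
        (Eventually.of_forall fun x => SchwartzMap.norm_le_seminorm ℝ ψ x)
    have e3 : ∫ ξ, (starRingEnd ℂ) ((𝓕 u : L2Plane) ξ) * dHat ψ ξ =
        ∫ ξ, ((starRingEnd ℂ) ((𝓕 f : L2Plane) ξ / symb κ ξ) * dHat ψ ξ -
          (starRingEnd ℂ) (dHat F ξ / symb κ ξ) * dHat ψ ξ) := by
      refine integral_congr_ae ?_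
      filter_upwards [h] with ξ hξ
      rw [hξ, sub_div, map_sub, sub_mul]
    rw [e3, integral_sub hBψ hC, e1, e2, ← integral_sub hGψ hHψ]
    congr 1; ext x
    rw [map_sub, sub_mul]
  filter_upwards [hstar] with x hx
  have := congrArg (starRingEnd ℂ) hx
  rw [Complex.conj_conj, Complex.conj_conj] at this
  exact this

end FourierPairing

end DeltaDiagonal

namespace DeltaDiagonal

open Set BoundedContinuousFunction
open scoped FourierTransform

/-! ### The integral operator of the line equation -/

section ConvolutionOperator

variable {H : Type*} [NormedAddCommGroup H] [NormedSpace ℂ H]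

theorem norm_convOp_integrand_le (b : ℝ → ℂ) (V : ℝ →ᵇ ℂ) (E : ℝ →ᵇ H) (x w : ℝ) :
    ‖(b w * V (x - w)) • E (x - w)‖ ≤ ‖b w‖ * (‖V‖ * ‖E‖) := by
  rw [norm_smul, norm_mul, mul_assoc]
  gcongr
  · exact V.norm_coe_le_norm _
  · exact E.norm_coe_le_norm _

theorem aestronglyMeasurable_convOp_integrand {b : ℝ → ℂ} (hb : Integrable b) (V : ℝ →ᵇ ℂ)
    (E : ℝ →ᵇ H) (x : ℝ) :
    AEStronglyMeasurable (fun w => (b w * V (x - w)) • E (x - w)) volume := by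
  have h1 : Continuous fun w : ℝ => V (x - w) := V.continuous.comp (by fun_prop)
  have h2 : Continuous fun w : ℝ => E (x - w) := E.continuous.comp (by fun_prop)
  exact (hb.1.mul h1.aestronglyMeasurable).smul h2.aestronglyMeasurable

theorem integrable_convOp_integrand {b : ℝ → ℂ} (hb : Integrable b) (V : ℝ →ᵇ ℂ) (E : ℝ →ᵇ H)
    (x : ℝ) : Integrable fun w => (b w * V (x - w)) • E (x - w) :=
  (hb.norm.mul_const (‖V‖ * ‖E‖)).mono' (aestronglyMeasurable_convOp_integrand hb V E x)
    (Eventually.of_forall fun w => norm_convOp_integrand_le b V E x w)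

theorem norm_convOp_le (b : ℝ → ℂ) (V : ℝ →ᵇ ℂ) (E : ℝ →ᵇ H) (x : ℝ) (hb : Integrable b) :
    ‖∫ w, (b w * V (x - w)) • E (x - w)‖ ≤ (‖V‖ * ∫ w, ‖b w‖) * ‖E‖ := by
  refine (norm_integral_le_of_norm_le (hb.norm.mul_const (‖V‖ * ‖E‖))
    (Eventually.of_forall fun w => norm_convOp_integrand_le b V E x w)).trans (le_of_eq ?_)
  rw [integral_mul_const]; ring

/-- The operator `E ↦ b ∗ (V E)` on bounded continuous functions. -/
def convOp {b : ℝ → ℂ} (hb : Integrable b) (V : ℝ →ᵇ ℂ) : (ℝ →ᵇ H) →L[ℂ] (ℝ →ᵇ H) :=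
  LinearMap.mkContinuous
    { toFun := fun E => BoundedContinuousFunction.ofNormedAddCommGroup
        (fun x => ∫ w, (b w * V (x - w)) • E (x - w))
        (continuous_of_dominated (fun x => aestronglyMeasurable_convOp_integrand hb V E x)
          (fun x => Eventually.of_forall fun w => norm_convOp_integrand_le b V E x w)
          (hb.norm.mul_const (‖V‖ * ‖E‖))
          (Eventually.of_forall fun w => by
            have h1 : Continuous fun x : ℝ => V (x - w) := V.continuous.comp (by fun_prop)
            have h2 : Continuous fun x : ℝ => E (x - w) := E.continuous.comp (by fun_prop)
            exact (continuous_const.mul h1).smul h2))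
        _ (fun x => norm_convOp_le b V E x hb)
      map_add' := fun E G => by
        ext x
        simp only [coe_ofNormedAddCommGroup, BoundedContinuousFunction.coe_add, Pi.add_apply, smul_add]
        exact integral_add (integrable_convOp_integrand hb V E x) (integrable_convOp_integrand hb V G x)
      map_smul' := fun c E => by
        ext x
        simp only [coe_ofNormedAddCommGroup, BoundedContinuousFunction.coe_smul, RingHom.id_apply]
        rw [← integral_smul]
        congr 1; ext w
        rw [smul_comm] }
    (‖V‖ * ∫ w, ‖b w‖)
    (fun E => by
      refine (BoundedContinuousFunction.norm_le (by positivity)).2 fun x => ?_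
      exact norm_convOp_le b V E x hb)

theorem convOp_apply {b : ℝ → ℂ} (hb : Integrable b) (V : ℝ →ᵇ ℂ) (E : ℝ →ᵇ H) (x : ℝ) :
    convOp hb V E x = ∫ w, (b w * V (x - w)) • E (x - w) := rfl

theorem norm_convOp {b : ℝ → ℂ} (hb : Integrable b) (V : ℝ →ᵇ ℂ) :
    ‖(convOp hb V : (ℝ →ᵇ H) →L[ℂ] (ℝ →ᵇ H))‖ ≤ ‖V‖ * ∫ w, ‖b w‖ :=
  LinearMap.mkContinuous_norm_le _ (by positivity) _

end ConvolutionOperator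

/-! ### Neumann series -/

section Neumann

variable {X : Type*} [NormedAddCommGroup X] [NormedSpace ℂ X]

theorem exists_eq_sub_apply [CompleteSpace X] (K : X →L[ℂ] X) (hK : ‖K‖ ≤ 1 / 2) (e : X) : ∃ h, h = e - K h := by
  have hu : IsUnit (1 - -K) := isUnit_one_sub_of_norm_lt_one (by rw [norm_neg]; linarith)
  obtain ⟨v, hv⟩ := hu
  refine ⟨(↑v⁻¹ : X →L[ℂ] X) e, ?_⟩
  have h1 : (1 - -K) ((↑v⁻¹ : X →L[ℂ] X) e) = e := by
    rw [← hv]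
    have := congrArg (fun T : X →L[ℂ] X => T e) v.mul_inv
    exact this
  have h2 : (↑v⁻¹ : X →L[ℂ] X) e + K ((↑v⁻¹ : X →L[ℂ] X) e) = e := by simpa using h1
  exact eq_sub_of_add_eq h2

theorem norm_le_of_eq_sub_apply {K : X →L[ℂ] X} (hK : ‖K‖ ≤ 1 / 2) {e h : X} (hh : h = e - K h) :
    ‖h‖ ≤ 2 * ‖e‖ := by
  have h1 : ‖h‖ ≤ ‖e‖ + ‖K h‖ := by
    calc ‖h‖ = ‖e - K h‖ := congrArg _ hh
      _ ≤ _ := norm_sub_le _ _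
  have h2 : ‖K h‖ ≤ 1 / 2 * ‖h‖ := K.le_of_opNorm_le hK h
  linarith

/-- The Neumann series with remainder. -/
theorem eq_neumann {K : X →L[ℂ] X} {e h : X} (hh : h = e - K h) (N : ℕ) :
    h = ∑ n ∈ Finset.range N, (-1 : ℂ) ^ n • (K ^ n) e + (-1 : ℂ) ^ N • (K ^ N) h := by
  induction N with
  | zero => simp
  | succ N ih =>
    rw [Finset.sum_range_succ, add_assoc]
    conv_lhs => rw [ih]
    congr 1
    have : (K ^ N) h = (K ^ N) e - (K ^ (N + 1)) h := by
      rw [pow_succ, mul_apply_eq_comp, ← map_sub, ← hh]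
    rw [this, pow_succ (-1 : ℂ)]
    simp [sub_eq_add_neg]

end Neumann

/-! ### The resolvent equation on the Fourier side -/

section ResolventEquation

theorem ae_eq_of_conj_schwartz {f g : Plane → ℂ} (hf : LocallyIntegrable f) (hg : LocallyIntegrable g)
    (h : ∀ ψ : 𝓢(Plane, ℂ), ∫ x, (starRingEnd ℂ) (ψ x) * f x = ∫ x, (starRingEnd ℂ) (ψ x) * g x) :
    f =ᵐ[volume] g := by
  refine ae_eq_of_integral_contDiff_smul_eq hf hg fun ψ hψ hc => ?_
  have hg₁ : HasCompactSupport (Complex.ofRealCLM ∘ ψ) := hc.comp_left rfl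
  have hg₂ : ContDiff ℝ ∞ (Complex.ofRealCLM ∘ ψ) := by fun_prop
  simpa [Complex.real_smul] using h (hg₁.toSchwartzMap hg₂)

theorem integrable_gradient_inner {u w : L2Plane} {g G : Fin 2 → L2Plane} (hu : HasWeakGradient u g)
    (hw : HasWeakGradient w G) (κ : ℂ) :
    Integrable fun ξ => (starRingEnd ℂ) ((𝓕 u : L2Plane) ξ) * (symb κ ξ * (𝓕 w : L2Plane) ξ) := by
  rw [hasWeakGradient_iff] at hu hw
  have hi := fun a b : L2Plane => L2.integrable_inner (𝕜 := ℂ) a b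
  refine (((hi (𝓕 (g 0)) (𝓕 (G 0))).add (hi (𝓕 (g 1)) (𝓕 (G 1)))).add
    ((hi (𝓕 u) (𝓕 w)).const_mul (κ ^ 2))).congr ?_
  filter_upwards [hu 0, hu 1, hw 0, hw 1] with ξ h1 h2 h3 h4
  simp only [Pi.add_apply, RCLike.inner_apply, h1, h2, h3, h4, symb, norm_sq_plane, map_mul,
    Complex.conj_I, Complex.conj_ofReal, map_ofNat]
  push_cast
  ring_nf
  rw [Complex.I_sq]
  ring

theorem isDiagonalTrace_schwartz (φ : 𝓢(Plane, ℂ)) :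
    ∃ Φ : L2Line, (Φ =ᵐ[volume] fun x => φ (diag x)) ∧ IsDiagonalTrace (φ.toLp 2) Φ := by
  obtain ⟨hm, -⟩ := schwartz_trace φ
  refine ⟨hm.toLp _, hm.coeFn_toLp, _, hasWeakGradient_schwartz φ, fun _ => φ, tendsto_const_nhds,
    fun _ => tendsto_const_nhds, ?_⟩
  have : eLpNorm (fun x : ℝ => φ (diag x) - hm.toLp _ x) 2 volume = 0 := by
    rw [← eLpNorm_zero (p := 2) (μ := (volume : Measure ℝ)) (ε := ℂ)]
    refine eLpNorm_congr_ae ?_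
    filter_upwards [hm.coeFn_toLp] with x hx
    simp [hx]
  simp [this]

theorem fourier_toLp_ae (φ : 𝓢(Plane, ℂ)) :
    ((𝓕 (φ.toLp 2 : L2Plane) : L2Plane) : Plane → ℂ) =ᵐ[volume] (𝓕 φ : 𝓢(Plane, ℂ)) := by
  rw [SchwartzMap.toLp_fourier_eq]
  exact (𝓕 φ).coeFn_toLp 2 volume

variable {ρ : ℝ → ℝ}

theorem memLp_potential (hρ : Continuous ρ) (hρc : HasCompactSupport ρ) (Ψ : L2Line) :
    MemLp (fun x => (ρ x : ℂ) * Ψ x) 2 := by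
  obtain ⟨C, hC⟩ := hρc.exists_bound_of_continuous hρ
  refine (Lp.memLp Ψ).of_le_mul (c := C) ?_ (Eventually.of_forall fun x => ?_)
  · exact (Complex.continuous_ofReal.comp hρ).aestronglyMeasurable.mul (Lp.aestronglyMeasurable Ψ)
  · rw [norm_mul, Complex.norm_real]
    gcongr
    exact hC x

theorem integrable_potential (hρ : Continuous ρ) (hρc : HasCompactSupport ρ) (Ψ : L2Line) :
    Integrable (fun x => (ρ x : ℂ) * Ψ x) := by
  have h1 : MemLp (fun x => (ρ x : ℂ)) 2 :=
    (Complex.continuous_ofReal.comp hρ).memLp_of_hasCompactSupport (hρc.comp_left (g := Complex.ofReal) rfl)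
  exact h1.integrable_mul (Lp.memLp Ψ)

theorem form_eq (hρ : Continuous ρ) (hρc : HasCompactSupport ρ) (h g : Fin 2 → L2Plane)
    (Φ Ψ : L2Line) : form ρ h Φ g Ψ =
      ∑ i, inner ℂ (h i) (g i) + inner ℂ Φ ((memLp_potential hρ hρc Ψ).toLp _) := by
  rw [form, L2.inner_def]
  congr 1
  refine integral_congr_ae ?_
  filter_upwards [(memLp_potential hρ hρc Ψ).coeFn_toLp] with x hx
  rw [hx, RCLike.inner_apply]
  ring

/-- Tested against Schwartz functions, the form together with the spectral term is a pairing with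
one locally integrable function, so a form identity for all test functions becomes an identity
almost everywhere. -/
theorem form_schwartz (hρ : Continuous ρ) (hρc : HasCompactSupport ρ) {κ : ℂ} {u : L2Plane}
    {g : Fin 2 → L2Plane} {Ψ : L2Line} (hu : HasWeakGradient u g) (φ : 𝓢(Plane, ℂ)) {Φ : L2Line}
    (hΦ : Φ =ᵐ[volume] fun x => φ (diag x)) :
    form ρ (fun i => (∂_{unitVec i} φ).toLp 2) Φ g Ψ + κ ^ 2 * inner ℂ (φ.toLp 2) u =
      ∫ ξ, (starRingEnd ℂ) (𝓕 φ ξ) * (symb κ ξ * (𝓕 u : L2Plane) ξ + dHat (fun x => (ρ x : ℂ) * Ψ x) ξ) ∧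
    LocallyIntegrable (fun ξ => symb κ ξ * (𝓕 u : L2Plane) ξ + dHat (fun x => (ρ x : ℂ) * Ψ x) ξ) := by
  have hF := integrable_potential hρ hρc Ψ
  constructor
  · have h1 := gradient_inner (hasWeakGradient_schwartz φ) hu κ
    have h2 : Integrable fun ξ => (starRingEnd ℂ) (𝓕 φ ξ) * (symb κ ξ * (𝓕 u : L2Plane) ξ) := by
      refine (integrable_gradient_inner (hasWeakGradient_schwartz φ) hu κ).congr ?_
      filter_upwards [fourier_toLp_ae φ] with ξ hξ
      rw [hξ]
    have h3 : Integrable fun ξ => (starRingEnd ℂ) (𝓕 φ ξ) * dHat (fun x => (ρ x : ℂ) * Ψ x) ξ :=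
      ((Complex.conjCLE.toContinuousLinearMap).integrable_comp (𝓕 φ).integrable).mul_bdd
        (c := ∫ x, ‖(ρ x : ℂ) * Ψ x‖) (continuous_dHat hF).aestronglyMeasurable
        (Eventually.of_forall (norm_dHat_le _))
    simp_rw [mul_add]
    rw [integral_add h2 h3, ← schwartz_diag_pairing φ hF, form, add_right_comm, h1]
    congr 1
    · refine integral_congr_ae ?_
      filter_upwards [fourier_toLp_ae φ] with ξ hξ
      rw [hξ]
    · refine integral_congr_ae ?_
      filter_upwards [hΦ] with x hx
      rw [hx]; ring
  · refine LocallyIntegrable.add ?_ (continuous_dHat hF).locallyIntegrable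
    have := (((Lp.memLp (𝓕 u : L2Plane)).locallyIntegrable (by norm_num)).locallyIntegrableOn
      univ).continuousOn_mul (g := symb κ) (continuous_symb κ).continuousOn isOpen_univ.isLocallyClosed
    exact locallyIntegrableOn_univ.1 this

theorem inner_schwartz (φ : 𝓢(Plane, ℂ)) (f : L2Plane) :
    inner ℂ (φ.toLp 2) f = ∫ ξ, (starRingEnd ℂ) (𝓕 φ ξ) * (𝓕 f : L2Plane) ξ := by
  rw [← Lp.inner_fourier_eq, L2.inner_def]
  refine integral_congr_ae ?_
  filter_upwards [fourier_toLp_ae φ] with ξ hξ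
  rw [hξ, RCLike.inner_apply, mul_comm]

/-- The resolvent equation on the Fourier side. -/
theorem deltaLaplacian_iff (hρ : Continuous ρ) (hρc : HasCompactSupport ρ) {κ : ℂ} (hκ : 0 < κ.re)
    (u f : L2Plane) : DeltaLaplacian ρ u (f + (-κ ^ 2) • u) ↔
      ∃ (g : Fin 2 → L2Plane) (Ψ : L2Line), HasWeakGradient u g ∧ IsDiagonalTrace u Ψ ∧
        ((𝓕 u : L2Plane) : Plane → ℂ) =ᵐ[volume]
          fun ξ => ((𝓕 f : L2Plane) ξ - dHat (fun x => (ρ x : ℂ) * Ψ x) ξ) / symb κ ξ := by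
  refine exists_congr fun g => exists_congr fun Ψ => and_congr_right fun hu => and_congr_right fun _ => ?_
  have hform : ∀ (φ : 𝓢(Plane, ℂ)) (Φ : L2Line), (Φ =ᵐ[volume] fun x => φ (diag x)) →
      (form ρ (fun i => (∂_{unitVec i} φ).toLp 2) Φ g Ψ = inner ℂ (φ.toLp 2) (f + (-κ ^ 2) • u) ↔
        ∫ ξ, (starRingEnd ℂ) (𝓕 φ ξ) * (symb κ ξ * (𝓕 u : L2Plane) ξ + dHat (fun x => (ρ x : ℂ) * Ψ x) ξ) =
          ∫ ξ, (starRingEnd ℂ) (𝓕 φ ξ) * (𝓕 f : L2Plane) ξ) := by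
    intro φ Φ hΦ
    rw [← (form_schwartz hρ hρc (κ := κ) hu φ hΦ).1, ← inner_schwartz, inner_add_right, inner_smul_right,
      neg_mul, ← sub_eq_add_neg, eq_sub_iff_add_eq]
  constructor
  · intro H
    have hae : (fun ξ => symb κ ξ * (𝓕 u : L2Plane) ξ + dHat (fun x => (ρ x : ℂ) * Ψ x) ξ)
        =ᵐ[volume] (𝓕 f : L2Plane) := by
      -- Local integrability does not depend on the test function; the zero function serves to
      -- extract it. The test functions used below are the inverse transforms of arbitrary Schwartz
      -- functions.
      obtain ⟨Φ₀, hΦ₀, -⟩ := isDiagonalTrace_schwartz 0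
      refine ae_eq_of_conj_schwartz (form_schwartz hρ hρc (κ := κ) hu 0 hΦ₀).2
        ((Lp.memLp _).locallyIntegrable (by norm_num)) fun ψ => ?_
      obtain ⟨Φ, hΦ, hΦt⟩ := isDiagonalTrace_schwartz (𝓕⁻ ψ)
      have := (hform (𝓕⁻ ψ) Φ hΦ).1 (H _ _ _ (hasWeakGradient_schwartz _) hΦt)
      rwa [FourierTransform.fourier_fourierInv_eq] at this
    filter_upwards [hae] with ξ hξ
    rw [← hξ, add_sub_cancel_right, mul_div_cancel_left₀ _ (symb_ne_zero hκ ξ)]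
  · intro hae v h Φ hv hΦ
    -- The sequence that defines the trace of `v` converges together with its gradients and its
    -- restrictions, so every term of the form passes to the limit.
    obtain ⟨h', hh', φ, hφ, hφg, hφt⟩ := hΦ
    obtain rfl := hh'.unique hv
    choose D hD hDt using isDiagonalTrace_schwartz
    have hDlim : Tendsto (fun n => D (φ n)) atTop (𝓝 Φ) := by
      refine (Lp.tendsto_Lp_iff_tendsto_eLpNorm' _ Φ).2 (hφt.congr fun n => ?_)
      refine eLpNorm_congr_ae ?_
      filter_upwards [hD (φ n)] with x hx
      simp only [Pi.sub_apply]
      rw [hx]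
    have hn : ∀ n, form ρ (fun i => (∂_{unitVec i} (φ n)).toLp 2) (D (φ n)) g Ψ =
        inner ℂ ((φ n).toLp 2) (f + (-κ ^ 2) • u) := by
      intro n
      rw [hform (φ n) (D (φ n)) (hD _)]
      refine integral_congr_ae ?_
      filter_upwards [hae] with ξ hξ
      rw [hξ, mul_div_cancel₀ _ (symb_ne_zero hκ ξ), sub_add_cancel]
    refine tendsto_nhds_unique ?_ (hφ.inner tendsto_const_nhds)
    simp_rw [← hn, form_eq hρ hρc]
    exact Tendsto.add (tendsto_finsetSum _ fun i _ => (hφg i).inner tendsto_const_nhds)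
      (hDlim.inner tendsto_const_nhds)

end ResolventEquation

end DeltaDiagonal

namespace DeltaDiagonal

open Set BoundedContinuousFunction
open scoped FourierTransform

/-! ### Construction of the resolvent -/

section ResolventConstruction

variable {κ : ℂ}

/-- Multiplication by the free resolvent symbol. -/
theorem exists_mulInvSymb (hκ : 0 < κ.re) : ∃ M : L2Plane →L[ℂ] L2Plane, ∀ v,
    (M v : Plane → ℂ) =ᵐ[volume] fun ξ => v ξ / symb κ ξ := by
  obtain ⟨C, hC⟩ := norm_inv_symb_le hκ
  have hm : MemLp (fun ξ => 1 / symb κ ξ) ⊤ (volume : Measure Plane) :=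
    memLp_top_of_bound (continuous_const.div (continuous_symb κ) (symb_ne_zero hκ)).aestronglyMeasurable C
      (Eventually.of_forall hC)
  refine ⟨(ContinuousLinearMap.mul ℂ ℂ).holderL volume ⊤ 2 2 (hm.toLp _), fun v => ?_⟩
  rw [ContinuousLinearMap.holderL_apply_apply]
  filter_upwards [ContinuousLinearMap.coeFn_holder (r := 2) (ContinuousLinearMap.mul ℂ ℂ) (hm.toLp _) v,
    hm.coeFn_toLp] with ξ h1 h2
  rw [h1, h2, ContinuousLinearMap.mul_apply', one_div_mul_eq_div]

variable {ρ : ℝ → ℝ}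

theorem continuous_rankOne (hρ : Continuous ρ) (hκ : 0 < κ.re) (h : ℝ →ᵇ L2Plane) :
    Continuous fun x => (innerSL ℂ (h x)).smulRight ((ρ x : ℂ) • gLp hκ x) := by
  have h1 : Continuous fun x => innerSL ℂ (h x) := (innerSL ℂ).continuous.comp h.continuous
  have h2 : Continuous fun x => (ρ x : ℂ) • gLp hκ x :=
    (Complex.continuous_ofReal.comp hρ).smul (continuous_gLp hκ)
  have h3 := (ContinuousLinearMap.smulRightL ℂ L2Plane L2Plane).continuous₂.comp (h1.prodMk h2)
  exact h3

/-- `∫ ρ(x) ⟨h_x, ·⟩ g_x dx` -/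
def pertOp (ρ : ℝ → ℝ) (hκ : 0 < κ.re) (h : ℝ →ᵇ L2Plane) : L2Plane →L[ℂ] L2Plane :=
  ∫ x, (innerSL ℂ (h x)).smulRight ((ρ x : ℂ) • gLp hκ x)

theorem integrable_rankOne (hρ : Continuous ρ) (hρc : HasCompactSupport ρ) (hκ : 0 < κ.re)
    (h : ℝ →ᵇ L2Plane) :
    Integrable fun x => (innerSL ℂ (h x)).smulRight ((ρ x : ℂ) • gLp hκ x) := by
  refine (continuous_rankOne hρ hκ h).integrable_of_hasCompactSupport ?_
  refine hρc.mono fun x hx => ?_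
  rw [Function.mem_support] at hx ⊢
  rintro h0
  refine hx ?_
  ext v
  simp [h0]

theorem pertOp_apply (hρ : Continuous ρ) (hρc : HasCompactSupport ρ) (hκ : 0 < κ.re)
    (h : ℝ →ᵇ L2Plane) (v : L2Plane) :
    pertOp ρ hκ h v = ∫ x, ((ρ x : ℂ) * inner ℂ (h x) v) • gLp hκ x := by
  rw [pertOp, ContinuousLinearMap.integral_apply (integrable_rankOne hρ hρc hκ h)]
  congr 1; ext1 x
  simp only [ContinuousLinearMap.smulRight_apply, innerSL_apply_apply]
  rw [smul_smul, mul_comm]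

theorem continuous_density (hρ : Continuous ρ) (h : ℝ →ᵇ L2Plane) (v : L2Plane) :
    Continuous fun x => (ρ x : ℂ) * inner ℂ (h x) v :=
  (Complex.continuous_ofReal.comp hρ).mul (h.continuous.inner continuous_const)

theorem hasCompactSupport_density (hρc : HasCompactSupport ρ) (h : ℝ →ᵇ L2Plane) (v : L2Plane) :
    HasCompactSupport fun x => (ρ x : ℂ) * inner ℂ (h x) v :=
  hρc.mono fun x hx => by
    rw [Function.mem_support] at hx ⊢
    rintro h0
    exact hx (by simp [h0])

/-- The `L²`-valued integral is identified weakly: after pairing with `z`, Fubini moves the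
`x`-integral onto the phase. -/
theorem integral_smul_gLp (hκ : 0 < κ.re) {F : ℝ → ℂ} (hF : Continuous F) (hFc : HasCompactSupport F) :
    ((∫ x, F x • gLp hκ x : L2Plane) : Plane → ℂ) =ᵐ[volume] fun ξ => dHat F ξ / symb κ ξ := by
  have hFi := hF.integrable_of_hasCompactSupport (μ := volume) hFc
  have hm := memLp_dHat_div_symb hκ hFi
  have hI : Integrable fun x => F x • gLp hκ x :=
    (hF.smul (continuous_gLp hκ)).integrable_of_hasCompactSupport hFc.smul_right
  suffices h : (∫ x, F x • gLp hκ x : L2Plane) = hm.toLp _ by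
    rw [h]; exact hm.coeFn_toLp
  refine ext_inner_left ℂ fun z => ?_
  rw [← innerSL_apply_apply ℂ z, ← (innerSL ℂ z).integral_comp_comm hI]
  simp only [innerSL_apply_apply, inner_smul_right]
  have hz : Integrable fun ξ => (starRingEnd ℂ) (z ξ) * (1 / symb κ ξ) := by
    refine MemLp.integrable_mul (p := 2) (q := 2) ?_ (memLp_inv_symb hκ)
    exact (Lp.memLp z).star
  have e1 : ∀ x, inner ℂ z (gLp hκ x) = ∫ ξ, phase x ξ * ((starRingEnd ℂ) (z ξ) * (1 / symb κ ξ)) := by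
    intro x
    rw [L2.inner_def]
    refine integral_congr_ae ?_
    filter_upwards [coeFn_gLp hκ x] with ξ hξ
    rw [hξ, RCLike.inner_apply]; ring
  simp_rw [e1]
  rw [integral_kernel_swap (p := fun z : ℝ × Plane => phase z.1 z.2)
    continuous_phase.aestronglyMeasurable (C := 1) (fun z => (norm_phase _ _).le) hFi hz, L2.inner_def]
  refine integral_congr_ae ?_
  filter_upwards [hm.coeFn_toLp] with ξ hξ
  rw [hξ, RCLike.inner_apply, dHat]; ring

theorem pertOp_ae (hρ : Continuous ρ) (hρc : HasCompactSupport ρ) (hκ : 0 < κ.re)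
    (h : ℝ →ᵇ L2Plane) (v : L2Plane) : (pertOp ρ hκ h v : Plane → ℂ) =ᵐ[volume]
      fun ξ => dHat (fun x => (ρ x : ℂ) * inner ℂ (h x) v) ξ / symb κ ξ := by
  rw [pertOp_apply hρ hρc]
  exact integral_smul_gLp hκ (continuous_density hρ h v) (hasCompactSupport_density hρc h v)

/-- The Fourier transform as a continuous linear equivalence. -/
abbrev fourierL : L2Plane ≃L[ℂ] L2Plane := (Lp.fourierTransformₗᵢ Plane ℂ).toContinuousLinearEquiv

/-- `F⁻¹ (M - S) F` with the free resolvent symbol `M` and the perturbation `S`. -/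
def resOp (ρ : ℝ → ℝ) (hκ : 0 < κ.re) (h : ℝ →ᵇ L2Plane) : L2Plane →L[ℂ] L2Plane :=
  (fourierL.symm : L2Plane →L[ℂ] L2Plane) ∘L ((exists_mulInvSymb hκ).choose - pertOp ρ hκ h) ∘L
    (fourierL : L2Plane →L[ℂ] L2Plane)

theorem fourier_resOp (hρ : Continuous ρ) (hρc : HasCompactSupport ρ) (hκ : 0 < κ.re)
    (h : ℝ →ᵇ L2Plane) (f : L2Plane) : ((𝓕 (resOp ρ hκ h f) : L2Plane) : Plane → ℂ) =ᵐ[volume]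
      fun ξ => ((𝓕 f : L2Plane) ξ - dHat (fun x => (ρ x : ℂ) * inner ℂ (h x) (𝓕 f : L2Plane)) ξ) /
        symb κ ξ := by
  have e : (𝓕 (resOp ρ hκ h f) : L2Plane) =
      (exists_mulInvSymb hκ).choose (𝓕 f) - pertOp ρ hκ h (𝓕 f) := by
    have := fourierL.apply_symm_apply ((exists_mulInvSymb hκ).choose (𝓕 f) - pertOp ρ hκ h (𝓕 f))
    exact this
  rw [e]
  filter_upwards [Lp.coeFn_sub ((exists_mulInvSymb hκ).choose (𝓕 f)) (pertOp ρ hκ h (𝓕 f)),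
    (exists_mulInvSymb hκ).choose_spec (𝓕 f), pertOp_ae hρ hρc hκ h (𝓕 f)] with ξ h1 h2 h3
  rw [h1, Pi.sub_apply, h2, h3, sub_div]

theorem memLp_coord_div_symb (hκ : 0 < κ.re) (v : L2Plane) (i : Fin 2) :
    MemLp (fun ξ : Plane => (ξ i : ℂ) * (v ξ / symb κ ξ)) 2 := by
  obtain ⟨δ, h0, h1, h2⟩ := exists_sector hκ
  have hn : 0 < ‖κ‖ := norm_pos_iff.2 (by rintro rfl; simp at hκ)
  refine (Lp.memLp v).of_le_mul (c := 1 / (δ * ‖κ‖)) ?_ (Eventually.of_forall fun ξ => ?_)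
  · refine AEStronglyMeasurable.mul (by fun_prop) ?_
    simp_rw [div_eq_mul_inv]
    exact (Lp.aestronglyMeasurable v).mul
      ((continuous_symb κ).inv₀ (symb_ne_zero hκ)).aestronglyMeasurable
  · have hs : 0 < ‖symb κ ξ‖ := norm_pos_iff.2 (symb_ne_zero hκ ξ)
    have h3 := norm_symb_ge h0.le h1 h2 ξ
    have h4 : ‖(ξ i : ℂ)‖ ≤ ‖ξ‖ := by
      rw [Complex.norm_real]; exact PiLp.norm_apply_le ξ i
    rw [norm_mul, norm_div, mul_div_assoc', div_le_iff₀ hs, mul_comm]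
    have h5 : ‖(ξ i : ℂ)‖ ≤ 1 / (δ * ‖κ‖) * ‖symb κ ξ‖ := by
      rw [one_div_mul_eq_div, le_div_iff₀ (by positivity)]
      refine le_trans ?_ h3
      have h6 : 1 ≤ Real.pi ^ 2 := by nlinarith [Real.pi_gt_three]
      have h7 : ‖ξ‖ ^ 2 ≤ Real.pi ^ 2 * ‖ξ‖ ^ 2 := le_mul_of_one_le_left (by positivity) h6
      calc ‖(ξ i : ℂ)‖ * (δ * ‖κ‖) ≤ ‖ξ‖ * (δ * ‖κ‖) := by gcongr
        _ = δ * (‖ξ‖ * ‖κ‖) := by ring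
        _ ≤ _ := by
          gcongr
          nlinarith [sq_nonneg (‖ξ‖ - ‖κ‖), norm_nonneg ξ, sq_nonneg ‖ξ‖, sq_nonneg ‖κ‖]
    calc ‖v ξ‖ * ‖(ξ i : ℂ)‖ ≤ ‖v ξ‖ * (1 / (δ * ‖κ‖) * ‖symb κ ξ‖) := by gcongr
      _ = _ := by ring

theorem integral_norm_conv_le {b D : ℝ → ℂ} (hb : Integrable b) (hD : Integrable D) :
    Integrable (fun x => ∫ w, ‖b w‖ * ‖D (x - w)‖) ∧
    ∫ x, ∫ w, ‖b w‖ * ‖D (x - w)‖ = (∫ w, ‖b w‖) * ∫ x, ‖D x‖ := by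
  constructor
  · exact hb.norm.integrable_convolution (ContinuousLinearMap.mul ℝ ℝ) hD.norm
  · exact integral_convolution (ContinuousLinearMap.mul ℝ ℝ) hb.norm hD.norm

/-- The `L¹` norm of a convolution gives `‖D‖₁ ≤ C ‖b‖₁ ‖D‖₁ ≤ ‖D‖₁ / 2`. This yields uniqueness for
the line equation. -/
theorem ae_zero_of_contraction {b D : ℝ → ℂ} (hb : Integrable b) (hD : Integrable D) {C : ℝ}
    (hρ : ∀ x, |ρ x| ≤ C) (hC : C * ∫ w, ‖b w‖ ≤ 1 / 2)
    (h : ∀ᵐ x, D x = -((ρ x : ℂ) * ∫ w, b w * D (x - w))) : D =ᵐ[volume] 0 := by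
  obtain ⟨hi, he⟩ := integral_norm_conv_le hb hD
  have hC0 : 0 ≤ C := (abs_nonneg _).trans (hρ 0)
  have h1 : ∫ x, ‖D x‖ ≤ ∫ x, C * ∫ w, ‖b w‖ * ‖D (x - w)‖ := by
    refine integral_mono_ae hD.norm (hi.const_mul C) ?_
    filter_upwards [h] with x hx
    rw [hx, norm_neg, norm_mul, Complex.norm_real]
    refine mul_le_mul (hρ x) ?_ (norm_nonneg _) hC0
    refine (norm_integral_le_integral_norm _).trans (le_of_eq ?_)
    simp_rw [norm_mul]
  rw [integral_const_mul, he, ← mul_assoc] at h1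
  have h2 : 0 ≤ ∫ x, ‖D x‖ := integral_nonneg fun _ => norm_nonneg _
  have h3 : ∫ x, ‖D x‖ = 0 := by nlinarith
  have h4 := (integral_eq_zero_iff_of_nonneg (fun x => norm_nonneg (D x)) hD.norm).1 h3
  filter_upwards [h4] with x hx
  simpa using hx

/-- The explicit resolvent. -/
theorem isResolvent_resOp (hρ : Continuous ρ) (hρc : HasCompactSupport ρ) (hκ : 0 < κ.re)
    {C : ℝ} (hC : ∀ x, |ρ x| ≤ C) (hsmall : C * ∫ w, ‖bKer κ w‖ ≤ 1 / 2) (h : ℝ →ᵇ L2Plane)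
    (hh : ∀ x, h x = gLp (re_conj_pos hκ) x -
      ∫ w, (bKer ((starRingEnd ℂ) κ) w * (ρ (x - w) : ℂ)) • h (x - w))
    (hhi : ∀ x, Integrable fun w => (bKer ((starRingEnd ℂ) κ) w * (ρ (x - w) : ℂ)) • h (x - w)) :
    IsResolvent ρ (-κ ^ 2) (resOp ρ hκ h) := by
  intro u f
  rw [deltaLaplacian_iff hρ hρc hκ]
  set F : ℝ → ℂ := fun x => (ρ x : ℂ) * inner ℂ (h x) (𝓕 f : L2Plane) with hF
  have hFc : Continuous F := continuous_density hρ h _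
  have hFs : HasCompactSupport F := hasCompactSupport_density hρc h _
  have hFi : Integrable F := hFc.integrable_of_hasCompactSupport hFs
  -- The equation for `h` is paired with `f̂`. As `h` stands in the conjugate-linear slot, the
  -- kernel for `κ̄` becomes the kernel for `κ`.
  have hΨ : ∀ x, inner ℂ (h x) (𝓕 f : L2Plane) =
      inner ℂ (gLp (re_conj_pos hκ) x) (𝓕 f : L2Plane) - ∫ w, bKer κ w * F (x - w) := by
    intro x
    conv_lhs => rw [hh x]
    rw [inner_sub_left, ← inner_conj_symm
      (∫ w : ℝ, (bKer ((starRingEnd ℂ) κ) w * (ρ (x - w) : ℂ)) • h (x - w)),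
      ← innerSL_apply_apply ℂ (𝓕 f : L2Plane),
      ← (innerSL ℂ (𝓕 f : L2Plane)).integral_comp_comm (hhi x), ← integral_conj]
    congr 2
    ext w
    rw [innerSL_apply_apply, inner_smul_right, map_mul, map_mul, inner_conj_symm, conj_bKer,
      Complex.conj_conj, Complex.conj_ofReal, mul_assoc]
  constructor
  · rintro rfl
    have hae := fourier_resOp hρ hρc hκ h f
    obtain ⟨g, hg⟩ : ∃ g, HasWeakGradient (resOp ρ hκ h f) g := by
      refine exists_hasWeakGradient fun i => ?_
      have h1 := (memLp_coord_div_symb hκ (𝓕 f : L2Plane) i).sub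
        (memLp_coord_dHat hκ hFi (hFc.memLp_of_hasCompactSupport hFs) i)
      refine (memLp_congr_ae ?_).2 h1
      filter_upwards [hae] with ξ hξ
      rw [hξ, Pi.sub_apply]; ring
    obtain ⟨Φ, hΦ⟩ := hg.exists_trace
    -- The candidate was built from the density `F` and not from its own trace; the trace formula
    -- and the equation for `h` show that `F = ρΦ`.
    refine ⟨g, Φ, hg, hΦ, ?_⟩
    have h2 := trace_eq hκ hFi hg hae hΦ
    have h3 : ∀ ξ, dHat F ξ = dHat (fun x => (ρ x : ℂ) * Φ x) ξ := by
      intro ξ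
      refine integral_congr_ae ?_
      filter_upwards [h2] with x hx
      rw [hx, hF, ← hΨ]
    simp_rw [← h3]
    exact hae
  · rintro ⟨g, Ψ, hg, hΨt, hu⟩
    have hG := integrable_potential hρ hρc Ψ
    have h2 := trace_eq hκ hG hg hu hΨt
    -- The densities of a given solution and of the constructed one satisfy the same line equation,
    -- so their difference solves the homogeneous one.
    have hD : (fun x => (ρ x : ℂ) * Ψ x - F x) =ᵐ[volume] 0 := by
      refine ae_zero_of_contraction (integrable_bKer hκ) (hG.sub hFi) hC hsmall ?_
      have hci := (integrable_bKer hκ).ae_convolution_exists (ContinuousLinearMap.mul ℂ ℂ) hG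
      have hci2 := (integrable_bKer hκ).ae_convolution_exists (ContinuousLinearMap.mul ℂ ℂ) hFi
      filter_upwards [h2, hci, hci2] with x hx h3 h4
      have h5 : ∫ w, bKer κ w * ((ρ (x - w) : ℂ) * Ψ (x - w) - F (x - w)) =
          (∫ w, bKer κ w * ((ρ (x - w) : ℂ) * Ψ (x - w))) - ∫ w, bKer κ w * F (x - w) := by
        simp_rw [mul_sub]
        exact integral_sub h3 h4
      rw [h5]
      conv_lhs => rw [hx, hF]
      simp only []
      rw [hΨ x]
      ring
    refine (Lp.fourierTransformₗᵢ Plane ℂ).injective (Lp.ext ?_)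
    have h6 := fourier_resOp hρ hρc hκ h f
    refine h6.trans (EventuallyEq.trans ?_ hu.symm)
    refine Eventually.of_forall fun ξ => ?_
    have h7 : dHat F ξ = dHat (fun x => (ρ x : ℂ) * Ψ x) ξ := by
      refine integral_congr_ae ?_
      filter_upwards [hD] with x hx
      rw [Pi.zero_apply, sub_eq_zero] at hx
      rw [hx]
    simp only []
    rw [← h7]

theorem IsResolvent.eq {z : ℂ} {R : L2Plane →L[ℂ] L2Plane} (hR : IsResolvent ρ z R) :
    resolvent ρ z = R := by
  have hex : InResolventSet ρ z := ⟨R, hR⟩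
  rw [resolvent, dif_pos hex]
  ext1 f
  exact (hex.choose_spec _ f).2 ((hR _ f).1 rfl)

theorem pertOp_zero (hκ : 0 < κ.re) (h : ℝ →ᵇ L2Plane) : pertOp (fun _ => 0) hκ h = 0 := by
  have : ∀ x : ℝ, (innerSL ℂ (h x)).smulRight (((0 : ℝ) : ℂ) • gLp hκ x) = 0 := fun x => by
    ext v; simp
  rw [pertOp]
  simp only [this, integral_zero]

/-- The Green functions as a bounded continuous function of their pole. -/
def gBCF (hκ : 0 < κ.re) : ℝ →ᵇ L2Plane :=
  BoundedContinuousFunction.ofNormedAddCommGroup (gLp hκ) (continuous_gLp hκ)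
    (√(∫ ξ : Plane, ‖1 / symb κ ξ ^ 2‖)) (fun x => by
      refine Real.le_sqrt_of_sq_le ?_
      have h1 := inner_self_eq_norm_sq_to_K (𝕜 := ℂ) (gLp hκ x)
      rw [inner_gLp_self] at h1
      have h2 : ‖((‖gLp hκ x‖ : ℝ) : ℂ) ^ 2‖ = ‖gLp hκ x‖ ^ 2 := by simp
      rw [← h2]
      erw [← h1]
      refine (norm_integral_phase_le _).trans (le_of_eq ?_)
      simp)

theorem gBCF_apply (hκ : 0 < κ.re) (x : ℝ) : gBCF hκ x = gLp hκ x := rfl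

theorem norm_gBCF_le (hκ : 0 < κ.re) {δ : ℝ} (hδ0 : 0 < δ) (hδ1 : δ ≤ 1) (h : δ * ‖κ‖ ≤ κ.re) :
    ‖gBCF hκ‖ ≤ √planeConst / (δ * ‖κ‖) := by
  refine (BoundedContinuousFunction.norm_le (by positivity)).2 fun x => ?_
  rw [gBCF_apply]
  have h1 := norm_gLp_sq_le hδ0 hδ1 h hκ x
  refine abs_le_of_sq_le_sq' ?_ (by positivity) |>.2
  rwa [div_pow, Real.sq_sqrt planeConst_nonneg, mul_pow]

end ResolventConstruction

end DeltaDiagonal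

namespace DeltaDiagonal

open Set BoundedContinuousFunction
open scoped FourierTransform

/-! ### The trace of the resolvent difference -/

section TraceFormula

variable {ρ : ℝ → ℝ} {κ : ℂ}

/-- A continuous compactly supported potential as a bounded continuous function. -/
theorem exists_potentialBCF (hρ : Continuous ρ) (hρc : HasCompactSupport ρ) :
    ∃ V : ℝ →ᵇ ℂ, ∀ x, V x = ρ x := by
  obtain ⟨C, hC⟩ := hρc.exists_bound_of_continuous hρ
  exact ⟨BoundedContinuousFunction.ofNormedAddCommGroup (fun x => (ρ x : ℂ))
    (Complex.continuous_ofReal.comp hρ) C (fun x => by rw [Complex.norm_real]; exact hC x), fun x => rfl⟩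

/-- `∫ ρ(x) ⟨E_x, g_x⟩ dx` -/
def pairing (ρ : ℝ → ℝ) (hκ : 0 < κ.re) (E : ℝ →ᵇ L2Plane) : ℂ :=
  ∫ x, (ρ x : ℂ) * inner ℂ (E x) (gLp hκ x)

theorem integrable_pairing (hρ : Continuous ρ) (hρc : HasCompactSupport ρ) (hκ : 0 < κ.re)
    (E : ℝ →ᵇ L2Plane) : Integrable fun x => (ρ x : ℂ) * inner ℂ (E x) (gLp hκ x) := by
  refine Continuous.integrable_of_hasCompactSupport ?_ ?_
  · exact (Complex.continuous_ofReal.comp hρ).mul (E.continuous.inner (continuous_gLp hκ))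
  · exact hρc.mono fun x hx => by
      rw [Function.mem_support] at hx ⊢
      rintro h0
      exact hx (by simp [h0])

theorem hasTrace_pertOp (hρ : Continuous ρ) (hρc : HasCompactSupport ρ) (hκ : 0 < κ.re)
    (h : ℝ →ᵇ L2Plane) :
    HasTrace (-((fourierL.symm : L2Plane →L[ℂ] L2Plane) ∘L pertOp ρ hκ h ∘L
      (fourierL : L2Plane →L[ℂ] L2Plane))) (-pairing ρ hκ h) := by
  have hfi : ∀ a b : L2Plane, inner ℂ (𝓕⁻ a : L2Plane) b = inner ℂ a (𝓕 b) := fun a b => by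
    rw [← Lp.inner_fourier_eq, FourierTransform.fourier_fourierInv_eq]
  have hfi' : ∀ a b : L2Plane, inner ℂ a (𝓕⁻ b : L2Plane) = inner ℂ (𝓕 a) b := fun a b => by
    rw [← Lp.inner_fourier_eq, FourierTransform.fourier_fourierInv_eq]
  have hcF : Continuous fun a : L2Plane => (𝓕⁻ a : L2Plane) :=
    (Lp.fourierTransformₗᵢ Plane ℂ).symm.continuous
  set g' : ℝ → L2Plane := fun x => -(𝓕⁻ ((ρ x : ℂ) • gLp hκ x) : L2Plane) with hg'
  -- The function `h` is only bounded. Cutting it off to the compact support of `ρ`, which `g'`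
  -- already carries, makes it square integrable without changing the product.
  set h' : ℝ → L2Plane := (tsupport ρ).indicator fun x => (𝓕⁻ (h x) : L2Plane) with hh'
  have hcg : Continuous g' :=
    (hcF.comp ((Complex.continuous_ofReal.comp hρ).smul (continuous_gLp hκ))).neg
  have h0 : (𝓕⁻ (0 : L2Plane) : L2Plane) = 0 := (Lp.fourierTransformₗᵢ Plane ℂ).symm.map_zero
  have hgm : MemLp g' 2 := by
    refine hcg.memLp_of_hasCompactSupport (hρc.mono fun x hx => ?_)
    rw [Function.mem_support] at hx ⊢
    rintro hx0
    refine hx ?_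
    simp only [hg', hx0, Complex.ofReal_zero, zero_smul, h0, neg_zero]
  have hhm : MemLp h' 2 := by
    rw [hh', memLp_indicator_iff_restrict (isClosed_tsupport ρ).measurableSet]
    have hfin : IsFiniteMeasure (volume.restrict (tsupport ρ)) :=
      ⟨by rw [Measure.restrict_apply_univ]; exact IsCompact.measure_lt_top hρc⟩
    refine MemLp.of_bound (hcF.comp h.continuous).aestronglyMeasurable ‖h‖
      (Eventually.of_forall fun x => ?_)
    have : ‖(𝓕⁻ (h x) : L2Plane)‖ = ‖h x‖ := (Lp.fourierTransformₗᵢ Plane ℂ).symm.norm_map _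
    rw [this]
    exact h.norm_coe_le_norm x
  have hpt : ∀ (x : ℝ) (v z : L2Plane), inner ℂ (h' x) v * inner ℂ z (g' x) =
      -((ρ x : ℂ) * inner ℂ (h x) (𝓕 v : L2Plane) * inner ℂ (𝓕 z : L2Plane) (gLp hκ x)) := by
    intro x v z
    simp only [hg', inner_neg_right, hfi', inner_smul_right]
    by_cases hx : x ∈ tsupport ρ
    · rw [hh', indicator_of_mem hx, hfi]; ring
    · rw [image_eq_zero_of_notMem_tsupport hx]; simp
  have key := hasTrace_of_integral_rankOne hgm hhm
    (T := -((fourierL.symm : L2Plane →L[ℂ] L2Plane) ∘L pertOp ρ hκ h ∘L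
      (fourierL : L2Plane →L[ℂ] L2Plane))) (fun z v => ?_)
  · have e : ∫ x, inner ℂ (h' x) (g' x) = -pairing ρ hκ h := by
      rw [pairing, ← integral_neg]
      congr 1; ext x
      simp only [hg', inner_neg_right, hfi']
      by_cases hx : x ∈ tsupport ρ
      · rw [hh', indicator_of_mem hx, FourierTransform.fourier_fourierInv_eq, inner_smul_right]
      · rw [image_eq_zero_of_notMem_tsupport hx]; simp
    rwa [e] at key
  · simp_rw [hpt]
    have e1 : (-((fourierL.symm : L2Plane →L[ℂ] L2Plane) ∘L pertOp ρ hκ h ∘L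
      (fourierL : L2Plane →L[ℂ] L2Plane))) v = -(𝓕⁻ (pertOp ρ hκ h (𝓕 v)) : L2Plane) := rfl
    rw [e1, inner_neg_right, hfi', pertOp_apply hρ hρc, integral_neg]
    have hI : Integrable fun x => ((ρ x : ℂ) * inner ℂ (h x) (𝓕 v : L2Plane)) • gLp hκ x :=
      ((continuous_density hρ h _).smul (continuous_gLp hκ)).integrable_of_hasCompactSupport
        (hasCompactSupport_density hρc h _).smul_right
    rw [← innerSL_apply_apply ℂ (𝓕 z : L2Plane), ← (innerSL ℂ (𝓕 z : L2Plane)).integral_comp_comm hI]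
    simp only [innerSL_apply_apply, inner_smul_right]

/-- The resolvents exist and the regularized trace is a pairing with the solution of a
Neumann series. -/
theorem trace_formula (hρ : Continuous ρ) (hρc : HasCompactSupport ρ) (hκ : 0 < κ.re) {V : ℝ →ᵇ ℂ}
    (hV : ∀ x, V x = ρ x) (hsmall : ‖V‖ * ∫ w, ‖bKer κ w‖ ≤ 1 / 2) {h : ℝ →ᵇ L2Plane}
    (hh : h = gBCF (re_conj_pos hκ) - convOp (integrable_bKer (re_conj_pos hκ)) V h) :
    InResolventSet ρ (-κ ^ 2) ∧ InResolventSet (fun _ => 0) (-κ ^ 2) ∧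
      HasTrace (regResolvent ρ (-κ ^ 2)) (trReg ρ (-κ ^ 2)) ∧
      trReg ρ (-κ ^ 2) = -pairing ρ hκ h := by
  have hC : ∀ x, |ρ x| ≤ ‖V‖ := fun x => by
    rw [← Real.norm_eq_abs, ← Complex.norm_real, ← hV]; exact V.norm_coe_le_norm x
  have hR : IsResolvent ρ (-κ ^ 2) (resOp ρ hκ h) := by
    refine isResolvent_resOp hρ hρc hκ hC hsmall h (fun x => ?_) (fun x => ?_)
    · conv_lhs => rw [hh]
      rw [BoundedContinuousFunction.sub_apply, gBCF_apply, convOp_apply]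
      simp_rw [hV]
      rfl
    · simp_rw [← hV]
      exact integrable_convOp_integrand (integrable_bKer (re_conj_pos hκ)) V h x
  have h0c : HasCompactSupport (fun _ : ℝ => (0 : ℝ)) := HasCompactSupport.zero
  -- For `ρ = 0` the same construction with `h` equal to the Green functions gives the free
  -- resolvent, so its multiplier cancels in the difference.
  have hR0 : IsResolvent (fun _ => 0) (-κ ^ 2) (resOp (fun _ => 0) hκ (gBCF (re_conj_pos hκ))) := by
    refine isResolvent_resOp continuous_const h0c hκ (C := 0) (fun x => by simp)
      (by simp) _ (fun x => ?_) (fun x => ?_)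
    · simp [gBCF_apply]
    · simp
  have hreg : regResolvent ρ (-κ ^ 2) = -((fourierL.symm : L2Plane →L[ℂ] L2Plane) ∘L
      pertOp ρ hκ h ∘L (fourierL : L2Plane →L[ℂ] L2Plane)) := by
    rw [regResolvent, hR.eq, hR0.eq, resOp, resOp, pertOp_zero]
    ext1 v
    simp [sub_eq_add_neg]
  have ht := hasTrace_pertOp hρ hρc hκ h
  rw [← hreg] at ht
  have htr : trReg ρ (-κ ^ 2) = -pairing ρ hκ h := ht.trace_eq
  exact ⟨⟨_, hR⟩, ⟨_, hR0⟩, by rwa [htr], htr⟩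

theorem norm_pairing_le (hρ : Continuous ρ) (hρc : HasCompactSupport ρ) (hκ : 0 < κ.re)
    (E : ℝ →ᵇ L2Plane) : ‖pairing ρ hκ E‖ ≤ (∫ x, |ρ x|) * (‖E‖ * ‖gBCF hκ‖) := by
  have hi : Integrable fun x => |ρ x| := (hρ.integrable_of_hasCompactSupport hρc).norm
  rw [pairing, ← integral_mul_const]
  refine norm_integral_le_of_norm_le (hi.mul_const _) (Eventually.of_forall fun x => ?_)
  rw [norm_mul, Complex.norm_real, Real.norm_eq_abs]
  gcongr
  refine (norm_inner_le_norm _ _).trans ?_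
  gcongr
  · exact E.norm_coe_le_norm x
  · exact (gBCF hκ).norm_coe_le_norm x

theorem pairing_neumann (hρ : Continuous ρ) (hρc : HasCompactSupport ρ) (hκ : 0 < κ.re)
    {K : (ℝ →ᵇ L2Plane) →L[ℂ] (ℝ →ᵇ L2Plane)} {e h : ℝ →ᵇ L2Plane} (hh : h = e - K h) (N : ℕ) :
    pairing ρ hκ h = ∑ n ∈ Finset.range N, (-1) ^ n * pairing ρ hκ ((K ^ n) e) +
      (-1) ^ N * pairing ρ hκ ((K ^ N) h) := by
  -- The pairing is conjugate-linear, which is harmless for the real scalars `(-1)^n`.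
  have hs : ∀ (n : ℕ) (E : ℝ →ᵇ L2Plane), pairing ρ hκ ((-1 : ℂ) ^ n • E) = (-1) ^ n * pairing ρ hκ E := by
    intro n E
    rw [pairing, pairing, ← integral_const_mul]
    congr 1; ext x
    rw [BoundedContinuousFunction.coe_smul, inner_smul_left]
    simp only [map_pow, map_neg, map_one]
    ring
  have ha : ∀ E G : ℝ →ᵇ L2Plane, pairing ρ hκ (E + G) = pairing ρ hκ E + pairing ρ hκ G := by
    intro E G
    rw [pairing, pairing, pairing, ← integral_add (integrable_pairing hρ hρc hκ E)
      (integrable_pairing hρ hρc hκ G)]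
    congr 1; ext x
    rw [BoundedContinuousFunction.add_apply, inner_add_left]
    ring
  have h0 : pairing ρ hκ 0 = 0 := by simp [pairing]
  let P : (ℝ →ᵇ L2Plane) →+ ℂ := ⟨⟨pairing ρ hκ, h0⟩, ha⟩
  have := congrArg P (eq_neumann hh N)
  rw [map_add, map_sum] at this
  simpa only [P, AddMonoidHom.coe_mk, ZeroHom.coe_mk, hs] using this

end TraceFormula

/-! ### Iterates of the convolution operator -/

section Iterates

variable {H : Type*} [NormedAddCommGroup H] [NormedSpace ℂ H]

/-- The partial sum `∑_{i ≤ j} w_i`. -/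
def psum {n : ℕ} (w : Fin n → ℝ) (j : Fin n) : ℝ := ∑ i, if i ≤ j then w i else 0

theorem psum_cons_zero {n : ℕ} (a : ℝ) (w : Fin n → ℝ) :
    psum (Fin.cons a w : Fin (n + 1) → ℝ) 0 = a := by
  simp [psum]

theorem psum_cons_succ {n : ℕ} (a : ℝ) (w : Fin n → ℝ) (j : Fin n) :
    psum (Fin.cons a w : Fin (n + 1) → ℝ) j.succ = a + psum w j := by
  simp [psum, Fin.sum_univ_succ]

theorem continuous_psum {n : ℕ} (j : Fin n) : Continuous fun w : Fin n → ℝ => psum w j := by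
  unfold psum
  refine continuous_finsetSum _ fun i _ => ?_
  split_ifs <;> fun_prop

theorem integrable_iterate {n : ℕ} {b : ℝ → ℂ} (hb : Integrable b) (V : ℝ →ᵇ ℂ) (E : ℝ →ᵇ H) (x : ℝ) :
    Integrable fun w : Fin n → ℝ => (∏ j, b (w j) * V (x - psum w j)) • E (x - ∑ i, w i) := by
  have h1 : Integrable fun w : Fin n → ℝ => ∏ j, b (w j) := Integrable.fintype_prod fun _ => hb
  have h2 : Continuous fun w : Fin n → ℝ => (∏ j, V (x - psum w j)) • E (x - ∑ i, w i) := by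
    refine Continuous.smul (continuous_finsetProd _ fun j _ => V.continuous.comp
      (continuous_const.sub (continuous_psum j))) (E.continuous.comp (by fun_prop))
  have h3 : Integrable fun w : Fin n → ℝ =>
      (∏ j, b (w j)) • ((∏ j, V (x - psum w j)) • E (x - ∑ i, w i)) := by
    refine (h1.norm.mul_const (‖V‖ ^ n * ‖E‖)).mono' (h1.1.smul h2.aestronglyMeasurable)
      (Eventually.of_forall fun w => ?_)
    rw [norm_smul, norm_smul]
    gcongr
    · rw [norm_prod]
      calc _ ≤ ∏ _j : Fin n, ‖V‖ := Finset.prod_le_prod (fun _ _ => norm_nonneg _)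
            fun j _ => V.norm_coe_le_norm _
        _ = _ := by simp
    · exact E.norm_coe_le_norm _
  refine h3.congr (Eventually.of_forall fun w => ?_)
  simp only []
  rw [smul_smul, ← Finset.prod_mul_distrib]

theorem integral_fin_succ {n : ℕ} {f : (Fin (n + 1) → ℝ) → H} (hf : Integrable f) :
    ∫ w, f w = ∫ a : ℝ, ∫ w : Fin n → ℝ, f (Fin.cons a w) := by
  have hmp := (volume_preserving_piFinSuccAbove (fun _ : Fin (n + 1) => ℝ) 0).symm
  have hi := (hmp.integrable_comp_emb (MeasurableEquiv.measurableEmbedding _)).2 hf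
  have hc : ∀ (a : ℝ) (w : Fin n → ℝ),
      (MeasurableEquiv.piFinSuccAbove (fun _ : Fin (n + 1) => ℝ) 0).symm (a, w) = Fin.cons a w := by
    intro a w
    rw [← Fin.insertNth_zero']
    rfl
  rw [← hmp.integral_comp (MeasurableEquiv.measurableEmbedding _), Measure.volume_eq_prod]
  refine (integral_prod _ hi).trans ?_
  simp only [Function.comp_apply, hc]

/-- Each application moves the point by a further `-w_j`, so the potential is sampled at `x` minus
the partial sums and `E` at `x` minus the full sum. -/
theorem convOp_pow_apply [CompleteSpace H] {b : ℝ → ℂ} (hb : Integrable b) (V : ℝ →ᵇ ℂ) (E : ℝ →ᵇ H) (n : ℕ) (x : ℝ) :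
    ((convOp hb V) ^ n) E x =
      ∫ w : Fin n → ℝ, (∏ j, b (w j) * V (x - psum w j)) • E (x - ∑ i, w i) := by
  induction n generalizing x with
  | zero => simp [Measure.real, volume_pi]
  | succ n ih =>
    rw [pow_succ', mul_apply_eq_comp, convOp_apply, integral_fin_succ (integrable_iterate hb V E x)]
    congr 1; ext1 a
    rw [ih, ← integral_smul]
    congr 1; ext1 w
    rw [smul_smul, Fin.prod_univ_succ, Fin.sum_univ_succ]
    simp only [Fin.cons_zero, Fin.cons_succ, psum_cons_zero, psum_cons_succ, sub_sub]

end Iterates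

end DeltaDiagonal

namespace DeltaDiagonal

open Set BoundedContinuousFunction
open scoped FourierTransform

/-! ### The terms of the Neumann series -/

section IteratedPairing

/-- The coordinates `φ⁻¹(w)_l` are the points visited by the iteration: the first is `x = (y + ∑
w_i) / 2`, and consecutive ones differ by `w_j`. This links the iterated convolutions to `ρ_{n,s}`.
-/
theorem rhoNS_one (ρ : ℝ → ℝ) (n : ℕ) (w : Fin n → ℝ) (y : ℝ) :
    rhoNS ρ n 1 (Fin.snoc w y) =
      ρ ((y + ∑ i, w i) / 2) * ∏ j, ρ ((y + ∑ i, w i) / 2 - psum w j) := by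
  have hw : (Fin.snoc (fun j : Fin n => sgn ((1 : Fin n → ℤˣ) j) *
      (Fin.snoc w y : Fin (n + 1) → ℝ) j.castSucc) ((Fin.snoc w y : Fin (n + 1) → ℝ) (Fin.last n)) :
      Fin (n + 1) → ℝ) = Fin.snoc w y := by
    congr 1
    · ext j; simp [sgn]
    · simp
  rw [rhoNS, hw, Fin.prod_univ_succ]
  congr 1
  · congr 1
    simp only [phiInv, Finset.sum_filter, Fin.sum_univ_castSucc, Fin.snoc_castSucc, Fin.snoc_last]
    simp
    ring
  · refine Finset.prod_congr rfl fun j _ => ?_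
    congr 1
    simp only [phiInv, Finset.sum_filter, Fin.sum_univ_castSucc, Fin.snoc_castSucc, Fin.snoc_last, psum]
    have h1 : ∀ m : Fin n, (j.succ ≤ m.castSucc) = ¬ (m ≤ j) := by
      intro m
      simp only [Fin.le_def, Fin.val_succ, Fin.val_castSucc, eq_iff_iff]; omega
    have h2 : ∀ m : Fin n, (m.castSucc < j.succ) = (m ≤ j) := by
      intro m
      simp only [Fin.le_def, Fin.lt_def, Fin.val_succ, Fin.val_castSucc, eq_iff_iff]; omega
    have h3 : j.succ ≤ Fin.last n := Fin.le_last _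
    have h4 : ¬ (Fin.last n < j.succ) := not_lt.2 h3
    simp only [h1, h2, h3, h4, if_true, if_false, add_zero]
    have h5 : ∑ m, (if ¬ (m ≤ j) then w m else 0) = ∑ m, w m - ∑ m, (if m ≤ j then w m else 0) := by
      rw [← Finset.sum_sub_distrib]
      refine Finset.sum_congr rfl fun m _ => ?_
      split_ifs <;> simp_all
    rw [h5]; ring

/-- The integral of `ρ_{n,1}` over the last variable. -/
def lastInt (ρ : ℝ → ℝ) (n : ℕ) (w : Fin n → ℝ) : ℝ := ∫ y, rhoNS ρ n 1 (Fin.snoc w y)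

theorem integral_shift_prod (ρ : ℝ → ℝ) (n : ℕ) (w : Fin n → ℝ) :
    ∫ x, ρ x * ∏ j, ρ (x - psum w j) = 1 / 2 * lastInt ρ n w := by
  simp only [lastInt, rhoNS_one]
  rw [integral_add_right_eq_self (fun y => ρ (y / 2) * ∏ j, ρ (y / 2 - psum w j)) (∑ i, w i),
    Measure.integral_comp_div (fun x => ρ x * ∏ j, ρ (x - psum w j)) 2]
  rw [abs_of_pos two_pos, smul_eq_mul]
  ring

variable {ρ : ℝ → ℝ} {κ : ℂ}

/-- The inner product of Green functions with poles `x - ∑ w_i` and `x` is `c_κ(∑ w_i)`, independent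
of `x`. After Fubini the `x`-integral sees only the potentials, and `dx = dy / 2` produces the
factor `1/2`. -/
theorem pairing_iterate (hρ : Continuous ρ) (hρc : HasCompactSupport ρ) (hκ : 0 < κ.re) {V : ℝ →ᵇ ℂ}
    (hV : ∀ x, V x = ρ x) (n : ℕ) :
    pairing ρ hκ (((convOp (integrable_bKer (re_conj_pos hκ)) V) ^ n) (gBCF (re_conj_pos hκ))) =
      1 / 2 * ∫ w : Fin n → ℝ, (∏ j, bKer κ (w j)) * cKer κ (∑ i, w i) * lastInt ρ n w := by
  have hb := integrable_bKer (re_conj_pos hκ)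
  have hb' := integrable_bKer hκ
  have h1 : ∀ x, inner ℂ (((convOp hb V) ^ n) (gBCF (re_conj_pos hκ)) x) (gLp hκ x) =
      ∫ w : Fin n → ℝ, (∏ j, bKer κ (w j) * ρ (x - psum w j)) * cKer κ (∑ i, w i) := by
    intro x
    have h2 : ((convOp hb V) ^ n) (gBCF (re_conj_pos hκ)) x = ∫ w : Fin n → ℝ,
        (∏ j, bKer ((starRingEnd ℂ) κ) (w j) * V (x - psum w j)) • gBCF (re_conj_pos hκ) (x - ∑ i, w i) :=
      convOp_pow_apply hb V _ n x
    rw [h2, ← inner_conj_symm, ← innerSL_apply_apply ℂ (gLp hκ x),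
      ← (innerSL ℂ (gLp hκ x)).integral_comp_comm (integrable_iterate (n := n) hb V (gBCF (re_conj_pos hκ)) x), ← integral_conj]
    congr 1; ext1 w
    rw [innerSL_apply_apply, inner_smul_right, map_mul, inner_conj_symm, gBCF_apply, inner_gLp_conj,
      map_prod]
    congr 1
    · refine Finset.prod_congr rfl fun j _ => ?_
      rw [map_mul, conj_bKer, Complex.conj_conj, hV, Complex.conj_ofReal]
    · congr 1; ring
  obtain ⟨δ, h0, hδ1, hδ⟩ := exists_sector hκ
  have hρi : Integrable fun x => (ρ x : ℂ) := (hρ.integrable_of_hasCompactSupport hρc).ofReal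
  have hbp : Integrable fun w : Fin n → ℝ => ∏ j, bKer κ (w j) := Integrable.fintype_prod fun _ => hb'
  have hI : Integrable (Function.uncurry fun (x : ℝ) (w : Fin n → ℝ) =>
      (ρ x : ℂ) * ((∏ j, bKer κ (w j) * ρ (x - psum w j)) * cKer κ (∑ i, w i)))
      ((volume : Measure ℝ).prod (volume : Measure (Fin n → ℝ))) := by
    have hcont : Continuous fun z : ℝ × (Fin n → ℝ) =>
        (∏ j, (ρ (z.1 - psum z.2 j) : ℂ)) * cKer κ (∑ i, z.2 i) := by
      refine (continuous_finsetProd _ fun j _ => ?_).mul ((continuous_cKer hκ).comp (by fun_prop))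
      exact Complex.continuous_ofReal.comp (hρ.comp (continuous_fst.sub
        ((continuous_psum j).comp continuous_snd)))
    have := (hρi.mul_prod hbp).mul_bdd (c := ‖V‖ ^ n * (planeConst / (δ ^ 2 * ‖κ‖ ^ 2)))
      hcont.aestronglyMeasurable (Eventually.of_forall fun z => by
        rw [norm_mul]
        gcongr
        · rw [norm_prod]
          calc _ ≤ ∏ _j : Fin n, ‖V‖ := Finset.prod_le_prod (fun _ _ => norm_nonneg _)
                fun j _ => by rw [← hV]; exact V.norm_coe_le_norm _
            _ = _ := by simp
        · exact norm_cKer_le h0 hδ1 hδ hκ _)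
    refine this.congr (Eventually.of_forall fun z => ?_)
    simp only [Function.uncurry, Finset.prod_mul_distrib]
    ring
  rw [pairing]
  simp_rw [h1, ← integral_const_mul]
  rw [integral_integral_swap hI]
  congr 1; ext1 w
  have h2 : ∀ x, (ρ x : ℂ) * ((∏ j, bKer κ (w j) * ρ (x - psum w j)) * cKer κ (∑ i, w i)) =
      (∏ j, bKer κ (w j)) * cKer κ (∑ i, w i) * ((ρ x * ∏ j, ρ (x - psum w j) : ℝ) : ℂ) := by
    intro x
    push_cast [Finset.prod_mul_distrib]
    ring
  simp_rw [h2]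
  rw [integral_const_mul, integral_complex_ofReal, integral_shift_prod]
  push_cast; ring

end IteratedPairing

end DeltaDiagonal

namespace DeltaDiagonal

open Set
open scoped Nat

/-! ### Taylor expansion in several variables -/

section Taylor

/-- Taylor's formula for a chain of antiderivatives. -/
theorem taylor_chain {f : ℕ → ℝ → ℝ} (hf : ∀ l t, HasDerivAt (f l) (f (l + 1) t) t) (L : ℕ) {C : ℝ}
    (hC : ∀ t ∈ Icc (0 : ℝ) 1, |f L t| ≤ C) : ∀ t ∈ Icc (0 : ℝ) 1,
      |f 0 t - ∑ l ∈ Finset.range L, f l 0 * t ^ l / l !| ≤ C := by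
  induction L generalizing f with
  | zero => simpa using hC
  | succ L ih =>
    have h1 := ih (f := fun l => f (l + 1)) (fun l t => hf (l + 1) t) hC
    have h2 : ∀ t, HasDerivAt (fun t => f 0 t - ∑ l ∈ Finset.range (L + 1), f l 0 * t ^ l / l !)
        (f 1 t - ∑ l ∈ Finset.range L, f (l + 1) 0 * t ^ l / l !) t := by
      intro t
      simp_rw [Finset.sum_range_succ']
      have h3 : HasDerivAt (fun t => ∑ l ∈ Finset.range L, f (l + 1) 0 * t ^ (l + 1) / (l + 1)!)
          (∑ l ∈ Finset.range L, f (l + 1) 0 * t ^ l / l !) t := by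
        refine HasDerivAt.fun_sum fun l _ => ?_
        have := ((hasDerivAt_pow (l + 1) t).const_mul (f (l + 1) 0)).div_const ((l + 1)! : ℝ)
        convert! this using 1
        rw [Nat.factorial_succ]
        have : (l ! : ℝ) ≠ 0 := by positivity
        have : ((l : ℝ) + 1) ≠ 0 := by positivity
        push_cast
        field_simp
      have h4 := (hf 0 t).fun_sub (h3.add_const (f 0 0 * 1 / (0 ! : ℝ)))
      simpa using h4
    intro t ht
    have h5 := (convex_Icc (0 : ℝ) 1).norm_image_sub_le_of_norm_hasDerivWithin_le
      (f := fun t => f 0 t - ∑ l ∈ Finset.range (L + 1), f l 0 * t ^ l / l !)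
      (fun x _ => (h2 x).hasDerivWithinAt) (C := C) (fun x hx => h1 x hx)
      (left_mem_Icc.2 zero_le_one) ht
    have h0 : f 0 0 - ∑ l ∈ Finset.range (L + 1), f l 0 * (0 : ℝ) ^ l / l ! = 0 := by
      rw [Finset.sum_range_succ']; simp
    have hC0 : 0 ≤ C := (abs_nonneg _).trans (hC 0 (left_mem_Icc.2 zero_le_one))
    simp only [h0, sub_zero, Real.norm_eq_abs] at h5
    refine h5.trans ?_
    rw [abs_of_nonneg ht.1]
    exact mul_le_of_le_one_right hC0 ht.2

variable {N : ℕ}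

/-- Smooth functions that vanish outside of `K`. -/
def smoothSub (K : Set (Fin N → ℝ)) : Submodule ℝ ((Fin N → ℝ) → ℝ) where
  carrier := {F | ContDiff ℝ ∞ F ∧ ∀ p ∉ K, F p = 0}
  add_mem' := fun {F G} hF hG => ⟨hF.1.add hG.1, fun p hp => by simp [hF.2 p hp, hG.2 p hp]⟩
  zero_mem' := ⟨contDiff_const, fun p _ => rfl⟩
  smul_mem' := fun c F hF => ⟨contDiff_const.smul hF.1, fun p hp => by simp [hF.2 p hp]⟩

theorem differentiable_of_mem {K : Set (Fin N → ℝ)} (F : smoothSub K) : Differentiable ℝ F.1 :=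
  F.2.1.differentiable (by simp)

/-- The directional derivative as an endomorphism of `smoothSub K`. -/
def dirD {K : Set (Fin N → ℝ)} (hK : IsClosed K) (v : Fin N → ℝ) : Module.End ℝ (smoothSub K) where
  toFun := fun F => ⟨fun p => fderiv ℝ F.1 p v, by
    refine ⟨(F.2.1.fderiv_right (m := ∞) (by simp)).clm_apply contDiff_const, fun p hp => ?_⟩
    have : F.1 =ᶠ[𝓝 p] fun _ => 0 := by
      filter_upwards [hK.isOpen_compl.mem_nhds hp] with q hq using F.2.2 q hq
    change fderiv ℝ F.1 p v = 0
    rw [this.fderiv_eq]; simp⟩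
  map_add' := fun F G => by
    ext p
    change fderiv ℝ (F.1 + G.1) p v = fderiv ℝ F.1 p v + fderiv ℝ G.1 p v
    rw [fderiv_add (differentiable_of_mem F p) (differentiable_of_mem G p)]
    rfl
  map_smul' := fun c F => by
    ext p
    change fderiv ℝ (c • F.1) p v = c • fderiv ℝ F.1 p v
    rw [fderiv_const_smul (differentiable_of_mem F p)]
    rfl

theorem dirD_apply {K : Set (Fin N → ℝ)} (hK : IsClosed K) (v : Fin N → ℝ) (F : smoothSub K)
    (p : Fin N → ℝ) : (dirD hK v F).1 p = fderiv ℝ F.1 p v := rfl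

theorem commute_dirD {K : Set (Fin N → ℝ)} (hK : IsClosed K) (u v : Fin N → ℝ) :
    Commute (dirD hK u) (dirD hK v) := by
  refine LinearMap.ext fun F => Subtype.ext (funext fun p => ?_)
  have hd : DifferentiableAt ℝ (fderiv ℝ F.1) p :=
    (F.2.1.fderiv_right (m := ∞) (by simp)).differentiable (by simp) p
  have h2 : ∀ a b : Fin N → ℝ, (dirD hK a (dirD hK b F)).1 p = fderiv ℝ (fderiv ℝ F.1) p a b := by
    intro a b
    rw [dirD_apply]
    have : (dirD hK b F).1 = fun q => fderiv ℝ F.1 q b := rfl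
    rw [this, fderiv_clm_apply hd (differentiableAt_const b)]
    simp
  have hs : IsSymmSndFDerivAt ℝ F.1 p := F.2.1.contDiffAt.isSymmSndFDerivAt
    (by rw [minSmoothness_of_isRCLikeNormedField]; exact WithTop.coe_le_coe.2 (le_top : (2 : ℕ∞) ≤ ⊤))
  change (dirD hK u (dirD hK v F)).1 p = (dirD hK v (dirD hK u F)).1 p
  rw [h2, h2]
  exact hs u v

theorem partialDeriv_eq {F : (Fin N → ℝ) → ℝ} (hF : Differentiable ℝ F) (i : Fin N) :
    partialDeriv i F = fun p => fderiv ℝ F p (Pi.single i 1) := by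
  ext p
  have h1 := hasDerivAt_update p i (p i)
  have h2 : HasFDerivAt F (fderiv ℝ F p) (Function.update p i (p i)) := by
    rw [Function.update_eq_self]; exact (hF p).hasFDerivAt
  exact (h2.comp_hasDerivAt (p i) h1).deriv

theorem partialDeriv_coe {K : Set (Fin N → ℝ)} (hK : IsClosed K) (F : smoothSub K) (i : Fin N) :
    partialDeriv i F.1 = (dirD hK (Pi.single i 1) F).1 :=
  partialDeriv_eq (differentiable_of_mem F) i

theorem partialDeriv_iterate_coe {K : Set (Fin N → ℝ)} (hK : IsClosed K) (F : smoothSub K) (i : Fin N)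
    (k : ℕ) : (partialDeriv i)^[k] F.1 = (((dirD hK (Pi.single i 1)) ^ k) F).1 := by
  induction k with
  | zero => rfl
  | succ k ih =>
    rw [Function.iterate_succ_apply', ih, partialDeriv_coe hK, pow_succ']
    rfl

variable {n : ℕ}

/-- The ordered iteration of partial derivatives becomes a product of commuting endomorphisms, to
which the multinomial theorem applies. -/
theorem multiDeriv_coe {K : Set (Fin (n + 1) → ℝ)} (hK : IsClosed K) (F : smoothSub K) (a : Fin n → ℕ) :
    multiDeriv a F.1 =
      (((List.finRange n).map fun j => (dirD hK (Pi.single j.castSucc 1)) ^ a j).prod F).1 := by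
  rw [multiDeriv]
  generalize List.finRange n = l
  induction l with
  | nil => rfl
  | cons j l ih =>
    rw [List.foldr_cons, ih, partialDeriv_iterate_coe hK, List.map_cons, List.prod_cons]
    rfl

theorem list_prod_smul {M : Type*} [AddCommGroup M] [Module ℝ M] (l : List (Fin n)) (c : Fin n → ℝ)
    (D : Fin n → Module.End ℝ M) :
    (l.map fun j => c j • D j).prod = (l.map c).prod • (l.map D).prod := by
  induction l with
  | nil => simp
  | cons j l ih => simp only [List.map_cons, List.prod_cons, ih, smul_mul_smul_comm]

/-- The multinomial theorem for directional derivatives. -/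
theorem dirD_pow {K : Set (Fin (n + 1) → ℝ)} (hK : IsClosed K) (w : Fin n → ℝ) (l : ℕ) (F : smoothSub K)
    (p : Fin (n + 1) → ℝ) :
    (((dirD hK (Fin.snoc w 0)) ^ l) F).1 p =
      ∑ a ∈ Finset.piAntidiag (Finset.univ : Finset (Fin n)) l,
        (Nat.multinomial Finset.univ a : ℝ) * (∏ j, w j ^ a j) * multiDeriv a F.1 p := by
  have h1 : dirD hK (Fin.snoc w 0) = ∑ j, w j • dirD hK (Pi.single j.castSucc 1) := by
    refine LinearMap.ext fun G => Subtype.ext (funext fun q => ?_)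
    have hv : (Fin.snoc w 0 : Fin (n + 1) → ℝ) = ∑ j : Fin n, w j • Pi.single j.castSucc 1 := by
      ext i
      simp only [Finset.sum_apply, Pi.smul_apply, smul_eq_mul]
      refine Fin.lastCases ?_ (fun i => ?_) i
      · simp [Pi.single_apply, Fin.ext_iff]
        exact (Finset.sum_eq_zero fun x _ => if_neg x.2.ne').symm
      · simp [Pi.single_apply]
    rw [dirD_apply, hv, map_sum, LinearMap.sum_apply]
    have : ((∑ j : Fin n, (w j • dirD hK (Pi.single j.castSucc 1)) G : smoothSub K) :
        (Fin (n + 1) → ℝ) → ℝ) = ∑ j : Fin n, ((w j • dirD hK (Pi.single j.castSucc 1)) G).1 := by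
      rw [Submodule.coe_sum]
    rw [this, Finset.sum_apply]
    refine Finset.sum_congr rfl fun j _ => ?_
    rw [map_smul]
    rfl
  have hc : ((Finset.univ : Finset (Fin n)) : Set (Fin n)).Pairwise
      (Function.onFun Commute fun j => w j • dirD hK (Pi.single j.castSucc 1)) := fun i _ j _ _ =>
    ((commute_dirD hK _ _).smul_left _).smul_right _
  rw [h1, Finset.sum_pow_eq_sum_piAntidiag_of_commute _ _ hc, LinearMap.sum_apply, Submodule.coe_sum,
    Finset.sum_apply]
  refine Finset.sum_congr rfl fun a _ => ?_
  have h2 : (Finset.univ : Finset (Fin n)).noncommProd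
      (fun j => (w j • dirD hK (Pi.single j.castSucc 1)) ^ a j) (hc.mono' fun _ _ h => h.pow_pow ..) =
      (∏ j, w j ^ a j) • ((List.finRange n).map fun j => (dirD hK (Pi.single j.castSucc 1)) ^ a j).prod := by
    have h3 : (Finset.univ : Finset (Fin n)).noncommProd
      (fun j => (w j • dirD hK (Pi.single j.castSucc 1)) ^ a j) (hc.mono' fun _ _ h => h.pow_pow ..) =
        ((List.finRange n).map fun j => (w j • dirD hK (Pi.single j.castSucc 1)) ^ a j).prod :=
      Multiset.noncommProd_coe _ _
    rw [h3]
    simp_rw [smul_pow]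
    rw [list_prod_smul, ← List.prod_ofFn, List.ofFn_eq_map]
  rw [h2, multiDeriv_coe hK, ← nsmul_eq_mul, ← Nat.cast_smul_eq_nsmul ℝ, smul_smul]
  rfl

theorem exists_bound_of_mem_smoothSub {K : Set (Fin N → ℝ)} (hK : IsCompact K) (F : smoothSub K) :
    ∃ C, 0 ≤ C ∧ ∀ p, |F.1 p| ≤ C := by
  obtain ⟨C, hC⟩ := hK.exists_bound_of_continuousOn F.2.1.continuous.continuousOn
  refine ⟨max C 0, le_max_right _ _, fun p => ?_⟩
  by_cases hp : p ∈ K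
  · exact (hC p hp).trans (le_max_left _ _)
  · rw [F.2.2 p hp]; simp

theorem multiDeriv_mem {K : Set (Fin (n + 1) → ℝ)} (hK : IsClosed K) (F : smoothSub K) (a : Fin n → ℕ) :
    multiDeriv a F.1 ∈ smoothSub K := by
  rw [multiDeriv_coe hK]; exact Subtype.property _

theorem continuous_snoc_right (w : Fin n → ℝ) : Continuous fun y : ℝ => (Fin.snoc w y : Fin (n + 1) → ℝ) := by
  refine continuous_pi fun i => ?_
  refine Fin.lastCases ?_ (fun i => ?_) i
  · simp only [Fin.snoc_last]; exact continuous_id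
  · simp only [Fin.snoc_castSucc]; exact continuous_const

/-- Multivariate Taylor expansion in the first variables. -/
theorem multi_taylor {G : (Fin (n + 1) → ℝ) → ℝ} (hG : ContDiff ℝ ∞ G) (hGc : HasCompactSupport G)
    (L : ℕ) : ∃ C Y : ℝ, 0 ≤ C ∧ ∀ (w : Fin n → ℝ) (y : ℝ),
      |G (Fin.snoc w y) - ∑ l ∈ Finset.range L, ∑ a ∈ Finset.piAntidiag (Finset.univ : Finset (Fin n)) l,
        (∏ j, w j ^ a j / (a j)!) * multiDeriv a G (Fin.snoc (fun _ => 0) y)| ≤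
      (Icc (-Y) Y).indicator (fun _ => C * (∑ j, |w j|) ^ L) y := by
  have hK : IsCompact (tsupport G) := hGc
  have hKc := hK.isClosed
  let F : smoothSub (tsupport G) := ⟨G, hG, fun p hp => image_eq_zero_of_notMem_tsupport hp⟩
  obtain ⟨Y, hY⟩ := hK.isBounded.exists_norm_le
  -- All functions involved vanish for `|y| > Y`, whatever `w` is; this provides the indicator that
  -- makes the error integrable in `y`.
  have hout : ∀ (H : smoothSub (tsupport G)) (w : Fin n → ℝ) (y : ℝ), y ∉ Icc (-Y) Y →
      H.1 (Fin.snoc w y) = 0 := by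
    intro H w y hy
    refine H.2.2 _ fun hmem => hy ?_
    have h1 := (norm_le_pi_norm (Fin.snoc w y : Fin (n + 1) → ℝ) (Fin.last n)).trans (hY _ hmem)
    rw [Fin.snoc_last, Real.norm_eq_abs] at h1
    exact abs_le.1 h1
  choose Ca hCa0 hCa using fun a : Fin n → ℕ =>
    exists_bound_of_mem_smoothSub hK ⟨_, multiDeriv_mem hKc F a⟩
  set A := Finset.piAntidiag (Finset.univ : Finset (Fin n)) L
  refine ⟨∑ a ∈ A, Ca a, Y, Finset.sum_nonneg fun a _ => hCa0 a, fun w y => ?_⟩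
  by_cases hy : y ∈ Icc (-Y) Y
  swap
  · rw [indicator_of_notMem hy, show G (Fin.snoc w y) = 0 from hout F w y hy]
    refine le_of_eq ?_
    rw [abs_eq_zero, zero_sub, neg_eq_zero]
    refine Finset.sum_eq_zero fun l _ => Finset.sum_eq_zero fun a _ => ?_
    rw [show multiDeriv a G (Fin.snoc (fun _ => 0) y) = 0 from
      hout ⟨_, multiDeriv_mem hKc F a⟩ _ y hy, mul_zero]
  rw [indicator_of_mem hy]
  -- The expansion is the one-dimensional one along the segment from `(0, y)` to `(w, y)`, where
  -- each `t`-derivative is one more application of the derivative in direction `(w, 0)`.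
  let f : ℕ → ℝ → ℝ := fun l t => (((dirD hKc (Fin.snoc w 0)) ^ l) F).1 (Fin.snoc (t • w) y)
  have hγ : ∀ t : ℝ, HasDerivAt (fun t : ℝ => (Fin.snoc (t • w) y : Fin (n + 1) → ℝ)) (Fin.snoc w 0) t := by
    intro t
    refine hasDerivAt_pi.2 fun i => ?_
    refine Fin.lastCases ?_ (fun i => ?_) i
    · simp only [Fin.snoc_last]; exact hasDerivAt_const t y
    · simp only [Fin.snoc_castSucc, Pi.smul_apply, smul_eq_mul]
      simpa using (hasDerivAt_id t).mul_const (w i)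
  have hf : ∀ l t, HasDerivAt (f l) (f (l + 1) t) t := by
    intro l t
    have h1 := (differentiable_of_mem (((dirD hKc (Fin.snoc w 0)) ^ l) F)
      (Fin.snoc (t • w) y)).hasFDerivAt.comp_hasDerivAt t (hγ t)
    have h2 : f (l + 1) t = fderiv ℝ (((dirD hKc (Fin.snoc w 0)) ^ l) F).1 (Fin.snoc (t • w) y)
        (Fin.snoc w 0) := by
      simp only [f]
      rw [pow_succ']
      rfl
    rw [h2]
    exact h1
  have hbd : ∀ t ∈ Icc (0 : ℝ) 1, |f L t| ≤ (∑ a ∈ A, Ca a) * (∑ j, |w j|) ^ L := by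
    intro t _
    simp only [f]
    rw [dirD_pow, Finset.sum_pow_eq_sum_piAntidiag, Finset.mul_sum]
    refine (Finset.abs_sum_le_sum_abs _ _).trans (Finset.sum_le_sum fun a ha => ?_)
    rw [abs_mul, abs_mul, Finset.abs_prod, Nat.abs_cast, mul_comm]
    simp_rw [abs_pow]
    refine mul_le_mul_of_nonneg_right ?_ (by positivity)
    exact (hCa a _).trans (Finset.single_le_sum (fun b _ => hCa0 b) ha)
  have key := taylor_chain hf L hbd 1 (right_mem_Icc.2 zero_le_one)
  refine le_trans (le_of_eq ?_) key
  congr 1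
  have e0 : f 0 1 = G (Fin.snoc w y) := by simp [f, F]
  rw [e0]
  congr 1
  refine Finset.sum_congr rfl fun l _ => ?_
  simp only [f, zero_smul, one_pow, mul_one]
  rw [dirD_pow, Finset.sum_div]
  refine Finset.sum_congr rfl fun a ha => ?_
  have hspec := Nat.multinomial_spec Finset.univ a
  rw [(Finset.mem_piAntidiag.1 ha).1] at hspec
  have hne : (∏ j, ((a j)! : ℝ)) ≠ 0 := Finset.prod_ne_zero_iff.2 fun j _ => by positivity
  have hs : (Nat.multinomial Finset.univ a : ℝ) = (l ! : ℝ) / ∏ j, ((a j)! : ℝ) := by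
    rw [eq_div_iff hne, mul_comm, ← hspec]; push_cast; rfl
  have hl : (l ! : ℝ) ≠ 0 := by positivity
  rw [hs, Finset.prod_div_distrib]
  have hz : (0 : Fin n → ℝ) = fun _ => 0 := rfl
  rw [hz]
  change _ = _ * multiDeriv a G _ / _
  field_simp

end Taylor

end DeltaDiagonal

namespace DeltaDiagonal

open Set
open scoped Nat

/-! ### Expansion of the density of the `n`-th term -/

section DensityExpansion

theorem contDiff_phiInv (n : ℕ) (s : Fin n → ℤˣ) (l : Fin (n + 1)) :
    ContDiff ℝ ∞ fun w : Fin (n + 1) → ℝ =>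
      phiInv n (Fin.snoc (fun j : Fin n => sgn (s j) * w j.castSucc) (w (Fin.last n))) l := by
  have h : ∀ m : Fin (n + 1), ContDiff ℝ ∞ fun w : Fin (n + 1) → ℝ =>
      (Fin.snoc (fun j : Fin n => sgn (s j) * w j.castSucc) (w (Fin.last n)) : Fin (n + 1) → ℝ) m := by
    intro m
    refine Fin.lastCases ?_ (fun m => ?_) m
    · simp only [Fin.snoc_last]; fun_prop
    · simp only [Fin.snoc_castSucc]; fun_prop
  unfold phiInv
  exact ((ContDiff.sum fun m _ => h m).sub (ContDiff.sum fun m _ => h m)).div_const 2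

variable {ρ : ℝ → ℝ}

theorem contDiff_rhoNS (hρ : ContDiff ℝ ∞ ρ) (n : ℕ) (s : Fin n → ℤˣ) : ContDiff ℝ ∞ (rhoNS ρ n s) := by
  unfold rhoNS
  exact contDiff_prod fun l _ => hρ.comp (contDiff_phiInv n s l)

theorem psum_eq {n : ℕ} (w : Fin n → ℝ) (j : Fin n) :
    psum w j = (∑ i, if i < j then w i else 0) + w j := by
  have : ∀ i, (if i ≤ j then w i else 0) = (if i < j then w i else 0) + if i = j then w i else 0 := by
    intro i
    rcases lt_trichotomy i j with h | h | h
    · simp [h, h.le, h.ne]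
    · simp [h]
    · simp [h.not_ge, h.not_gt, h.ne']
  simp only [psum]
  simp_rw [this]
  rw [Finset.sum_add_distrib]
  simp

/-- Each `w_j` is the difference of two consecutive partial sums, the sum before the first one being
`0`. -/
theorem abs_le_of_psum_le {n : ℕ} {w : Fin n → ℝ} {R : ℝ} (hR : 0 ≤ R) (h : ∀ j, |psum w j| ≤ R)
    (j : Fin n) : |w j| ≤ 2 * R := by
  have h1 : |∑ i, if i < j then w i else 0| ≤ R := by
    obtain ⟨k, hk⟩ := j
    cases k with
    | zero =>
      have : ∀ i : Fin n, ¬ i < ⟨0, hk⟩ := fun i => by simp [Fin.lt_def]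
      simpa [this] using hR
    | succ k =>
      have : ∀ i : Fin n, (i < ⟨k + 1, hk⟩) = (i ≤ ⟨k, by omega⟩) := fun i => by
        simp only [Fin.lt_def, Fin.le_def, eq_iff_iff]; omega
      simp_rw [this]
      exact h ⟨k, by omega⟩
  have h2 := psum_eq w j
  have h3 := h j
  rw [abs_le] at *
  constructor <;> linarith

/-- If no factor vanishes, all points `x - psum w j` and `x` itself lie in the support of `ρ`.
Differences bound the partial sums, these bound `w`, and then `y` is bounded through `x = (y + ∑
w_i) / 2`. -/
theorem hasCompactSupport_rhoNS (hρc : HasCompactSupport ρ) (n : ℕ) :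
    HasCompactSupport (rhoNS ρ n 1) := by
  obtain ⟨R, hR⟩ := hρc.isCompact.isBounded.exists_norm_le
  have hR' : ∀ x, ρ x ≠ 0 → |x| ≤ max R 0 := fun x hx =>
    (hR x (subset_tsupport ρ hx)).trans (le_max_left _ _)
  set r := max R 0 with hr
  have hr0 : 0 ≤ r := le_max_right _ _
  refine HasCompactSupport.intro (isCompact_closedBall (0 : Fin (n + 1) → ℝ) (4 * r + 4 * n * r))
    fun w hw => ?_
  by_contra hne
  refine hw ?_
  rw [← Fin.snoc_init_self w, rhoNS_one] at hne
  set v := Fin.init w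
  set y := w (Fin.last n)
  have h1 := hR' _ (left_ne_zero_of_mul hne)
  have h2 : ∀ j, |psum v j| ≤ 2 * r := by
    intro j
    have h3 := hR' _ (Finset.prod_ne_zero_iff.1 (right_ne_zero_of_mul hne) j (Finset.mem_univ _))
    rw [abs_le] at *
    constructor <;> linarith
  have h4 := abs_le_of_psum_le (by positivity) h2
  have h5 : |∑ i, v i| ≤ n * (4 * r) := by
    refine (Finset.abs_sum_le_sum_abs _ _).trans ?_
    calc _ ≤ ∑ _i : Fin n, 4 * r := Finset.sum_le_sum fun i _ => by linarith [h4 i]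
      _ = _ := by simp
  rw [mem_closedBall_zero_iff, pi_norm_le_iff_of_nonneg (by positivity)]
  have hnr : 0 ≤ n * r := by positivity
  refine Fin.lastCases ?_ fun i => ?_
  · rw [Real.norm_eq_abs]
    change |y| ≤ _
    rw [abs_le] at *
    constructor <;> linarith
  · rw [Real.norm_eq_abs]
    have := h4 i
    change |v i| ≤ _
    linarith

theorem hasCompactSupport_comp_snoc {n : ℕ} {G : (Fin (n + 1) → ℝ) → ℝ} {K : Set (Fin (n + 1) → ℝ)}
    (hK : IsCompact K) (hG : ∀ p ∉ K, G p = 0) (w : Fin n → ℝ) :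
    HasCompactSupport fun y => G (Fin.snoc w y) := by
  have himg : IsCompact ((fun p : Fin (n + 1) → ℝ => p (Fin.last n)) '' K) :=
    hK.image (continuous_apply _)
  refine HasCompactSupport.intro himg fun y hy => hG _ fun hmem => hy ⟨_, hmem, ?_⟩
  simp

/-- The integral of a mixed derivative of `ρ_{n,1}` over the last variable. -/
def derivInt (ρ : ℝ → ℝ) (n : ℕ) (a : Fin n → ℕ) : ℝ :=
  ∫ y, multiDeriv a (rhoNS ρ n 1) (Fin.snoc (fun _ => 0) y)

theorem lastInt_taylor (hρ : ContDiff ℝ ∞ ρ) (hρc : HasCompactSupport ρ) (n L : ℕ) :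
    ∃ C, 0 ≤ C ∧ ∀ w : Fin n → ℝ, |lastInt ρ n w -
      ∑ l ∈ Finset.range L, ∑ a ∈ Finset.piAntidiag (Finset.univ : Finset (Fin n)) l,
        (∏ j, w j ^ a j / (a j)!) * derivInt ρ n a| ≤ C * (∑ j, |w j|) ^ L := by
  have hG := contDiff_rhoNS hρ n 1
  have hGc := hasCompactSupport_rhoNS hρc n
  obtain ⟨C, Y, hC, h⟩ := multi_taylor hG hGc L
  have hK : IsCompact (tsupport (rhoNS ρ n 1)) := hGc
  let F : smoothSub (tsupport (rhoNS ρ n 1)) := ⟨_, hG, fun p hp => image_eq_zero_of_notMem_tsupport hp⟩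
  have hint : ∀ (H : smoothSub (tsupport (rhoNS ρ n 1))) (w : Fin n → ℝ),
      Integrable fun y => H.1 (Fin.snoc w y) := fun H w =>
    (H.2.1.continuous.comp (continuous_snoc_right w)).integrable_of_hasCompactSupport
      (hasCompactSupport_comp_snoc hK H.2.2 w)
  have hi2 : ∀ (w : Fin n → ℝ) (a : Fin n → ℕ), Integrable fun y =>
      (∏ j, w j ^ a j / (a j)!) * multiDeriv a (rhoNS ρ n 1) (Fin.snoc (fun _ => 0) y) := fun w a =>
    (hint ⟨_, multiDeriv_mem hK.isClosed F a⟩ _).const_mul _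
  refine ⟨C * (volume (Icc (-Y) Y)).toReal, by positivity, fun w => ?_⟩
  have e : lastInt ρ n w - ∑ l ∈ Finset.range L, ∑ a ∈ Finset.piAntidiag (Finset.univ : Finset (Fin n)) l,
        (∏ j, w j ^ a j / (a j)!) * derivInt ρ n a =
      ∫ y, (rhoNS ρ n 1 (Fin.snoc w y) - ∑ l ∈ Finset.range L,
        ∑ a ∈ Finset.piAntidiag (Finset.univ : Finset (Fin n)) l,
        (∏ j, w j ^ a j / (a j)!) * multiDeriv a (rhoNS ρ n 1) (Fin.snoc (fun _ => 0) y)) := by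
    rw [integral_sub (hint F w) (integrable_finsetSum _ fun l _ => integrable_finsetSum _ fun a _ => hi2 w a),
      integral_finsetSum _ (fun l _ => integrable_finsetSum _ fun a _ => hi2 w a), lastInt]
    congr 1
    refine Finset.sum_congr rfl fun l _ => ?_
    rw [integral_finsetSum _ (fun a _ => hi2 w a)]
    refine Finset.sum_congr rfl fun a _ => ?_
    rw [integral_const_mul, derivInt]
  rw [e, ← Real.norm_eq_abs]
  have hind : Integrable ((Icc (-Y) Y).indicator fun _ : ℝ => C * (∑ j, |w j|) ^ L) :=
    (integrable_indicator_iff measurableSet_Icc).2 (integrableOn_const (by simp))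
  refine (norm_integral_le_of_norm_le hind (Eventually.of_forall fun y => ?_)).trans (le_of_eq ?_)
  · rw [Real.norm_eq_abs]; exact h w y
  rw [integral_indicator measurableSet_Icc, setIntegral_const, smul_eq_mul, Measure.real]
  ring

theorem rhoNS_eq_comp (ρ : ℝ → ℝ) (n : ℕ) (s : Fin n → ℤˣ) :
    rhoNS ρ n s = fun w => rhoNS ρ n 1
      (Fin.snoc (fun j : Fin n => sgn (s j) * w j.castSucc) (w (Fin.last n))) := by
  ext w
  simp only [rhoNS, Fin.snoc_castSucc, Fin.snoc_last, Pi.one_apply]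
  simp [sgn]

theorem partialDeriv_comp_scale {n : ℕ} (σ : Fin n → ℝ) (c : ℝ) (G : (Fin (n + 1) → ℝ) → ℝ) (j : Fin n) :
    partialDeriv j.castSucc (fun w => c * G (Fin.snoc (fun j : Fin n => σ j * w j.castSucc) (w (Fin.last n)))) =
      fun w => (σ j * c) * partialDeriv j.castSucc G
        (Fin.snoc (fun j : Fin n => σ j * w j.castSucc) (w (Fin.last n))) := by
  ext w
  have h1 : ∀ t : ℝ, (Fin.snoc (fun i : Fin n => σ i * (Function.update w j.castSucc t) i.castSucc)
      ((Function.update w j.castSucc t) (Fin.last n)) : Fin (n + 1) → ℝ) =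
      Function.update (Fin.snoc (fun i : Fin n => σ i * w i.castSucc) (w (Fin.last n))) j.castSucc (σ j * t) := by
    intro t
    ext i
    refine Fin.lastCases ?_ (fun i => ?_) i
    · rw [Fin.snoc_last, Function.update_of_ne (Fin.castSucc_lt_last j).ne',
        Function.update_of_ne (Fin.castSucc_lt_last j).ne', Fin.snoc_last]
    · rw [Fin.snoc_castSucc]
      by_cases h : i = j
      · subst h; simp
      · have h' : i.castSucc ≠ j.castSucc := fun hh => h (Fin.castSucc_injective _ hh)
        rw [Function.update_of_ne h', Function.update_of_ne h', Fin.snoc_castSucc]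
  simp only [partialDeriv, h1]
  rw [deriv_const_mul_field, deriv_comp_mul_left (σ j) (fun t => G (Function.update _ j.castSucc t)),
    Fin.snoc_castSucc, smul_eq_mul]
  ring

theorem multiDeriv_comp_scale {n : ℕ} (σ : Fin n → ℝ) (G : (Fin (n + 1) → ℝ) → ℝ) (a : Fin n → ℕ) :
    multiDeriv a (fun w => G (Fin.snoc (fun j : Fin n => σ j * w j.castSucc) (w (Fin.last n)))) =
      fun w => (∏ j, σ j ^ a j) * multiDeriv a G
        (Fin.snoc (fun j : Fin n => σ j * w j.castSucc) (w (Fin.last n))) := by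
  have hpow : ∀ (j : Fin n) (k : ℕ) (c : ℝ) (G : (Fin (n + 1) → ℝ) → ℝ), (partialDeriv j.castSucc)^[k]
      (fun w => c * G (Fin.snoc (fun j : Fin n => σ j * w j.castSucc) (w (Fin.last n)))) =
      fun w => (σ j ^ k * c) * ((partialDeriv j.castSucc)^[k] G)
        (Fin.snoc (fun j : Fin n => σ j * w j.castSucc) (w (Fin.last n))) := by
    intro j k
    induction k with
    | zero => intro c G; simp
    | succ k ih =>
      intro c G
      rw [Function.iterate_succ_apply', ih, partialDeriv_comp_scale]
      ext w
      rw [Function.iterate_succ_apply']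
      ring
  have hgen : ∀ l : List (Fin n), l.foldr (fun j F => (partialDeriv j.castSucc)^[a j] F)
      (fun w => G (Fin.snoc (fun j : Fin n => σ j * w j.castSucc) (w (Fin.last n)))) =
      fun w => (l.map fun j => σ j ^ a j).prod * (l.foldr (fun j F => (partialDeriv j.castSucc)^[a j] F) G)
        (Fin.snoc (fun j : Fin n => σ j * w j.castSucc) (w (Fin.last n))) := by
    intro l
    induction l with
    | nil => simp
    | cons j l ih =>
      rw [List.foldr_cons, ih, hpow, List.map_cons, List.prod_cons, List.foldr_cons]
  rw [multiDeriv, hgen, ← List.ofFn_eq_map, List.prod_ofFn]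
  rfl

/-- By the chain rule the signs enter a mixed derivative at `w = 0` only through the factors
`s(j)^{a_j}`, so one density serves for all `s`. -/
theorem integral_multiDeriv_rhoNS (ρ : ℝ → ℝ) (n : ℕ) (s : Fin n → ℤˣ) (a : Fin n → ℕ) :
    ∫ y : ℝ, multiDeriv a (rhoNS ρ n s) (Fin.snoc (fun _ : Fin n => (0 : ℝ)) y) =
      (∏ j, sgn (s j) ^ a j) * derivInt ρ n a := by
  rw [rhoNS_eq_comp, multiDeriv_comp_scale, derivInt, ← integral_const_mul]
  congr 1; ext y
  simp only [Fin.snoc_castSucc, Fin.snoc_last, mul_zero]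

/-- It replaces the power of `∑ |k w_j|` in the Taylor error by a product weight, so that the error
integral factorises over the `w_j`. -/
theorem one_add_sum_le_prod {ι : Type*} (s : Finset ι) {f : ι → ℝ} (hf : ∀ i, 0 ≤ f i) :
    1 + ∑ i ∈ s, f i ≤ ∏ i ∈ s, (1 + f i) := by
  classical
  induction s using Finset.induction_on with
  | empty => simp
  | insert i s hi ih =>
    rw [Finset.sum_insert hi, Finset.prod_insert hi]
    have : 0 ≤ ∑ i ∈ s, f i := Finset.sum_nonneg fun i _ => hf i
    nlinarith [hf i, mul_nonneg (hf i) this]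

end DensityExpansion

/-! ### Moments of the kernels -/

section MomentExpansion

/-- The moments of the kernel of the `n`-th term. -/
def moment (κ : ℂ) {n : ℕ} (a : Fin n → ℕ) : ℂ :=
  ∫ w : Fin n → ℝ, (∏ j, bKer κ (w j) * (w j : ℂ) ^ a j) * cKer κ (∑ i, w i)

theorem integrable_bKer_pow {κ : ℂ} (hκ : 0 < κ.re) (a : ℕ) :
    Integrable fun w : ℝ => bKer κ w * (w : ℂ) ^ a := by
  simpa using integrable_bKer_mul hκ 0 a

theorem integrable_moment {κ : ℂ} (hκ : 0 < κ.re) {n : ℕ} (a : Fin n → ℕ) :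
    Integrable fun w : Fin n → ℝ => (∏ j, bKer κ (w j) * (w j : ℂ) ^ a j) * cKer κ (∑ i, w i) := by
  obtain ⟨δ, h0, h1, h2⟩ := exists_sector hκ
  have h3 : Integrable fun w : Fin n → ℝ => ∏ j, bKer κ (w j) * (w j : ℂ) ^ a j :=
    Integrable.fintype_prod (f := fun j (w : ℝ) => bKer κ w * (w : ℂ) ^ a j) fun j => integrable_bKer_pow hκ (a j)
  exact h3.mul_bdd (c := planeConst / (δ ^ 2 * ‖κ‖ ^ 2))
    ((continuous_cKer hκ).comp (by fun_prop)).aestronglyMeasurable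
    (Eventually.of_forall fun w => norm_cKer_le h0 h1 h2 hκ _)

theorem integrable_weight {k : ℝ} (hk : 0 < k) (L : ℕ) :
    Integrable fun w : ℝ => bReal k w * (1 + |k * w|) ^ L := by
  have h1 : Integrable fun u : ℝ => bReal 1 u * (1 + |u|) ^ L := by
    refine (((integrable_bReal one_pos).add (integrable_pow_bReal one_pos L)).const_mul (2 ^ (L - 1))).mono' ?_
      (Eventually.of_forall fun u => ?_)
    · exact (stronglyMeasurable_bReal 1).aestronglyMeasurable.mul (by fun_prop)
    · rw [Real.norm_of_nonneg (mul_nonneg (bReal_nonneg _ _) (by positivity))]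
      have := add_pow_le zero_le_one (abs_nonneg u) L
      rw [one_pow] at this
      calc _ ≤ bReal 1 u * (2 ^ (L - 1) * (1 + |u| ^ L)) :=
            mul_le_mul_of_nonneg_left this (bReal_nonneg _ _)
        _ = _ := by simp only [Pi.add_apply]; ring
  refine (h1.comp_mul_left' hk.ne').congr (Eventually.of_forall fun w => ?_)
  simp only []
  rw [bReal_scale hk w]

theorem integral_weight {k : ℝ} (hk : 0 < k) (L : ℕ) :
    ∫ w : ℝ, bReal k w * (1 + |k * w|) ^ L = k⁻¹ * ∫ u : ℝ, bReal 1 u * (1 + |u|) ^ L := by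
  simp_rw [bReal_scale hk]
  rw [Measure.integral_comp_mul_left (fun u => bReal 1 u * (1 + |u|) ^ L), abs_of_pos (by positivity),
    smul_eq_mul]

theorem continuous_lastInt {ρ : ℝ → ℝ} (hρ : ContDiff ℝ ∞ ρ) (hρc : HasCompactSupport ρ) (n : ℕ) :
    Continuous (lastInt ρ n) := by
  have hK : IsCompact (tsupport (rhoNS ρ n 1)) := hasCompactSupport_rhoNS hρc n
  obtain ⟨Y, hY⟩ := hK.isBounded.exists_norm_le
  have hG : Continuous (rhoNS ρ n 1) := (contDiff_rhoNS hρ n 1).continuous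
  obtain ⟨C, hC⟩ := (hasCompactSupport_rhoNS hρc n).exists_bound_of_continuous hG
  have hcs : Continuous fun z : (Fin n → ℝ) × ℝ => (Fin.snoc z.1 z.2 : Fin (n + 1) → ℝ) := by
    refine continuous_pi fun i => ?_
    refine Fin.lastCases ?_ (fun i => ?_) i
    · simp only [Fin.snoc_last]; exact continuous_snd
    · simp only [Fin.snoc_castSucc]; fun_prop
  generalize hGdef : rhoNS ρ n 1 = G at *
  have hcc : Continuous fun z : (Fin n → ℝ) × ℝ => G (Fin.snoc z.1 z.2) := hG.comp hcs
  have e : lastInt ρ n = fun w => ∫ y, G (Fin.snoc w y) := by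
    ext w; rw [lastInt, hGdef]
  rw [e]
  refine continuous_of_dominated (bound := (Icc (-Y) Y).indicator fun _ => C) (fun w => ?_) (fun w => ?_) ?_ ?_
  · exact (hcc.comp (continuous_const.prodMk continuous_id)).aestronglyMeasurable
  · refine Eventually.of_forall fun y => ?_
    by_cases hy : y ∈ Icc (-Y) Y
    · rw [indicator_of_mem hy]; exact hC _
    · have h0 : G (Fin.snoc w y) = 0 := by
        refine image_eq_zero_of_notMem_tsupport fun hmem => hy ?_
        have h1 := (norm_le_pi_norm (Fin.snoc w y : Fin (n + 1) → ℝ) (Fin.last n)).trans (hY _ hmem)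
        rw [Fin.snoc_last, Real.norm_eq_abs] at h1
        exact abs_le.1 h1
      rw [indicator_of_notMem hy, h0, norm_zero]
  · exact (integrable_indicator_iff measurableSet_Icc).2 (integrableOn_const (by simp))
  · exact Eventually.of_forall fun y => hcc.comp (continuous_id.prodMk continuous_const)

theorem integrable_kernel_lastInt {ρ : ℝ → ℝ} (hρ : ContDiff ℝ ∞ ρ) (hρc : HasCompactSupport ρ) {κ : ℂ}
    (hκ : 0 < κ.re) (n : ℕ) :
    Integrable fun w : Fin n → ℝ => (∏ j, bKer κ (w j)) * cKer κ (∑ i, w i) * lastInt ρ n w := by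
  have hc := continuous_lastInt hρ hρc n
  obtain ⟨C, hC0, hC⟩ := lastInt_taylor hρ hρc n 0
  have := (integrable_moment hκ (fun _ : Fin n => 0)).mul_bdd (c := C) (g := fun w => (lastInt ρ n w : ℂ))
    (Complex.continuous_ofReal.comp hc).aestronglyMeasurable (Eventually.of_forall fun w => by
      rw [Complex.norm_real]; simpa using hC w)
  simpa using this

/-- The expansion of the `n`-th term of the Neumann series in moments. -/
theorem iterate_expansion {ρ : ℝ → ℝ} (hρ : ContDiff ℝ ∞ ρ) (hρc : HasCompactSupport ρ) {δ : ℝ}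
    (hδ0 : 0 < δ) (hδ1 : δ ≤ 1) (n L : ℕ) : ∃ C, ∀ κ : ℂ, 0 < κ.re → δ * ‖κ‖ ≤ κ.re →
      ‖(∫ w : Fin n → ℝ, (∏ j, bKer κ (w j)) * cKer κ (∑ i, w i) * lastInt ρ n w) -
        ∑ l ∈ Finset.range L, ∑ a ∈ Finset.piAntidiag (Finset.univ : Finset (Fin n)) l,
          (derivInt ρ n a : ℂ) / (∏ j, ((a j)! : ℂ)) * moment κ a‖ ≤ C * (‖κ‖⁻¹) ^ (2 + n + L) := by
  obtain ⟨C, hC0, hC⟩ := lastInt_taylor hρ hρc n L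
  set J := ∫ u : ℝ, bReal 1 u * (1 + |u|) ^ L with hJ
  have hJ0 : 0 ≤ J := integral_nonneg fun u => mul_nonneg (bReal_nonneg _ _) (by positivity)
  refine ⟨C * (planeConst / δ ^ 2) * (J ^ n * (δ⁻¹) ^ (n + L)), fun κ hκ hδ => ?_⟩
  have hn : 0 < ‖κ‖ := norm_pos_iff.2 (by rintro rfl; simp at hκ)
  set k := κ.re with hk
  let m : (Fin n → ℝ) → (Fin n → ℕ) → ℂ := fun w a =>
    (derivInt ρ n a : ℂ) / (∏ j, ((a j)! : ℂ)) * ((∏ j, bKer κ (w j) * (w j : ℂ) ^ a j) * cKer κ (∑ i, w i))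
  have hmi : ∀ a, Integrable fun w => m w a := fun a => (integrable_moment hκ a).const_mul _
  have e1 : ∑ l ∈ Finset.range L, ∑ a ∈ Finset.piAntidiag (Finset.univ : Finset (Fin n)) l,
      (derivInt ρ n a : ℂ) / (∏ j, ((a j)! : ℂ)) * moment κ a =
      ∫ w, ∑ l ∈ Finset.range L, ∑ a ∈ Finset.piAntidiag (Finset.univ : Finset (Fin n)) l, m w a := by
    rw [integral_finsetSum _ fun l _ => integrable_finsetSum _ fun a _ => hmi a]
    refine Finset.sum_congr rfl fun l _ => ?_
    rw [integral_finsetSum _ fun a _ => hmi a]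
    refine Finset.sum_congr rfl fun a _ => ?_
    rw [integral_const_mul, moment]
  rw [e1, ← integral_sub (integrable_kernel_lastInt hρ hρc hκ n)
    (integrable_finsetSum _ fun l _ => integrable_finsetSum _ fun a _ => hmi a)]
  have hw : Integrable fun w : Fin n → ℝ => ∏ j, bReal k (w j) * (1 + |k * w j|) ^ L :=
    Integrable.fintype_prod fun _ => integrable_weight hκ L
  -- The factor `k^{-L}` comes from rescaling the Taylor error, `|κ|^{-2}` from `c_κ`; integrating
  -- the product weight adds `k^{-n}`. In the sector `k⁻¹ ≤ (δ|κ|)⁻¹`, which gives the total power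
  -- `2 + n + L`.
  have hb : ∀ w : Fin n → ℝ, ‖(∏ j, bKer κ (w j)) * cKer κ (∑ i, w i) * lastInt ρ n w -
      ∑ l ∈ Finset.range L, ∑ a ∈ Finset.piAntidiag (Finset.univ : Finset (Fin n)) l, m w a‖ ≤
      (planeConst / (δ ^ 2 * ‖κ‖ ^ 2) * (C * (k⁻¹) ^ L)) * ∏ j, bReal k (w j) * (1 + |k * w j|) ^ L := by
    intro w
    have e2 : (∏ j, bKer κ (w j)) * cKer κ (∑ i, w i) * lastInt ρ n w -
        ∑ l ∈ Finset.range L, ∑ a ∈ Finset.piAntidiag (Finset.univ : Finset (Fin n)) l, m w a =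
        (∏ j, bKer κ (w j)) * cKer κ (∑ i, w i) * ((lastInt ρ n w -
          ∑ l ∈ Finset.range L, ∑ a ∈ Finset.piAntidiag (Finset.univ : Finset (Fin n)) l,
          (∏ j, w j ^ a j / (a j)!) * derivInt ρ n a : ℝ) : ℂ) := by
      push_cast
      rw [mul_sub, Finset.mul_sum]
      congr 1
      refine Finset.sum_congr rfl fun l _ => ?_
      rw [Finset.mul_sum]
      refine Finset.sum_congr rfl fun a _ => ?_
      simp only [m, Finset.prod_mul_distrib, Finset.prod_div_distrib]
      ring
    rw [e2, norm_mul, norm_mul, Complex.norm_real, norm_prod, Real.norm_eq_abs]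
    have h1 : ∏ j, ‖bKer κ (w j)‖ ≤ ∏ j, bReal k (w j) :=
      Finset.prod_le_prod (fun _ _ => norm_nonneg _) fun j _ => norm_bKer_le κ (w j)
    have h2 := norm_cKer_le hδ0 hδ1 hδ hκ (∑ i, w i)
    have h3 : (∑ j, |w j|) ^ L ≤ (k⁻¹) ^ L * ∏ j, (1 + |k * w j|) ^ L := by
      rw [Finset.prod_pow, ← mul_pow]
      refine pow_le_pow_left₀ (Finset.sum_nonneg fun _ _ => abs_nonneg _) ?_ L
      rw [le_inv_mul_iff₀ hκ, Finset.mul_sum]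
      have := one_add_sum_le_prod Finset.univ (f := fun j => |k * w j|) fun _ => abs_nonneg _
      refine le_trans ?_ (le_trans (le_add_of_nonneg_left zero_le_one) this)
      refine le_of_eq (Finset.sum_congr rfl fun j _ => ?_)
      rw [abs_mul, abs_of_pos hκ]
    have hP : 0 ≤ ∏ j, bReal k (w j) := Finset.prod_nonneg fun _ _ => bReal_nonneg _ _
    calc _ ≤ (∏ j, bReal k (w j)) * (planeConst / (δ ^ 2 * ‖κ‖ ^ 2)) *
          (C * ((k⁻¹) ^ L * ∏ j, (1 + |k * w j|) ^ L)) := by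
          have := planeConst_nonneg
          refine mul_le_mul (mul_le_mul h1 h2 (norm_nonneg _) hP)
            ((hC w).trans (mul_le_mul_of_nonneg_left h3 hC0)) (abs_nonneg _) (by positivity)
      _ = _ := by rw [Finset.prod_mul_distrib]; ring
  refine (norm_integral_le_of_norm_le (hw.const_mul _) (Eventually.of_forall hb)).trans ?_
  rw [integral_const_mul, integral_fintype_prod_volume_eq_pow (fun w : ℝ => bReal k w * (1 + |k * w|) ^ L),
    integral_weight hκ, Fintype.card_fin, mul_pow, ← hJ]
  have hkinv : k⁻¹ ≤ δ⁻¹ * ‖κ‖⁻¹ := by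
    rw [← mul_inv]; exact inv_anti₀ (by positivity) hδ
  have := planeConst_nonneg
  calc planeConst / (δ ^ 2 * ‖κ‖ ^ 2) * (C * k⁻¹ ^ L) * (k⁻¹ ^ n * J ^ n)
      = planeConst / (δ ^ 2 * ‖κ‖ ^ 2) * C * J ^ n * k⁻¹ ^ (n + L) := by ring
    _ ≤ planeConst / (δ ^ 2 * ‖κ‖ ^ 2) * C * J ^ n * (δ⁻¹ * ‖κ‖⁻¹) ^ (n + L) := by
        gcongr
    _ = _ := by
        have hx : planeConst / (δ ^ 2 * ‖κ‖ ^ 2) = planeConst / δ ^ 2 * ‖κ‖⁻¹ ^ 2 := by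
          rw [inv_pow, div_mul_eq_div_div, div_eq_mul_inv _ (‖κ‖ ^ 2)]
        rw [hx, mul_pow]
        ring

end MomentExpansion

end DeltaDiagonal

namespace DeltaDiagonal

open Set

/-! ### Holomorphic dependence on the spectral parameter -/

/-- The open right half-plane. -/
def halfPlane : Set ℂ := {κ | 0 < κ.re}

theorem isOpen_halfPlane : IsOpen halfPlane := isOpen_lt continuous_const Complex.continuous_re

theorem isPreconnected_halfPlane : IsPreconnected halfPlane :=
  (convex_halfSpace_re_gt 0).isPreconnected

/-- Cauchy's estimate on small discs bounds the derivative by the majorant of `f` divided by the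
radius, so dominating `f` itself is enough. -/
theorem differentiableOn_integral {X : Type*} [MeasurableSpace X] {μ : Measure X} {f : ℂ → X → ℂ}
    (hm : ∀ κ ∈ halfPlane, AEStronglyMeasurable (f κ) μ)
    (hd : ∀ x, DifferentiableOn ℂ (fun κ => f κ x) halfPlane)
    (hb : ∀ k > 0, ∀ R, ∃ g : X → ℝ, Integrable g μ ∧
      ∀ κ : ℂ, k ≤ κ.re → ‖κ‖ ≤ R → ∀ x, ‖f κ x‖ ≤ g x) :
    DifferentiableOn ℂ (fun κ => ∫ x, f κ x ∂μ) halfPlane := by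
  intro κ₀ hκ₀
  have hκ : 0 < κ₀.re := hκ₀
  -- The closed disc of radius `2r` around `κ₀` stays in `Re z ≥ 2r`, and it contains the closed
  -- disc of radius `r` around every point of the smaller disc.
  set r := κ₀.re / 4 with hr
  have hr0 : 0 < r := by positivity
  obtain ⟨g, hg, hfg⟩ := hb (2 * r) (by positivity) (‖κ₀‖ + 2 * r)
  have hre : ∀ z ∈ Metric.closedBall κ₀ (2 * r), 2 * r ≤ z.re ∧ ‖z‖ ≤ ‖κ₀‖ + 2 * r := by
    intro z hz
    rw [mem_closedBall_iff_norm] at hz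
    have h1 : |(z - κ₀).re| ≤ 2 * r := (Complex.abs_re_le_norm _).trans hz
    rw [Complex.sub_re] at h1
    refine ⟨by linarith [(abs_le.1 h1).1], ?_⟩
    calc ‖z‖ = ‖κ₀ + (z - κ₀)‖ := by congr 1; ring
      _ ≤ _ := (norm_add_le _ _).trans (by gcongr)
  have hsub : Metric.closedBall κ₀ (2 * r) ⊆ halfPlane := fun z hz =>
    show 0 < z.re by linarith [(hre z hz).1]
  have hat : ∀ x, ∀ z ∈ Metric.ball κ₀ r, HasDerivAt (fun κ => f κ x) (deriv (fun κ => f κ x) z) z := by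
    intro x z hz
    have hz' : z ∈ halfPlane := hsub (Metric.ball_subset_closedBall
      (Metric.ball_subset_ball (by linarith) hz))
    exact ((hd x).differentiableAt (isOpen_halfPlane.mem_nhds hz')).hasDerivAt
  have hbd : ∀ x, ∀ z ∈ Metric.ball κ₀ r, ‖deriv (fun κ => f κ x) z‖ ≤ g x / r := by
    intro x z hz
    have hzs : Metric.closedBall z r ⊆ Metric.closedBall κ₀ (2 * r) :=
      Metric.closedBall_subset_closedBall' (by rw [Metric.mem_ball] at hz; linarith)
    refine Complex.norm_deriv_le_of_forall_mem_sphere_norm_le hr0 ?_ ?_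
    · refine DifferentiableOn.diffContOnCl ?_
      rw [closure_ball z hr0.ne']
      exact (hd x).mono (hzs.trans hsub)
    · intro w hw
      have := hre w (hzs (Metric.sphere_subset_closedBall hw))
      exact hfg w this.1 this.2 x
  have hself : κ₀ ∈ Metric.ball κ₀ r := Metric.mem_ball_self hr0
  -- The derivative is a pointwise limit of difference quotients with positive increments `1/(n+1)`,
  -- which do not leave the half-plane.
  have hmeas : AEStronglyMeasurable (fun x => deriv (fun κ => f κ x) κ₀) μ := by
    have hlim : Tendsto (fun n : ℕ => (((n : ℝ) + 1)⁻¹ : ℝ)) atTop (𝓝[≠] 0) := by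
      refine tendsto_nhdsWithin_iff.2 ⟨tendsto_inv_atTop_zero.comp
        (tendsto_atTop_add_const_right _ _ tendsto_natCast_atTop_atTop), Eventually.of_forall fun n => ?_⟩
      simp only [mem_compl_iff, mem_singleton_iff]; positivity
    have hlim2 : Tendsto (fun n : ℕ => ((((n : ℝ) + 1)⁻¹ : ℝ) : ℂ)) atTop (𝓝[≠] 0) := by
      refine tendsto_nhdsWithin_iff.2 ⟨?_, Eventually.of_forall fun n => ?_⟩
      · have := (Complex.continuous_ofReal.tendsto 0).comp (tendsto_nhdsWithin_iff.1 hlim).1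
        rw [Complex.ofReal_zero] at this
        exact this
      · simp only [mem_compl_iff, mem_singleton_iff, Complex.ofReal_eq_zero]; positivity
    refine aestronglyMeasurable_of_tendsto_ae atTop (f := fun (n : ℕ) x =>
      ((((n : ℝ) + 1)⁻¹ : ℝ) : ℂ)⁻¹ • (f (κ₀ + ((((n : ℝ) + 1)⁻¹ : ℝ) : ℂ)) x - f κ₀ x)) (fun n => ?_)
      (Eventually.of_forall fun x => ?_)
    · simp only [smul_eq_mul]
      refine AEStronglyMeasurable.const_mul ((hm _ ?_).sub (hm κ₀ hκ₀)) _
      show 0 < (κ₀ + ((((n : ℝ) + 1)⁻¹ : ℝ) : ℂ)).re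
      rw [Complex.add_re, Complex.ofReal_re]; positivity
    · exact (hasDerivAt_iff_tendsto_slope_zero.1 (hat x κ₀ hself)).comp hlim2
  have hF : Integrable (f κ₀) μ := hg.mono' (hm κ₀ hκ₀) (Eventually.of_forall fun x => by
    have := hre κ₀ (Metric.mem_closedBall_self (by positivity))
    exact hfg κ₀ this.1 this.2 x)
  have h := hasDerivAt_integral_of_dominated_loc_of_deriv_le (μ := μ) (F := f)
    (F' := fun κ x => deriv (fun κ => f κ x) κ) (bound := fun x => g x / r)
    (Metric.ball_mem_nhds κ₀ hr0)
    (by filter_upwards [isOpen_halfPlane.mem_nhds hκ₀] with z hz using hm z hz) hF hmeas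
    (Eventually.of_forall fun x z hz => hbd x z hz) (hg.div_const r)
    (Eventually.of_forall fun x z hz => hat x z hz)
  exact h.2.differentiableAt.differentiableWithinAt

theorem integrableOn_exp_cosh {c : ℝ} (hc : 0 < c) :
    IntegrableOn (fun t : ℝ => Real.exp (-(c * Real.cosh t))) (Ioi 0) := by
  refine ((integrableOn_pow_mul_exp hc 0 (by norm_num)).mono' ?_ ?_)
  · exact (Continuous.aestronglyMeasurable (by fun_prop))
  · refine (ae_restrict_iff' measurableSet_Ioi).2 (Eventually.of_forall fun t ht => ?_)
    have ht0 : (0 : ℝ) < t := ht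
    rw [Real.norm_of_nonneg (Real.exp_pos _).le, Real.rpow_zero, one_mul]
    refine Real.exp_le_exp.2 (neg_le_neg (mul_le_mul_of_nonneg_left ?_ hc.le))
    exact (Real.self_le_sinh_iff.2 ht0.le).trans (Real.sinh_lt_cosh t).le

theorem differentiableOn_bKer (y : ℝ) : DifferentiableOn ℂ (fun κ => bKer κ y) halfPlane := by
  unfold bKer
  rcases eq_or_ne y 0 with rfl | hy
  · simp only [abs_zero, Complex.ofReal_zero, mul_zero]
    exact differentiableOn_const _
  refine DifferentiableOn.const_mul (differentiableOn_integral (fun κ _ => ?_) (fun t => ?_) fun k hk R => ?_) _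
  · exact Continuous.aestronglyMeasurable (by fun_prop)
  · fun_prop
  · have hy' : 0 < |y| := abs_pos.2 hy
    refine ⟨_, integrableOn_exp_cosh (c := √2 * k * |y|) (by positivity), fun κ hκ _ t => ?_⟩
    rw [norm_cexp_kernel]
    refine Real.exp_le_exp.2 (neg_le_neg ?_)
    have := Real.cosh_pos t
    calc √2 * k * |y| * Real.cosh t = √2 * k * Real.cosh t * |y| := by ring
      _ ≤ _ := by gcongr

theorem bReal_anti {k l : ℝ} (hk : 0 < k) (hkl : k ≤ l) (y : ℝ) : bReal l y ≤ bReal k y := by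
  rcases eq_or_ne y 0 with rfl | hy
  · simp [bReal]
  have hy' : 0 < |y| := abs_pos.2 hy
  have hi : ∀ k : ℝ, 0 < k → IntegrableOn (fun t : ℝ => Real.exp (-(√2 * k * Real.cosh t * |y|))) (Ioi 0) := by
    intro k hk
    refine (integrableOn_exp_cosh (c := √2 * k * |y|) (by positivity)).congr_fun (fun t _ => ?_) measurableSet_Ioi
    simp only []
    congr 2; ring
  unfold bReal
  refine mul_le_mul_of_nonneg_left (setIntegral_mono (hi l (hk.trans_le hkl)) (hi k hk) fun t => ?_) (by positivity)
  have := Real.cosh_pos t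
  exact Real.exp_le_exp.2 (neg_le_neg (by gcongr))

/-- A bounded part of `Re κ ≥ k` lies in a sector, so the sectorial estimates become locally uniform
in the half-plane. -/
theorem sector_of_bounds {k R : ℝ} (hk : 0 < k) : ∃ δ : ℝ, 0 < δ ∧ δ ≤ 1 ∧
    ∀ κ : ℂ, k ≤ κ.re → ‖κ‖ ≤ R → δ * ‖κ‖ ≤ κ.re := by
  refine ⟨min (k / (|R| + k)) 1, by positivity, min_le_right _ _, fun κ h1 h2 => ?_⟩
  calc min (k / (|R| + k)) 1 * ‖κ‖ ≤ k / (|R| + k) * (|R| + k) := by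
        gcongr
        · exact min_le_left _ _
        · linarith [le_abs_self R]
    _ = k := div_mul_cancel₀ _ (by positivity)
    _ ≤ _ := h1

theorem differentiableOn_cKer (y : ℝ) : DifferentiableOn ℂ (fun κ => cKer κ y) halfPlane := by
  unfold cKer
  refine differentiableOn_integral (fun κ hκ => ?_) (fun ξ => ?_) fun k hk R => ?_
  · exact (continuous_phase_right y).aestronglyMeasurable.mul
      (integrable_inv_symb_sq hκ).aestronglyMeasurable
  · refine DifferentiableOn.const_mul (DifferentiableOn.div (differentiableOn_const _) ?_ fun κ hκ =>
      pow_ne_zero _ (symb_ne_zero hκ ξ)) _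
    unfold symb; fun_prop
  · obtain ⟨δ, h0, h1, h2⟩ := sector_of_bounds (R := R) hk
    refine ⟨_, (integrable_planeWeight hk).const_mul ((δ ^ 2)⁻¹), fun κ hκ hR ξ => ?_⟩
    rw [norm_mul, norm_phase, one_mul]
    refine (norm_inv_symb_sq_le h0 h1 (h2 κ hκ hR) (hk.trans_le hκ) ξ).trans ?_
    have := hκ.trans (Complex.re_le_norm κ)
    gcongr

theorem differentiableOn_moment {n : ℕ} (a : Fin n → ℕ) :
    DifferentiableOn ℂ (fun κ => moment κ a) halfPlane := by
  unfold moment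
  refine differentiableOn_integral (fun κ hκ => (integrable_moment hκ a).aestronglyMeasurable)
    (fun w => ?_) fun k hk R => ?_
  · refine DifferentiableOn.mul ?_ (differentiableOn_cKer _)
    exact DifferentiableOn.fun_finsetProd fun j _ => (differentiableOn_bKer _).mul_const _
  · obtain ⟨δ, h0, h1, h2⟩ := sector_of_bounds (R := R) hk
    refine ⟨fun w => (∏ j, |w j| ^ a j * bReal k (w j)) * (planeConst / (δ ^ 2 * k ^ 2)), ?_, fun κ hκ hR w => ?_⟩
    · exact (Integrable.fintype_prod (f := fun j (w : ℝ) => |w| ^ a j * bReal k w)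
        fun j => integrable_pow_bReal hk (a j)).mul_const _
    · rw [norm_mul, norm_prod]
      refine mul_le_mul (Finset.prod_le_prod (fun _ _ => norm_nonneg _) fun j _ => ?_) ?_ (norm_nonneg _)
        (Finset.prod_nonneg fun j _ => mul_nonneg (by positivity) (bReal_nonneg _ _))
      · rw [norm_mul, norm_pow, Complex.norm_real, Real.norm_eq_abs, mul_comm]
        exact mul_le_mul_of_nonneg_left ((norm_bKer_le κ _).trans (bReal_anti hk hκ _)) (by positivity)
      · refine (norm_cKer_le h0 h1 (h2 κ hκ hR) (hk.trans_le hκ) _).trans ?_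
        have := hκ.trans (Complex.re_le_norm κ)
        have := planeConst_nonneg
        gcongr

end DeltaDiagonal

namespace DeltaDiagonal

open Set
open scoped Nat

/-! ### The constants `c_{a,s}` and the moments -/

/-- The `t`-integrals in the constants `c_{a,s}`. -/
def cFactor (a : ℕ) (σ : ℤˣ) (ξ : ℝ) : ℂ :=
  ∫ t in Ioi (0 : ℝ), 1 / ((Real.sqrt 2 : ℂ) *
    ((Real.cosh t : ℂ) + Complex.I * (ξ : ℂ) * (sgn σ : ℂ))) ^ (a + 1)

theorem integrableOn_inv_cosh : IntegrableOn (fun t : ℝ => 1 / Real.cosh t) (Ioi 0) := by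
  have h2 : IntegrableOn (fun t : ℝ => Real.exp (-1 * t)) (Ioi 0) :=
    exp_neg_integrableOn_Ioi 0 one_pos
  refine (h2.const_mul 2).mono' ?_ (Eventually.of_forall fun t => ?_)
  · exact (Measurable.aestronglyMeasurable (by fun_prop))
  · have h := Real.cosh_pos t
    rw [Real.norm_of_nonneg (by positivity), div_le_iff₀ h, Real.cosh_eq]
    have h3 : Real.exp (-1 * t) * Real.exp t = 1 := by rw [← Real.exp_add]; simp
    nlinarith [Real.exp_pos (-1 * t), Real.exp_pos (-t)]

/-- The real part of the base is `√2 cosh t ≥ cosh t ≥ 1`, and the exponent `a + 1` is at least `1`.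
The bound is uniform in `ξ`, so the integrand of `c_{a,s}` has a product majorant. -/
theorem norm_inv_factor_le (a : ℕ) (σ : ℤˣ) (ξ t : ℝ) :
    ‖1 / ((Real.sqrt 2 : ℂ) *
      ((Real.cosh t : ℂ) + Complex.I * (ξ : ℂ) * (sgn σ : ℂ))) ^ (a + 1)‖ ≤ 1 / Real.cosh t := by
  have h1 := Real.one_le_cosh t
  have h2 : Real.cosh t ≤ ‖(Real.sqrt 2 : ℂ) *
      ((Real.cosh t : ℂ) + Complex.I * (ξ : ℂ) * (sgn σ : ℂ))‖ := by
    rw [norm_mul, Complex.norm_real, Real.norm_of_nonneg (Real.sqrt_nonneg 2)]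
    have h3 : Real.cosh t ≤ ‖(Real.cosh t : ℂ) + Complex.I * (ξ : ℂ) * (sgn σ : ℂ)‖ := by
      refine le_trans (le_of_eq ?_) (Complex.re_le_norm _)
      simp [-Complex.ofReal_cosh]
    have h4 : 1 ≤ √2 := Real.one_le_sqrt.2 (by norm_num)
    nlinarith [norm_nonneg ((Real.cosh t : ℂ) + Complex.I * (ξ : ℂ) * (sgn σ : ℂ))]
  rw [norm_div, norm_one, norm_pow]
  refine one_div_le_one_div_of_le (by linarith) (h2.trans ?_)
  exact le_self_pow₀ (h1.trans h2) (by omega)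

theorem restrict_cDomain (n : ℕ) : (volume : Measure ((Fin n → ℝ) × ℝ)).restrict (cDomain n) =
    (Measure.pi fun _ : Fin n => (volume : Measure ℝ).restrict (Ioi 0)).prod volume := by
  rw [cDomain, Measure.volume_eq_prod, ← Measure.prod_restrict, Measure.restrict_univ, volume_pi,
    Measure.restrict_pi_pi]

theorem cIntegrand_eq {n : ℕ} (a : Fin n → ℕ) (s : Fin n → ℤˣ) (p : (Fin n → ℝ) × ℝ) :
    cIntegrand a s p = (∏ j, 1 / ((Real.sqrt 2 : ℂ) *
      ((Real.cosh (p.1 j) : ℂ) + Complex.I * (p.2 : ℂ) * (sgn (s j) : ℂ))) ^ (a j + 1)) *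
      ((1 / (1 + p.2 ^ 2) ^ (3 / 2 : ℝ) : ℝ) : ℂ) := by
  rw [cIntegrand, Finset.prod_div_distrib, Finset.prod_const_one, Complex.ofReal_div,
    Complex.ofReal_one, div_mul_div_comm, one_mul, mul_comm]

theorem integrable_cIntegrand {n : ℕ} (a : Fin n → ℕ) (s : Fin n → ℤˣ) :
    Integrable (cIntegrand a s)
      ((Measure.pi fun _ : Fin n => (volume : Measure ℝ).restrict (Ioi 0)).prod volume) := by
  have h1 : Integrable (fun t : Fin n → ℝ => ∏ j, 1 / Real.cosh (t j))
      (Measure.pi fun _ : Fin n => (volume : Measure ℝ).restrict (Ioi 0)) :=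
    Integrable.fintype_prod (f := fun _ (t : ℝ) => 1 / Real.cosh t) fun _ => integrableOn_inv_cosh
  refine (h1.mul_prod integrable_inv_rpow_three_halves).mono' ?_ (Eventually.of_forall fun p => ?_)
  · refine Measurable.aestronglyMeasurable ?_
    unfold cIntegrand
    fun_prop
  · rw [cIntegrand_eq, norm_mul, norm_prod, Complex.norm_real,
      Real.norm_of_nonneg (by positivity : (0 : ℝ) ≤ 1 / (1 + p.2 ^ 2) ^ (3 / 2 : ℝ))]
    refine mul_le_mul_of_nonneg_right ?_ (by positivity)
    exact Finset.prod_le_prod (fun _ _ => norm_nonneg _) fun j _ => norm_inv_factor_le _ _ _ _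

theorem integrableOn_cIntegrand {n : ℕ} (a : Fin n → ℕ) (s : Fin n → ℤˣ) :
    IntegrableOn (cIntegrand a s) (cDomain n) := by
  rw [IntegrableOn, restrict_cDomain]
  exact integrable_cIntegrand a s

theorem integral_cIntegrand_left {n : ℕ} (a : Fin n → ℕ) (s : Fin n → ℤˣ) (ξ : ℝ) :
    ∫ t, cIntegrand a s (t, ξ) ∂(Measure.pi fun _ : Fin n => (volume : Measure ℝ).restrict (Ioi 0)) =
      (∏ j, cFactor (a j) (s j) ξ) * ((1 / (1 + ξ ^ 2) ^ (3 / 2 : ℝ) : ℝ) : ℂ) := by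
  simp_rw [cIntegrand_eq]
  rw [integral_mul_const]
  congr 1
  exact integral_fintype_prod_eq_prod (fun j t => 1 / ((Real.sqrt 2 : ℂ) *
      ((Real.cosh t : ℂ) + Complex.I * (ξ : ℂ) * (sgn (s j) : ℂ))) ^ (a j + 1))

theorem cCoeff_eq {n : ℕ} (a : Fin n → ℕ) (s : Fin n → ℤˣ) :
    cCoeff a s = ∫ ξ : ℝ, (∏ j, cFactor (a j) (s j) ξ) * ((1 / (1 + ξ ^ 2) ^ (3 / 2 : ℝ) : ℝ) : ℂ) := by
  rw [cCoeff, restrict_cDomain, integral_prod_symm _ (integrable_cIntegrand a s)]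
  simp_rw [integral_cIntegrand_left]

theorem integrable_prod_cFactor {n : ℕ} (a : Fin n → ℕ) (s : Fin n → ℤˣ) :
    Integrable fun ξ : ℝ => (∏ j, cFactor (a j) (s j) ξ) * ((1 / (1 + ξ ^ 2) ^ (3 / 2 : ℝ) : ℝ) : ℂ) := by
  have := (integrable_cIntegrand a s).integral_prod_right
  simpa only [integral_cIntegrand_left] using this

theorem integral_inv_add_sq_sq {D : ℝ} (hD : 0 < D) :
    ∫ t : ℝ, 1 / (8 * Real.pi ^ 2 * t ^ 2 + D) ^ 2 = 1 / (4 * √2 * (D * √D)) := by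
  have hp := Real.pi_pos
  have h2 : √2 * √2 = 2 := Real.mul_self_sqrt (by norm_num)
  have hDD : √D * √D = D := Real.mul_self_sqrt hD.le
  have hsD : 0 < √D := Real.sqrt_pos.2 hD
  set c := 2 * √2 * Real.pi / √D with hc
  have hc0 : 0 < c := by positivity
  have hcc : D * c ^ 2 = 8 * Real.pi ^ 2 := by
    rw [hc, div_pow, mul_pow, mul_pow, sq (√D), hDD, sq (√2), h2]; field_simp; ring
  have h : ∀ t : ℝ, 1 / (8 * Real.pi ^ 2 * t ^ 2 + D) ^ 2 = (D ^ 2)⁻¹ * (1 / (1 + (c * t) ^ 2) ^ 2) := by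
    intro t
    rw [← hcc, show D * c ^ 2 * t ^ 2 + D = D * (1 + (c * t) ^ 2) by ring, mul_pow]
    field_simp
  simp_rw [h]
  rw [integral_const_mul, Measure.integral_comp_mul_left (fun u : ℝ => 1 / (1 + u ^ 2) ^ 2),
    integral_inv_one_add_sq_sq, abs_of_pos (by positivity), smul_eq_mul, hc]
  field_simp
  rw [sq (√D), hDD]; ring

/-- Integrating the squared symbol across the diagonal leaves `(2π²η² + k²)^{-3/2}` up to a
constant, and the substitution `ξ = √2πη / k` turns this into the weight `(1 + ξ²)^{-3/2}` of the
constants `c_{a,s}`. -/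
theorem cKer_ofReal {k : ℝ} (hk : 0 < k) (y : ℝ) :
    cKer (k : ℂ) y = 1 / (8 * Real.pi * (k : ℂ) ^ 2) *
      ∫ ξ : ℝ, Complex.exp (-(Complex.I * ((√2 * k * ξ : ℝ) : ℂ) * y)) *
        ((1 / (1 + ξ ^ 2) ^ (3 / 2 : ℝ) : ℝ) : ℂ) := by
  have hp := Real.pi_pos
  have hκ : 0 < (k : ℂ).re := by simpa
  have h2 : √2 * √2 = 2 := Real.mul_self_sqrt (by norm_num)
  have hint : Integrable fun ξ : Plane => phase y ξ * (1 / symb (k : ℂ) ξ ^ 2) :=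
    (integrable_inv_symb_sq hκ).bdd_mul (c := 1) (continuous_phase_right y).aestronglyMeasurable
      (Eventually.of_forall fun ξ => (norm_phase y ξ).le)
  have hint2 := integrable_plane.2 hint
  rw [cKer, integral_plane, Measure.volume_eq_prod, integral_prod _ hint2]
  have hin : ∀ η : ℝ, ∫ t : ℝ, phase y (rot (η, t)) * (1 / symb (k : ℂ) (rot (η, t)) ^ 2) =
      Complex.exp (-(Complex.I * ((2 * Real.pi * η : ℝ) : ℂ) * y)) *
        ((1 / (4 * √2 * (k ^ 3 * (1 + (√2 * Real.pi / k * η) ^ 2) ^ (3 / 2 : ℝ))) : ℝ) : ℂ) := by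
    intro η
    simp_rw [phase_rot]
    rw [integral_const_mul]
    congr 1
    have hD : 0 < 2 * Real.pi ^ 2 * η ^ 2 + k ^ 2 := by positivity
    have h3 : ∀ t : ℝ, 1 / symb (k : ℂ) (rot (η, t)) ^ 2 =
        ((1 / (8 * Real.pi ^ 2 * t ^ 2 + (2 * Real.pi ^ 2 * η ^ 2 + k ^ 2)) ^ 2 : ℝ) : ℂ) := by
      intro t; rw [symb_rot]; push_cast; ring
    simp_rw [h3]
    rw [integral_complex_ofReal, integral_inv_add_sq_sq hD]
    refine congrArg Complex.ofReal ?_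
    have h4 : 2 * Real.pi ^ 2 * η ^ 2 + k ^ 2 = k ^ 2 * (1 + (√2 * Real.pi / k * η) ^ 2) := by
      rw [mul_pow, div_pow, mul_pow, sq (√2), h2]; field_simp; ring
    rw [h4, Real.sqrt_mul (by positivity), Real.sqrt_sq hk.le, rpow_three_halves (by positivity)]
    ring
  simp_rw [hin]
  have hsub := Measure.integral_comp_mul_left (fun ξ : ℝ =>
    Complex.exp (-(Complex.I * ((√2 * k * ξ : ℝ) : ℂ) * y)) *
        ((1 / (4 * √2 * (k ^ 3 * (1 + ξ ^ 2) ^ (3 / 2 : ℝ))) : ℝ) : ℂ)) (√2 * Real.pi / k)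
  have h5 : ∀ η : ℝ, √2 * k * (√2 * Real.pi / k * η) = 2 * Real.pi * η := by
    intro η; field_simp; rw [sq, h2]; ring
  simp_rw [h5] at hsub
  rw [hsub, abs_of_pos (by positivity), Complex.real_smul]
  have h6 : ∀ ξ : ℝ, Complex.exp (-(Complex.I * ((√2 * k * ξ : ℝ) : ℂ) * y)) *
        ((1 / (4 * √2 * (k ^ 3 * (1 + ξ ^ 2) ^ (3 / 2 : ℝ))) : ℝ) : ℂ) =
      ((1 / (4 * √2 * k ^ 3) : ℝ) : ℂ) * (Complex.exp (-(Complex.I * ((√2 * k * ξ : ℝ) : ℂ) * y)) *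
        ((1 / (1 + ξ ^ 2) ^ (3 / 2 : ℝ) : ℝ) : ℂ)) := by
    intro ξ
    rw [show 1 / (4 * √2 * (k ^ 3 * (1 + ξ ^ 2) ^ (3 / 2 : ℝ))) =
      1 / (4 * √2 * k ^ 3) * (1 / (1 + ξ ^ 2) ^ (3 / 2 : ℝ)) by field_simp, Complex.ofReal_mul (1 / (4 * √2 * k ^ 3))]
    ring
  simp_rw [h6]
  rw [integral_const_mul, ← mul_assoc, ← Complex.ofReal_mul]
  congr 1
  have : (√2 * Real.pi / k)⁻¹ * (1 / (4 * √2 * k ^ 3)) = 1 / (8 * Real.pi * k ^ 2) := by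
    rw [inv_div]
    field_simp
    rw [sq, h2]; norm_num
  rw [this]; push_cast; rfl

/-- The two half-lines correspond to the two signs: reflecting `w` gives `σ^a` from the power and
replaces `ξ` by `σξ`. With frequency `√2 k ξ` the factor `k` comes out of the denominator. -/
theorem integral_bKer_mul {k : ℝ} (hk : 0 < k) (ξ : ℝ) (a : ℕ) :
    ∫ w : ℝ, bKer k w * ((w : ℂ) ^ a * Complex.exp (-(Complex.I * ((√2 * k * ξ : ℝ) : ℂ) * w))) =
      (2 * Real.pi : ℂ)⁻¹ * a ! * ((k : ℂ)⁻¹) ^ (a + 1) * ∑ σ : ℤˣ, (sgn σ : ℂ) ^ a * cFactor a σ ξ := by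
  have hκ : 0 < (k : ℂ).re := by simpa
  have hk0 : (k : ℂ) ≠ 0 := by exact_mod_cast hk.ne'
  have hfac : ∀ σ : ℤˣ, ∫ w in Ioi (0 : ℝ), bKer k w * ((w : ℂ) ^ a *
      Complex.exp (-(Complex.I * ((√2 * k * ξ * sgn σ : ℝ) : ℂ) * w))) =
      (2 * Real.pi : ℂ)⁻¹ * a ! * ((k : ℂ)⁻¹) ^ (a + 1) * cFactor a σ ξ := by
    intro σ
    rw [integral_Ioi_bKer_mul hκ, one_div, mul_assoc (2 * Real.pi : ℂ)⁻¹, mul_assoc (2 * Real.pi : ℂ)⁻¹,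
      cFactor, ← integral_const_mul ((a ! : ℂ) * _)]
    congr 2; ext t
    have : ((√2 : ℝ) : ℂ) * (k : ℂ) * (Real.cosh t : ℂ) + Complex.I * ((√2 * k * ξ * sgn σ : ℝ) : ℂ) =
        k * (((√2 : ℝ) : ℂ) * ((Real.cosh t : ℂ) + Complex.I * (ξ : ℂ) * (sgn σ : ℂ))) := by
      push_cast; ring
    rw [this, mul_pow, inv_pow]
    simp only [div_eq_mul_inv, mul_inv, one_mul]; ring
  rw [integral_eq_Ioi_add (integrable_bKer_mul hκ _ a)]
  have huniv : (Finset.univ : Finset ℤˣ) = {1, -1} := by decide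
  rw [huniv, Finset.sum_pair (by decide), mul_add, mul_left_comm, ← hfac 1, mul_left_comm, ← hfac (-1)]
  congr 1
  · simp [sgn]
  · rw [← integral_const_mul]
    congr 1; ext w
    rw [bKer_neg]
    simp only [sgn]
    push_cast
    rw [neg_pow (w : ℂ)]
    ring_nf

/-- The value of the moments at `κ = 1`. -/
def momentConst {n : ℕ} (a : Fin n → ℕ) : ℂ :=
  1 / (8 * Real.pi) * ((2 * Real.pi : ℂ)⁻¹) ^ n * (∏ j, ((a j)! : ℂ)) *
    ∑ s : Fin n → ℤˣ, (∏ j, (sgn (s j) : ℂ) ^ a j) * cCoeff a s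

/-- With `c_k` written as a Fourier integral, the phase in `∑ w_i` is a product over the `w_j`, and
Fubini leaves a product of one-dimensional integrals. Each is a sum over two signs, and multiplying
out gives the sum over all `s`. -/
theorem moment_ofReal {k : ℝ} (hk : 0 < k) {n : ℕ} (a : Fin n → ℕ) :
    moment (k : ℂ) a = ((k : ℂ)⁻¹) ^ (2 + n + ∑ j, a j) * momentConst a := by
  have hκ : 0 < (k : ℂ).re := by simpa
  have hA : Integrable fun w : Fin n → ℝ => ∏ j, bKer k (w j) * (w j : ℂ) ^ a j :=
    Integrable.fintype_prod (f := fun j (w : ℝ) => bKer k w * (w : ℂ) ^ a j) fun j => integrable_bKer_pow hκ (a j)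
  have hB : Integrable fun ξ : ℝ => ((1 / (1 + ξ ^ 2) ^ (3 / 2 : ℝ) : ℝ) : ℂ) :=
    integrable_inv_rpow_three_halves.ofReal
  set p : (Fin n → ℝ) × ℝ → ℂ := fun z =>
    Complex.exp (-(Complex.I * ((√2 * k * z.2 : ℝ) : ℂ) * ((∑ i, z.1 i : ℝ) : ℂ))) with hp
  have hpc : Continuous p := by fun_prop
  have hpb : ∀ z, ‖p z‖ ≤ 1 := fun z => by
    rw [hp]
    simp only [Complex.norm_exp]
    rw [Real.exp_le_one_iff]
    rw [mul_assoc, ← Complex.ofReal_mul]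
    simp
  have hinner : ∀ ξ : ℝ, ∫ w : Fin n → ℝ, p (w, ξ) * ∏ j, bKer k (w j) * (w j : ℂ) ^ a j =
      ((2 * Real.pi : ℂ)⁻¹) ^ n * (∏ j, ((a j)! : ℂ)) * ((k : ℂ)⁻¹) ^ (n + ∑ j, a j) *
        ∑ s : Fin n → ℤˣ, (∏ j, (sgn (s j) : ℂ) ^ a j) * ∏ j, cFactor (a j) (s j) ξ := by
    intro ξ
    have h1 : ∀ w : Fin n → ℝ, p (w, ξ) * ∏ j, bKer k (w j) * (w j : ℂ) ^ a j =
        ∏ j, bKer k (w j) * ((w j : ℂ) ^ a j *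
          Complex.exp (-(Complex.I * ((√2 * k * ξ : ℝ) : ℂ) * (w j)))) := by
      intro w
      have : p (w, ξ) = ∏ j, Complex.exp (-(Complex.I * ((√2 * k * ξ : ℝ) : ℂ) * (w j))) := by
        rw [← Complex.exp_sum, hp]
        simp only [Complex.ofReal_sum, Finset.mul_sum, Finset.sum_neg_distrib]
      rw [this, ← Finset.prod_mul_distrib]
      exact Finset.prod_congr rfl fun j _ => by ring
    simp_rw [h1]
    rw [integral_fintype_prod_volume_eq_prod (fun j (w : ℝ) => bKer k w * ((w : ℂ) ^ a j *
          Complex.exp (-(Complex.I * ((√2 * k * ξ : ℝ) : ℂ) * w))))]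
    simp_rw [integral_bKer_mul hk]
    rw [Finset.prod_mul_distrib, Finset.prod_mul_distrib, Finset.prod_mul_distrib, Finset.prod_const,
      Finset.card_univ, Fintype.card_fin, Finset.prod_pow_eq_pow_sum, Finset.sum_add_distrib,
      Finset.sum_const, Finset.card_univ, Fintype.card_fin, smul_eq_mul, mul_one,
      add_comm (∑ j, a j), Finset.prod_univ_sum, Fintype.piFinset_univ]
    simp_rw [Finset.prod_mul_distrib]
  have hck : ∀ w : Fin n → ℝ, cKer (k : ℂ) (∑ i, w i) = 1 / (8 * Real.pi * (k : ℂ) ^ 2) *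
      ∫ ξ : ℝ, p (w, ξ) * ((1 / (1 + ξ ^ 2) ^ (3 / 2 : ℝ) : ℝ) : ℂ) := fun w => cKer_ofReal hk _
  rw [moment]
  simp_rw [hck, mul_left_comm _ (1 / (8 * Real.pi * (k : ℂ) ^ 2))]
  rw [integral_const_mul, integral_kernel_swap hpc.aestronglyMeasurable hpb hA hB]
  simp_rw [hinner, mul_assoc, integral_const_mul, Finset.sum_mul]
  rw [integral_finsetSum _ fun s _ => ?_]
  · simp_rw [mul_assoc, integral_const_mul, ← cCoeff_eq]
    rw [momentConst, pow_add, pow_add, pow_add]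
    have hk0 : (k : ℂ) ≠ 0 := by exact_mod_cast hk.ne'
    field_simp
  · simp_rw [mul_assoc]
    exact (integrable_prod_cFactor a s).const_mul _

/-- Both sides are holomorphic in the half-plane and agree on the real points `1 + 1/(n+1)`, which
accumulate at `1`. -/
theorem moment_eq {κ : ℂ} (hκ : 0 < κ.re) {n : ℕ} (a : Fin n → ℕ) :
    moment κ a = (κ⁻¹) ^ (2 + n + ∑ j, a j) * momentConst a := by
  have h1 : AnalyticOnNhd ℂ (fun κ => moment κ a) halfPlane :=
    (differentiableOn_moment a).analyticOnNhd isOpen_halfPlane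
  have h2 : AnalyticOnNhd ℂ (fun κ => (κ⁻¹) ^ (2 + n + ∑ j, a j) * momentConst a) halfPlane := by
    refine DifferentiableOn.analyticOnNhd ?_ isOpen_halfPlane
    refine ((differentiableOn_id.inv fun z hz h => ?_).pow _).mul_const _
    have : 0 < z.re := hz
    simp [h] at this
  refine h1.eqOn_of_preconnected_of_frequently_eq h2 isPreconnected_halfPlane
    (z₀ := 1) (by simp [halfPlane]) ?_ hκ
  have hlim : Tendsto (fun n : ℕ => ((1 + ((n : ℝ) + 1)⁻¹ : ℝ) : ℂ)) atTop (𝓝[≠] 1) := by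
    refine tendsto_nhdsWithin_iff.2 ⟨?_, Eventually.of_forall fun n => ?_⟩
    · have h3 : Tendsto (fun n : ℕ => (1 + ((n : ℝ) + 1)⁻¹ : ℝ)) atTop (𝓝 (1 + 0)) :=
        tendsto_const_nhds.add (tendsto_inv_atTop_zero.comp
          (tendsto_atTop_add_const_right _ _ tendsto_natCast_atTop_atTop))
      have h4 := (Complex.continuous_ofReal.tendsto (1 + 0)).comp h3
      rw [add_zero, Complex.ofReal_one] at h4
      exact h4
    · have : (((n : ℝ) + 1)⁻¹ : ℝ) ≠ 0 := by positivity
      simp only [mem_compl_iff, mem_singleton_iff]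
      rw [← Complex.ofReal_one, Complex.ofReal_inj]
      intro h; exact this (by linarith)
  exact hlim.frequently (Frequently.of_forall fun n => moment_ofReal (by positivity) a)

end DeltaDiagonal

namespace DeltaDiagonal

open Set BoundedContinuousFunction
open scoped Nat

/-! ### The asymptotic expansion -/

section Expansion

variable {ρ : ℝ → ℝ}

theorem integral_norm_bKer_le {κ : ℂ} (hκ : 0 < κ.re) {δ : ℝ} (hδ0 : 0 < δ) (h : δ * ‖κ‖ ≤ κ.re) :
    ∫ w, ‖bKer κ w‖ ≤ (∫ u, bReal 1 u) / δ * ‖κ‖⁻¹ := by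
  have hn : 0 < ‖κ‖ := hκ.trans_le (Complex.re_le_norm κ)
  have hB : 0 ≤ ∫ u, bReal 1 u := integral_nonneg fun u => bReal_nonneg 1 u
  calc ∫ w, ‖bKer κ w‖ ≤ ∫ w, bReal κ.re w :=
        integral_mono (integrable_bKer hκ).norm (integrable_bReal hκ) fun w => norm_bKer_le κ w
    _ = κ.re⁻¹ * ∫ u, bReal 1 u := integral_bReal_scale hκ
    _ ≤ (δ * ‖κ‖)⁻¹ * ∫ u, bReal 1 u := by gcongr
    _ = _ := by rw [mul_inv]; ring

/-- Here `A/|κ|` bounds the norm of the convolution operator, and `R = 2A` makes it at most `1/2`.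
The remainder after `N` steps carries the `N`-th power of this norm and two Green functions of norm
`O(1/|κ|)` each. -/
theorem neumann_solution (hρ : Continuous ρ) (hρc : HasCompactSupport ρ) {δ : ℝ} (hδ0 : 0 < δ)
    (hδ1 : δ ≤ 1) : ∃ A R : ℝ, 0 ≤ A ∧ ∀ κ : ℂ, 0 < κ.re → δ * ‖κ‖ ≤ κ.re → R ≤ ‖κ‖ →
      (InResolventSet ρ (-κ ^ 2) ∧ InResolventSet (fun _ => 0) (-κ ^ 2) ∧
        HasTrace (regResolvent ρ (-κ ^ 2)) (trReg ρ (-κ ^ 2))) ∧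
      ∀ N : ℕ, ‖trReg ρ (-κ ^ 2) + ∑ n ∈ Finset.range N, (-1) ^ n * (1 / 2 * ∫ w : Fin n → ℝ,
        (∏ j, bKer κ (w j)) * cKer κ (∑ i, w i) * lastInt ρ n w)‖ ≤
          (∫ x, |ρ x|) * (2 * (planeConst / δ ^ 2)) * A ^ N * (‖κ‖⁻¹) ^ (N + 2) := by
  obtain ⟨V, hV⟩ := exists_potentialBCF hρ hρc
  have hB : 0 ≤ ∫ u, bReal 1 u := integral_nonneg fun u => bReal_nonneg 1 u
  set A := ‖V‖ * ((∫ u, bReal 1 u) / δ) with hA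
  have hA0 : 0 ≤ A := by positivity
  refine ⟨A, 2 * A, hA0, fun κ hκ hδ hR => ?_⟩
  have hn : 0 < ‖κ‖ := hκ.trans_le (Complex.re_le_norm κ)
  have hconj : δ * ‖(starRingEnd ℂ) κ‖ ≤ ((starRingEnd ℂ) κ).re := by simpa using hδ
  have hAκ : A * ‖κ‖⁻¹ ≤ 1 / 2 := by
    rw [← div_eq_mul_inv, div_le_iff₀ hn]; linarith
  have hsmall : ‖V‖ * ∫ w, ‖bKer κ w‖ ≤ 1 / 2 := by
    refine (mul_le_mul_of_nonneg_left (integral_norm_bKer_le hκ hδ0 hδ) (norm_nonneg V)).trans ?_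
    rwa [← mul_assoc]
  set K : (ℝ →ᵇ L2Plane) →L[ℂ] (ℝ →ᵇ L2Plane) := convOp (integrable_bKer (re_conj_pos hκ)) V with hK
  have hKA : ‖K‖ ≤ A * ‖κ‖⁻¹ := by
    refine (norm_convOp _ V).trans ?_
    refine (mul_le_mul_of_nonneg_left (integral_norm_bKer_le (re_conj_pos hκ) hδ0 hconj) (norm_nonneg V)).trans ?_
    rw [RCLike.norm_conj, ← mul_assoc]
  obtain ⟨h, hh⟩ := exists_eq_sub_apply K (hKA.trans hAκ) (gBCF (re_conj_pos hκ))
  obtain ⟨h1, h2, h3, h4⟩ := trace_formula hρ hρc hκ hV hsmall hh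
  refine ⟨⟨h1, h2, h3⟩, fun N => ?_⟩
  have hsum : trReg ρ (-κ ^ 2) + ∑ n ∈ Finset.range N, (-1) ^ n * (1 / 2 * ∫ w : Fin n → ℝ,
      (∏ j, bKer κ (w j)) * cKer κ (∑ i, w i) * lastInt ρ n w) =
      -((-1) ^ N * pairing ρ hκ ((K ^ N) h)) := by
    rw [h4, pairing_neumann hρ hρc hκ hh N]
    simp_rw [hK, pairing_iterate hρ hρc hκ hV]
    ring
  have hg := norm_gBCF_le hκ hδ0 hδ1 hδ
  have hg' := norm_gBCF_le (re_conj_pos hκ) hδ0 hδ1 hconj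
  rw [RCLike.norm_conj] at hg'
  have hhn : ‖h‖ ≤ 2 * (√planeConst / (δ * ‖κ‖)) :=
    (norm_le_of_eq_sub_apply (hKA.trans hAκ) hh).trans (by gcongr)
  have hKN : ∀ N : ℕ, ‖(K ^ N) h‖ ≤ (A * ‖κ‖⁻¹) ^ N * (2 * (√planeConst / (δ * ‖κ‖))) := by
    intro N
    refine le_trans ?_ (mul_le_mul (pow_le_pow_left₀ (norm_nonneg _) hKA N) hhn (norm_nonneg _) (by positivity))
    induction N with
    | zero => simp
    | succ N ih =>
      rw [pow_succ', pow_succ', mul_assoc]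
      exact (K.le_opNorm _).trans (mul_le_mul_of_nonneg_left ih (norm_nonneg K))
  rw [hsum, norm_neg, norm_mul, norm_pow, norm_neg, norm_one, one_pow, one_mul]
  refine (norm_pairing_le hρ hρc hκ _).trans ?_
  have hρ1 : 0 ≤ ∫ x, |ρ x| := integral_nonneg fun x => abs_nonneg _
  calc (∫ x, |ρ x|) * (‖(K ^ N) h‖ * ‖gBCF hκ‖)
      ≤ (∫ x, |ρ x|) * (((A * ‖κ‖⁻¹) ^ N * (2 * (√planeConst / (δ * ‖κ‖)))) * (√planeConst / (δ * ‖κ‖))) := by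
        gcongr
        exact hKN N
    _ = (∫ x, |ρ x|) * (2 * ((√planeConst * √planeConst) / δ ^ 2)) * A ^ N * (‖κ‖⁻¹) ^ (N + 2) := by
        rw [mul_pow, pow_add]; field_simp
    _ = _ := by rw [Real.mul_self_sqrt planeConst_nonneg]

theorem sum_momentConst (ρ : ℝ → ℝ) (n l : ℕ) :
    ∑ a ∈ Finset.piAntidiag (Finset.univ : Finset (Fin n)) l,
      (derivInt ρ n a : ℂ) / (∏ j, ((a j)! : ℂ)) * momentConst a =
        1 / (8 * Real.pi) * ((2 * Real.pi : ℂ)⁻¹) ^ n * bNL ρ n l := by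
  rw [bNL, Finset.mul_sum]
  refine Finset.sum_congr rfl fun a _ => ?_
  have hf : (∏ j, ((a j)! : ℂ)) ≠ 0 :=
    Finset.prod_ne_zero_iff.2 fun j _ => by exact_mod_cast (a j).factorial_ne_zero
  simp_rw [integral_multiDeriv_rhoNS]
  rw [momentConst]
  have : ∑ s : Fin n → ℤˣ, cCoeff a s * (((∏ j, sgn (s j) ^ a j) * derivInt ρ n a : ℝ) : ℂ) =
      derivInt ρ n a * ∑ s : Fin n → ℤˣ, (∏ j, (sgn (s j) : ℂ) ^ a j) * cCoeff a s := by
    rw [Finset.mul_sum]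
    refine Finset.sum_congr rfl fun s _ => ?_
    push_cast; ring
  rw [this]
  field_simp

/-- All constants meet here: `-(-1)^n · (1/2) · (1/8π) · (2π)^{-n} = (1/8)(-2π)^{-(n+1)}`. -/
theorem sum_moment (ρ : ℝ → ℝ) {κ : ℂ} (hκ : 0 < κ.re) (n l : ℕ) :
    -((-1) ^ n * (1 / 2 * ∑ a ∈ Finset.piAntidiag (Finset.univ : Finset (Fin n)) l,
      (derivInt ρ n a : ℂ) / (∏ j, ((a j)! : ℂ)) * moment κ a)) =
        1 / 8 * (bNL ρ n l / (-2 * (Real.pi : ℂ)) ^ (n + 1)) * (κ⁻¹) ^ (n + l + 2) := by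
  have h : ∑ a ∈ Finset.piAntidiag (Finset.univ : Finset (Fin n)) l,
      (derivInt ρ n a : ℂ) / (∏ j, ((a j)! : ℂ)) * moment κ a =
      (κ⁻¹) ^ (n + l + 2) * (1 / (8 * Real.pi) * ((2 * Real.pi : ℂ)⁻¹) ^ n * bNL ρ n l) := by
    rw [← sum_momentConst, Finset.mul_sum]
    refine Finset.sum_congr rfl fun a ha => ?_
    rw [moment_eq hκ, (Finset.mem_piAntidiag.1 ha).1, show 2 + n + l = n + l + 2 by ring]
    ring
  have hp : (Real.pi : ℂ) ≠ 0 := by exact_mod_cast Real.pi_ne_zero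
  rw [h, show (-2 * (Real.pi : ℂ)) = -1 * (2 * Real.pi) by ring, mul_pow (-1 : ℂ), pow_succ (-1 : ℂ), pow_succ (2 * Real.pi : ℂ),
    inv_pow (2 * Real.pi : ℂ)]
  have h1 : ((-1 : ℂ) ^ n) * (-1) ^ n = 1 := by rw [← mul_pow]; simp
  have h2 : ((-1 : ℂ) ^ n) ≠ 0 := pow_ne_zero _ (by norm_num)
  field_simp
  rw [sq, h1]
  ring

theorem sum_bCoeff (ρ : ℝ → ℝ) (M : ℕ) (x : ℂ) :
    ∑ m ∈ Finset.range M, bCoeff ρ m * x ^ (m + 2) =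
      ∑ n ∈ Finset.range M, ∑ l ∈ Finset.range (M - n),
        1 / 8 * (bNL ρ n l / (-2 * (Real.pi : ℂ)) ^ (n + 1)) * x ^ (n + l + 2) := by
  rw [← Finset.sum_range_diag_flip M fun n l =>
    1 / 8 * (bNL ρ n l / (-2 * (Real.pi : ℂ)) ^ (n + 1)) * x ^ (n + l + 2)]
  refine Finset.sum_congr rfl fun m _ => ?_
  rw [bCoeff, Finset.Nat.sum_antidiagonal_eq_sum_range_succ_mk, Finset.mul_sum, Finset.sum_mul]
  refine Finset.sum_congr rfl fun n hn => ?_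
  rw [Nat.add_sub_cancel' (Nat.lt_succ_iff.1 (Finset.mem_range.1 hn))]

theorem trReg_expansion (hρ : ContDiff ℝ ∞ ρ) (hρc : HasCompactSupport ρ) {δ : ℝ} (hδ0 : 0 < δ)
    (hδ1 : δ ≤ 1) : ∃ R : ℝ, ∀ M : ℕ, ∃ C : ℝ, ∀ κ : ℂ, 0 < κ.re → δ * ‖κ‖ ≤ κ.re → R ≤ ‖κ‖ →
      (InResolventSet ρ (-κ ^ 2) ∧ InResolventSet (fun _ => 0) (-κ ^ 2) ∧
        HasTrace (regResolvent ρ (-κ ^ 2)) (trReg ρ (-κ ^ 2))) ∧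
      ‖trReg ρ (-κ ^ 2) - ∑ m ∈ Finset.range M, bCoeff ρ m * (κ⁻¹) ^ (m + 2)‖ ≤
        C * (‖κ‖⁻¹) ^ (M + 2) := by
  obtain ⟨A, R, hA, h⟩ := neumann_solution hρ.continuous hρc hδ0 hδ1
  refine ⟨R, fun M => ?_⟩
  -- The `n`-th term is already of order `|κ|^{-n-2}`, so its Taylor expansion is needed only up to
  -- order `M - n`. The radius `R` comes from the contraction and does not depend on `M`.
  choose C hC using fun n => iterate_expansion hρ hρc hδ0 hδ1 n (M - n)
  refine ⟨(∫ x, |ρ x|) * (2 * (planeConst / δ ^ 2)) * A ^ M + ∑ n ∈ Finset.range M, 1 / 2 * C n,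
    fun κ hκ hδ hR => ⟨(h κ hκ hδ hR).1, ?_⟩⟩
  have h2 := (h κ hκ hδ hR).2 M
  set I : ℕ → ℂ := fun n => ∫ w : Fin n → ℝ, (∏ j, bKer κ (w j)) * cKer κ (∑ i, w i) * lastInt ρ n w
  set S : ℕ → ℂ := fun n => ∑ l ∈ Finset.range (M - n),
    ∑ a ∈ Finset.piAntidiag (Finset.univ : Finset (Fin n)) l,
      (derivInt ρ n a : ℂ) / (∏ j, ((a j)! : ℂ)) * moment κ a with hS
  have hsum : ∑ m ∈ Finset.range M, bCoeff ρ m * (κ⁻¹) ^ (m + 2) =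
      -∑ n ∈ Finset.range M, (-1) ^ n * (1 / 2 * S n) := by
    rw [sum_bCoeff, ← Finset.sum_neg_distrib]
    refine Finset.sum_congr rfl fun n _ => ?_
    rw [hS]
    simp only [Finset.mul_sum (Finset.range (M - n)), ← Finset.sum_neg_distrib (s := Finset.range (M - n))]
    exact Finset.sum_congr rfl fun l _ => (sum_moment ρ hκ n l).symm
  have heq : trReg ρ (-κ ^ 2) - ∑ m ∈ Finset.range M, bCoeff ρ m * (κ⁻¹) ^ (m + 2) =
      (trReg ρ (-κ ^ 2) + ∑ n ∈ Finset.range M, (-1) ^ n * (1 / 2 * I n)) -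
        ∑ n ∈ Finset.range M, (-1) ^ n * (1 / 2 * (I n - S n)) := by
    rw [hsum]
    simp only [mul_sub, Finset.sum_sub_distrib]
    ring
  rw [heq, add_mul, Finset.sum_mul]
  refine (norm_sub_le _ _).trans (add_le_add h2 ((norm_sum_le _ _).trans (Finset.sum_le_sum fun n hn => ?_)))
  have h3 := hC n κ hκ hδ
  rw [show 2 + n + (M - n) = M + 2 by have := Finset.mem_range.1 hn; omega] at h3
  rw [norm_mul, norm_mul, norm_pow, norm_neg, norm_one, one_pow, one_mul, mul_assoc]
  refine mul_le_mul (by norm_num) h3 (norm_nonneg _) (by norm_num)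

end Expansion

/-! ### The first two coefficients -/

theorem multiDeriv_zero {n : ℕ} (f : (Fin (n + 1) → ℝ) → ℝ) : multiDeriv 0 f = f := by
  unfold multiDeriv
  induction List.finRange n with
  | nil => rfl
  | cons j l ih => simp

theorem derivInt_zero (ρ : ℝ → ℝ) (n : ℕ) : derivInt ρ n 0 = 2 * ∫ y, ρ y ^ (n + 1) := by
  have h := integral_shift_prod ρ n (fun _ => 0)
  simp only [psum, ite_self, Finset.sum_const_zero, sub_zero, Finset.prod_const, Finset.card_univ,
    Fintype.card_fin] at h
  rw [derivInt, multiDeriv_zero]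
  simp only [lastInt] at h
  simp_rw [pow_succ']
  linarith

theorem bNL_zero (ρ : ℝ → ℝ) (n : ℕ) :
    bNL ρ n 0 = (∑ s : Fin n → ℤˣ, cCoeff 0 s) * ((2 * ∫ y, ρ y ^ (n + 1) : ℝ) : ℂ) := by
  rw [bNL, Finset.piAntidiag_zero, Finset.sum_singleton, Finset.sum_mul]
  simp_rw [integral_multiDeriv_rhoNS, derivInt_zero]
  simp

theorem cCoeff_fin_zero (a : Fin 0 → ℕ) (s : Fin 0 → ℤˣ) : cCoeff a s = 2 := by
  rw [cCoeff_eq]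
  simp only [Finset.univ_eq_empty, Finset.prod_empty, one_mul]
  rw [integral_complex_ofReal, integral_inv_rpow_three_halves]
  norm_num

theorem bCoeff_zero (ρ : ℝ → ℝ) :
    bCoeff ρ 0 = ((-(1 / (4 * Real.pi)) * ∫ y : ℝ, ρ y : ℝ) : ℂ) := by
  rw [bCoeff, show Finset.HasAntidiagonal.antidiagonal 0 = {(0, 0)} from rfl, Finset.sum_singleton, bNL_zero]
  simp only [cCoeff_fin_zero, zero_add, pow_one, Finset.sum_const, Finset.card_univ]
  have hp : (Real.pi : ℂ) ≠ 0 := by exact_mod_cast Real.pi_ne_zero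
  simp
  field_simp
  ring

/-- The Fourier transform of `b_1` has been computed twice, once as a sum over half-lines and once
in closed form; comparing the two gives the sum without evaluating either summand. -/
theorem sum_cFactor_zero (ξ : ℝ) :
    ∑ σ : ℤˣ, cFactor 0 σ ξ = ((Real.pi / √2 * (1 / √(1 + ξ ^ 2)) : ℝ) : ℂ) := by
  have hs : 0 < √(1 + ξ ^ 2) := Real.sqrt_pos.2 (by positivity)
  have h2 : (√2) ^ 2 = 2 := Real.sq_sqrt (by norm_num)
  have h := integral_bKer_mul one_pos ξ 0
  have h' := integral_bKer_mul_exp (κ := ((1 : ℝ) : ℂ)) (by simp) (√2 * 1 * ξ)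
    (c := ((√2 * √(1 + ξ ^ 2) : ℝ) : ℂ)) (by rw [Complex.ofReal_re]; positivity) (by
      rw [← Complex.ofReal_pow, mul_pow, h2, Real.sq_sqrt (by positivity), ← Complex.ofReal_pow (√2 * 1 * ξ),
        mul_one, mul_pow, h2]
      push_cast; ring)
  simp only [pow_zero, one_mul] at h
  rw [h'] at h
  simp only [Nat.factorial_zero, Nat.cast_one, mul_one, Complex.ofReal_one, inv_one, one_pow] at h
  have hp : (Real.pi : ℂ) ≠ 0 := by exact_mod_cast Real.pi_ne_zero
  have h3 : ∑ σ : ℤˣ, cFactor 0 σ ξ = 2 * Real.pi * (1 / (2 * ((√2 * √(1 + ξ ^ 2) : ℝ) : ℂ))) := by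
    rw [h]; field_simp
  rw [h3]
  push_cast
  have h4 : ((√(1 + ξ ^ 2) : ℝ) : ℂ) ≠ 0 := by exact_mod_cast hs.ne'
  have h5 : ((√2 : ℝ) : ℂ) ≠ 0 := by exact_mod_cast (by positivity : √2 ≠ 0)
  field_simp

theorem sum_cCoeff_one : ∑ s : Fin 1 → ℤˣ, cCoeff 0 s = ((Real.pi ^ 2 / (2 * √2) : ℝ) : ℂ) := by
  simp_rw [cCoeff_eq]
  rw [← integral_finsetSum _ fun s _ => integrable_prod_cFactor _ s]
  -- The sum over the signs contributes `(1 + ξ²)^{-1/2}`, which raises the exponent of the weight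
  -- from `3/2` to `2`.
  have h : ∀ ξ : ℝ, ∑ s : Fin 1 → ℤˣ, (∏ j, cFactor ((0 : Fin 1 → ℕ) j) (s j) ξ) *
      ((1 / (1 + ξ ^ 2) ^ (3 / 2 : ℝ) : ℝ) : ℂ) =
      ((Real.pi / √2 * (1 / (1 + ξ ^ 2) ^ 2) : ℝ) : ℂ) := by
    intro ξ
    have hs : 0 < √(1 + ξ ^ 2) := Real.sqrt_pos.2 (by positivity)
    have hq : √(1 + ξ ^ 2) * √(1 + ξ ^ 2) = 1 + ξ ^ 2 := Real.mul_self_sqrt (by positivity)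
    rw [← Finset.sum_mul]
    simp only [Fin.prod_univ_one, Pi.zero_apply]
    rw [Fintype.sum_equiv (Equiv.funUnique (Fin 1) ℤˣ) (fun s => cFactor 0 (s 0) ξ) (fun σ => cFactor 0 σ ξ) (fun s => rfl),
      sum_cFactor_zero, ← Complex.ofReal_mul, rpow_three_halves (by positivity)]
    refine congrArg Complex.ofReal ?_
    field_simp
    rw [sq (√(1 + ξ ^ 2)), hq]
  simp_rw [h]
  rw [integral_complex_ofReal, integral_const_mul, integral_inv_one_add_sq_sq]
  refine congrArg Complex.ofReal ?_
  field_simp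

theorem bCoeff_one (ρ : ℝ → ℝ) :
    bCoeff ρ 1 = ((√2 / 64 * ∫ y : ℝ, ρ y ^ 2 : ℝ) : ℂ) := by
  -- For `n = 0` there is no multi-index of order `1`.
  have h0 : bNL ρ 0 1 = 0 := by
    rw [bNL, Finset.univ_eq_empty, Finset.piAntidiag_empty_of_ne_zero one_ne_zero, Finset.sum_empty]
  rw [bCoeff, show Finset.HasAntidiagonal.antidiagonal 1 = {(0, 1), (1, 0)} from rfl,
    Finset.sum_pair (by decide)]
  rw [h0, bNL_zero, sum_cCoeff_one, zero_div, zero_add]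
  have h2 : (√2) * √2 = 2 := Real.mul_self_sqrt (by norm_num)
  have hp := Real.pi_pos
  have : (1 / 8 : ℂ) * (((Real.pi ^ 2 / (2 * √2) : ℝ) : ℂ) * ((2 * ∫ y, ρ y ^ (1 + 1) : ℝ) : ℂ) /
      (-2 * (Real.pi : ℂ)) ^ (1 + 1)) = ((1 / 8 * ((Real.pi ^ 2 / (2 * √2)) * (2 * ∫ y, ρ y ^ (1 + 1)) /
      (-2 * Real.pi) ^ (1 + 1)) : ℝ) : ℂ) := by push_cast; ring
  refine this.trans (congrArg Complex.ofReal ?_)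
  have h3 : (-2 * Real.pi) ^ (1 + 1) = 4 * Real.pi ^ 2 := by ring
  rw [h3]
  field_simp
  rw [sq, h2]; ring

/-! ### The sector -/

/-- The rotation `κ = -ik` moves the cone to the positive real axis. For `α ≤ 0` the sector is
empty, and `max α 0` merely keeps the aperture constant positive. The value `arg 0 = 0` excludes `k
= 0`, because `α < π/2`. -/
theorem exists_of_mem_sector {α : ℝ} (hα : α < Real.pi / 2) {lam : ℂ} (h : lam ∈ sector α) :
    ∃ κ : ℂ, 0 < κ.re ∧ Real.cos (max α 0) * ‖κ‖ ≤ κ.re ∧ lam = κ ^ 2 := by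
  obtain ⟨k, hk, hk2⟩ := h
  have hk' : |k.arg - Real.pi / 2| < α := hk
  have hα0 : 0 < α := (abs_nonneg _).trans_lt hk'
  have hp := Real.pi_pos
  have hk0 : k ≠ 0 := by
    rintro rfl
    rw [Complex.arg_zero, zero_sub, abs_neg, abs_of_pos (by positivity)] at hk'
    linarith
  have hre : (-Complex.I * k).re = ‖k‖ * Real.cos (k.arg - Real.pi / 2) := by
    rw [Real.cos_sub_pi_div_two, Complex.norm_mul_sin_arg]; simp
  have hcos : Real.cos α ≤ Real.cos (k.arg - Real.pi / 2) := by
    rw [← Real.cos_abs (k.arg - Real.pi / 2)]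
    exact Real.cos_le_cos_of_nonneg_of_le_pi (abs_nonneg _) (by linarith) hk'.le
  have hcα : 0 < Real.cos α := Real.cos_pos_of_mem_Ioo ⟨by linarith, hα⟩
  have hn : ‖-Complex.I * k‖ = ‖k‖ := by simp
  refine ⟨-Complex.I * k, ?_, ?_, ?_⟩
  · rw [hre]; exact mul_pos (norm_pos_iff.2 hk0) (hcα.trans_le hcos)
  · rw [hre, hn, max_eq_left hα0.le, mul_comm]
    gcongr
  · rw [mul_pow, hk2, neg_sq, Complex.I_sq]; ring

/-- For `Re κ > 0` the argument of `κ` lies in `(-π/2, π/2)`, so `log κ² = 2 log κ` on the principal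
branch. -/
theorem sq_cpow_neg {κ : ℂ} (hκ : 0 < κ.re) (m : ℕ) :
    (κ ^ 2) ^ (-((m : ℂ) / 2 + 1)) = (κ⁻¹) ^ (m + 2) := by
  have h0 : κ ≠ 0 := by rintro rfl; simp at hκ
  have harg := abs_lt.1 (Complex.abs_arg_lt_pi_div_two_iff.2 (Or.inl hκ))
  have hlog : Complex.log (κ ^ 2) = ((2 : ℕ) : ℂ) * Complex.log κ := by
    rw [← Complex.exp_log h0, ← Complex.exp_nat_mul, Complex.exp_log h0, Complex.log_exp]
    · simp only [Nat.cast_ofNat, Complex.re_ofNat, Complex.im_ofNat, Complex.mul_im, Complex.log_im]; linarith [harg.1]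
    · simp only [Nat.cast_ofNat, Complex.re_ofNat, Complex.im_ofNat, Complex.mul_im, Complex.log_im]; linarith [harg.2]
  rw [Complex.cpow_def_of_ne_zero (pow_ne_zero 2 h0), hlog]
  rw [show (((2 : ℕ) : ℂ) * Complex.log κ) * (-((m : ℂ) / 2 + 1)) = ((m + 2 : ℕ) : ℂ) * (-Complex.log κ) by
    push_cast; ring, Complex.exp_nat_mul, Complex.exp_neg, Complex.exp_log h0]

theorem sq_rpow_neg {r : ℝ} (hr : 0 ≤ r) (M : ℕ) :
    (r ^ 2) ^ (-((M : ℝ) / 2 + 1)) = (r⁻¹) ^ (M + 2) := by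
  rw [← Real.rpow_natCast r 2, ← Real.rpow_mul hr, inv_pow, ← Real.rpow_natCast, ← Real.rpow_neg hr]
  congr 1; push_cast; ring

end DeltaDiagonal

end

open DeltaDiagonal in
theorem mainTheorem1 (ρ : ℝ → ℝ) (hρ : ContDiff ℝ ∞ ρ) (hρc : HasCompactSupport ρ) :
    (∀ α : ℝ, α < Real.pi / 2 →
      (∀ᶠ lam in Bornology.cobounded ℂ ⊓ 𝓟 (sector α),
        InResolventSet ρ (-lam) ∧ InResolventSet (fun _ => 0) (-lam) ∧
          HasTrace (regResolvent ρ (-lam)) (trReg ρ (-lam))) ∧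
      ∀ M : ℕ,
        (fun lam : ℂ => trReg ρ (-lam) -
            ∑ m ∈ Finset.range M, bCoeff ρ m * lam ^ (-((m : ℂ) / 2 + 1)))
          =O[Bornology.cobounded ℂ ⊓ 𝓟 (sector α)]
        (fun lam : ℂ => ‖lam‖ ^ (-((M : ℝ) / 2 + 1)))) ∧
    (∀ (n : ℕ) (a : Fin n → ℕ) (s : Fin n → ℤˣ), IntegrableOn (cIntegrand a s) (cDomain n)) ∧
    bCoeff ρ 0 = ((-(1 / (4 * Real.pi)) * ∫ y : ℝ, ρ y : ℝ) : ℂ) ∧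
    bCoeff ρ 1 = ((Real.sqrt 2 / 64 * ∫ y : ℝ, ρ y ^ 2 : ℝ) : ℂ) := by
  refine ⟨fun α hα => ?_, fun n a s => integrableOn_cIntegrand a s, bCoeff_zero ρ, bCoeff_one ρ⟩
  have hδ0 : 0 < Real.cos (max α 0) :=
    Real.cos_pos_of_mem_Ioo ⟨by linarith [le_max_right α 0, Real.pi_pos], max_lt hα (by positivity)⟩
  obtain ⟨R, hR⟩ := trReg_expansion hρ hρc hδ0 (Real.cos_le_one _)
  have hlarge : ∀ᶠ lam in Bornology.cobounded ℂ ⊓ 𝓟 (sector α), ∃ κ : ℂ, 0 < κ.re ∧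
      Real.cos (max α 0) * ‖κ‖ ≤ κ.re ∧ R ≤ ‖κ‖ ∧ lam = κ ^ 2 := by
    rw [eventually_inf_principal]
    filter_upwards [eventually_cobounded_le_norm (R ^ 2)] with lam hlam hs
    obtain ⟨κ, h1, h2, rfl⟩ := exists_of_mem_sector hα hs
    rw [norm_pow] at hlam
    exact ⟨κ, h1, h2, (le_abs_self R).trans (abs_le_of_sq_le_sq hlam (norm_nonneg κ)), rfl⟩
  constructor
  -- The existence statements are the same for every `M`; any value would do.
  · obtain ⟨C, hC⟩ := hR 0
    filter_upwards [hlarge] with lam hlam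
    obtain ⟨κ, h1, h2, h3, rfl⟩ := hlam
    exact (hC κ h1 h2 h3).1
  · intro M
    obtain ⟨C, hC⟩ := hR M
    refine Asymptotics.IsBigO.of_bound C ?_
    filter_upwards [hlarge] with lam hlam
    obtain ⟨κ, h1, h2, h3, rfl⟩ := hlam
    simp_rw [sq_cpow_neg h1]
    rw [norm_pow, sq_rpow_neg (norm_nonneg κ), Real.norm_of_nonneg (by positivity)]
    exact (hC κ h1 h2 h3).2
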